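/- Let $m\ge 2$ and let $e_1,\dots,e_m$ be the canonical basis of $\mathbb R^m$. Put $w_k=-e_k+e_{k+1}$ for $1\le k\le m-1$ and $w_m=2e_1-e_m$. For $V\in\mathbb N^m\setminus\{0\}$, let $(L(t)^V)_{t\ge 0}$ be the right-continuous continuous-time Markov process on $\mathbb N^m$ started at $V$ whose infinitesimal generator is $$\mathcal G f(X)=\sum_{k=1}^m (m+k-1)\,x_k\,\bigl[f(X+w_k)-f(X)\bigr],\qquad X=(x_1,\dots,x_m)$$ (each particle of type $k$ lives an exponential time of parameter $m+k-1$, and is then replaced by one particle of type $k+1$ if $k<m$, by two particles of type $1$ if $k=m$). Let $R_m$ be the $m\times m$ matrix whose $k$-th row is $-(m+k-1)e_k+(m+k)e_{k+1}$ for $k<m$ and $2m\,e_1-(2m-1)e_m$ for $k=m$. Let $\lambda_2$ be the eigenvalue of $R_m$ which has a positive imaginary part and the largest real part among the eigenvalues other than $1$, and assume that $\Re\lambda_2>\tfrac12$ (large phase). Let $$u_2(x_1,\dots,x_m)=\sum_{k=1}^m\Bigl(\prod_{j=0}^{k-2}\frac{\lambda_2+m+j}{1+m+j}\Bigr)x_k,\qquad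 P=\mathrm{Diag}(m,m+1,\dots,2m-1).$$ For $1\le k\le m$ the limit $W_k=\lim_{t\to\infty}e^{-\lambda_2 t}\,u_2\bigl(P\,L(t)^{e_k}\bigr)$ exists almost surely. Let $\varphi_k(z)=\mathbb E\,e^{\langle z,W_k\rangle}$ be the Laplace transform of $W_k$, where $\langle z,w\rangle=z\overline w$, and let $\mathcal D\subseteq\mathbb C$ be the interior of the set of all $z$ such that $\mathbb E\,e^{\Re(z\overline{W_k})}<\infty$ for every $k\in\{1,\dots,m\}$. Then $0\in\mathcal D$. For any continuous determination of the logarithm on an open set $U\subseteq\mathbb C\setminus\{0\}$, let, for $z\in U$ with $z^{-\overline{\lambda_2}}\in\mathcal D$, $$\psi_k(z)=c_k\,\frac{\varphi_k\bigl(z^{-\overline{\lambda_2}}\bigr)}{z^{m+k-1}},\qquad c_k=(-1)^{m+k-1}\,\frac{(2m-1)!\,(m+k-2)!}{\bigl((m-1)!\bigr)^2}.$$ Then, at every $z\in U$ with $z^{-\overline{\lambda_2}}\in\mathcal D$, the functions $\psi_k$ are complex differentiable and $$\psi_k'=\psi_{k+1}\quad(1\le k\le m-1),\qquad \psi_m'=\psi_1^2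 .$$ In particular $\psi_1$ is a solution of the differential equation $y^{(m)}=y^2$. If instead $\langle z,w\rangle=\Re(\overline z\,w)$ is the real scalar product of the plane, then the same equations hold at the same points, the derivative with respect to $z$ at a point $z_0$ being now taken along the open half-line $\{rz_0: r>0\}$ only (in particular on the half-line $(0,\infty)$). -/

import Mathlib

open MeasureTheory ProbabilityTheory Filter Topology
open scoped NNReal

noncomputable section

namespace BTree

/-- Compositions of the fringe: `X k` is the number of particles (fringe nodes) of the `k`-th
type. Types are numbered from `0` to `m - 1`, so index `k` here is the type usually called `k + 1`;
a fringe node of index `k` has `m + k` gaps. -/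
abbrev State (m : ℕ) : Type := Fin m → ℕ

/-- What replaces a particle of index `k`: one particle of index `k + 1` if `k + 1 < m`,
two particles of index `0` if `k` is the last index. -/
def offspring {m : ℕ} (k : Fin m) : State m := fun j =>
  if k.val + 1 < m then (if j.val = k.val + 1 then 1 else 0)
  else (if j.val = 0 then 2 else 0)

/-- The composition `X + w_k`: one particle of index `k` is removed and replaced by its offspring.
It is only used with a coefficient that vanishes when `X k = 0`. -/
def step {m : ℕ} (X : State m) (k : Fin m) : State m :=
  X - Pi.single k 1 + offspring k

/-- The infinitesimal generator of the continuous-time fringe node process: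
`f ↦ ∑ k, (m + k) * X k * (f (X + w_k) - f X)`. -/
def gen {m : ℕ} (f : State m → ℝ) (X : State m) : ℝ :=
  ∑ k : Fin m, ((m : ℝ) + (k.val : ℝ)) * (X k : ℝ) * (f (step X k) - f X)

/-- `L` is a continuous-time fringe node process started at `V`: a Markov jump process on `ℕ^m`
with right-continuous paths and infinitesimal generator `gen`, given as the solution of the
martingale problem for `gen` (with finitely supported test functions) in its natural filtration. -/
structure IsFringeProcess {m : ℕ} {Ω : Type*} [MeasurableSpace Ω] (μ : Measure Ω)
    (V : State m) (L : ℝ≥0 → Ω → State m) : Prop where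
  measurable : ∀ t, Measurable (L t)
  rightCont : ∀ ω t, ContinuousWithinAt (fun s => L s ω) (Set.Ici t) t
  init : ∀ᵐ ω ∂μ, L 0 ω = V
  martingale : ∀ f : State m → ℝ, f.support.Finite →
    Martingale (fun (t : ℝ≥0) (ω : Ω) =>
        f (L t ω) - ∫ s in (0 : ℝ)..(t : ℝ), gen f (L s.toNNReal ω))
      (Filtration.natural L fun t => (measurable t).stronglyMeasurable) μ

/-- The replacement matrix of the gap urn: row `k` is `-(m + k) e_k + (m + k + 1) e_{k+1}` for
`k + 1 < m`, and the last row is `-(2 m - 1) e_{m-1} + 2 m e_0`. -/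
def replacementMatrix (m : ℕ) : Matrix (Fin m) (Fin m) ℂ := fun k j =>
  (if j = k then -((m : ℂ) + (k.val : ℂ)) else 0)
    + (if j.val = k.val + 1 then (m : ℂ) + (k.val : ℂ) + 1 else 0)
    + (if k.val + 1 = m ∧ j.val = 0 then 2 * (m : ℂ) else 0)

/-- `l` is the eigenvalue of the replacement matrix with the second largest real part (the largest
one being that of the eigenvalue `1`) and a positive imaginary part. -/
structure IsSecondEigenvalue (m : ℕ) (l : ℂ) : Prop where
  hasEigenvalue : Module.End.HasEigenvalue (Matrix.toLin' (replacementMatrix m)) l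
  im_pos : 0 < l.im
  re_le : ∀ x : ℂ, Module.End.HasEigenvalue (Matrix.toLin' (replacementMatrix m)) x →
    x ≠ 1 → x.re ≤ l.re

/-- The linear form `u(l)` on `ℂ^m`. -/
def eigenform (m : ℕ) (l : ℂ) (x : Fin m → ℂ) : ℂ :=
  ∑ k : Fin m, (∏ j ∈ Finset.range k.val, (l + (m : ℂ) + (j : ℂ)) / (1 + (m : ℂ) + (j : ℂ))) * x k

/-- The vector of the numbers of gaps of each type in the fringe `X`. -/
def gaps {m : ℕ} (X : State m) : Fin m → ℂ := fun k => ((m : ℂ) + (k.val : ℂ)) * (X k : ℂ)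

/-- `W` is the limit random variable of the process `L` in the direction `l`:
`W = lim_{t → ∞} exp (- l t) u(l) (P L(t))` almost surely. -/
def IsLimitVariable {m : ℕ} {Ω : Type*} [MeasurableSpace Ω] (μ : Measure Ω) (l : ℂ)
    (L : ℝ≥0 → Ω → State m) (W : Ω → ℂ) : Prop :=
  Measurable W ∧
    ∀ᵐ ω ∂μ, Tendsto (fun t : ℝ≥0 => Complex.exp (-l * ((t : ℝ) : ℂ))
      * eigenform m l (gaps (L t ω))) atTop (𝓝 (W ω))

/-- Laplace transform `z ↦ E exp ⟨z, W⟩` for the Hermitian product `⟨z, w⟩ = z * conj w`. -/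
def laplace {Ω : Type*} [MeasurableSpace Ω] (μ : Measure Ω) (W : Ω → ℂ) (z : ℂ) : ℂ :=
  ∫ ω, Complex.exp (z * (starRingEnd ℂ) (W ω)) ∂μ

/-- Laplace transform `z ↦ E exp ⟨z, W⟩` for the real scalar product
`⟨z, w⟩ = Re (conj z * w)` of the plane. -/
def realLaplace {Ω : Type*} [MeasurableSpace Ω] (μ : Measure Ω) (W : Ω → ℂ) (z : ℂ) : ℂ :=
  ((∫ ω, Real.exp (inner ℝ z (W ω)) ∂μ : ℝ) : ℂ)

/-- The open set on which all the Laplace transforms of a finite family of random variables are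
given by absolutely convergent integrals (for both products, since `Re (z * conj w)` is the real
scalar product of `z` and `w`). -/
def laplaceDomain {m : ℕ} {Ω : Fin m → Type*} [∀ k, MeasurableSpace (Ω k)]
    (μ : ∀ k, Measure (Ω k)) (W : ∀ k, Ω k → ℂ) : Set ℂ :=
  interior {z : ℂ | ∀ k, Integrable (fun ω => Real.exp (inner ℝ z (W k ω))) (μ k)}

/-- `(-1)^(m+k) (2m-1)! (m+k-1)! / ((m-1)!)^2`, the coefficient in the change of function. -/
def psiCoeff (m k : ℕ) : ℂ :=
  (-1) ^ (m + k) * (((2 * m - 1).factorial : ℂ) * ((m + k - 1).factorial : ℂ)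
    / ((m - 1).factorial : ℂ) ^ 2)

/-- The power `z ^ (- conj l)` for the determination `ℓ` of the logarithm. -/
def negConjPow (l : ℂ) (ℓ : ℂ → ℂ) (z : ℂ) : ℂ :=
  Complex.exp (-(starRingEnd ℂ) l * ℓ z)

/-- The change of function `ψ_k(z) = c_k φ_k (z ^ (- conj l)) / z ^ (m + k)`. -/
def psi {m : ℕ} (l : ℂ) (ℓ : ℂ → ℂ) (φ : Fin m → ℂ → ℂ) (k : Fin m) (z : ℂ) : ℂ :=
  psiCoeff m k.val * (φ k (negConjPow l ℓ z) / z ^ (m + k.val))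

/-- The open half-line from the origin through `z`. -/
def ray (z : ℂ) : Set ℂ := {w | ∃ r : ℝ, 0 < r ∧ w = (r : ℂ) * z}

end BTree

end

/-! Write `v` for the coefficients of the eigenform. A jump of a particle of index `k` adds `l * v
k` to `weightForm v` and exactly one to the number of gaps. Hence `exp (-l t) * weightForm v (L t)`
is a martingale. The number of gaps grows like `exp t`, so the quadratic variation of this
martingale has a density of order `exp ((1 - 2 Re l) t)`, which is integrable in the large phase.
This yields the limits `W k` and exponential moments near `0` (`exists_integral_exp_scaledForm_le`,
`ae_tendsto_scaledForm`).

The relation between the `W k` expresses the branching property, reached here through generating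
functions. If `σ` solves `σ_k' = (m + k) (offspringGF σ k - σ_k)`, then `∏ j, σ (t - r) j ^ X j` is
space-time harmonic, so the generating functions of the process follow this equation
(`integral_prod_pow`). For suitable initial values of modulus one, letting time go to infinity shows
that the characteristic functions of the `W k` satisfy the same equation along the flow `z ↦ exp
(conj l * h) z` (`integral_cexp_flow`).

These characteristic functions are the restrictions to the real subspace `conj a + b = 0` of the
holomorphic functions `E exp (a W + b conj W)`, defined on the tube `conj a + b ∈ laplaceDomain`.
Both members of the branching equation are holomorphic there, so it extends to the tube
(`branchingDefect_eq_zero`). The Hermitian Laplace transform is the value at `(0, z)`, the real one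
the value at `(conj z / 2, z / 2)`.

Finally, put `ζ = z ^ (-conj l)`, so that `z ζ' = -conj l * ζ`. The branching equation becomes `z
(φ_k ∘ ζ)' = -(m + k) (offspringGF φ k - φ_k)`. Division by `z ^ (m + k)` removes the linear term,
the remaining powers of `z` fit since `m + (m - 1) + 1 = 2 m`, and the constants `psiCoeff` absorb
the factors `-(m + k)`. For the real product, `a` and `b` are conjugate and must move together along
the flow in real time, which confines `z` to a half-line. -/

namespace BTree

/-! ### Combinatorics of the fringe: jumps, gap count and generator -/

/-- The total number of gaps of a fringe composition. -/
def gapCount {m : ℕ} (X : State m) : ℕ := ∑ k : Fin m, (m + k.val) * X k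

/-- With `X k ≠ 0` the truncated subtraction in `step` is a genuine one, so an additive functional
changes by an amount that depends on `k` only. -/
theorem sum_step {m : ℕ} {R : Type*} [CommRing R] (a : Fin m → R) {X : State m} {k : Fin m}
    (hk : X k ≠ 0) :
    ∑ j, a j * (step X k j : R)
      = ∑ j, a j * (X j : R) + (∑ j, a j * (offspring k j : R) - a k) := by
  have h : ∀ j, (step X k j : R) = (X j : R) - (if j = k then 1 else 0) + (offspring k j : R) := by
    intro j
    have h1 : (Pi.single k 1 : State m) j ≤ X j := by
      by_cases hj : j = k
      · subst hj; simp; omega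
      · simp [hj]
    simp only [step, Pi.add_apply, Pi.sub_apply, Nat.cast_add, Nat.cast_sub h1]
    congr 2
    simp [Pi.single_apply]
  simp only [h, mul_add, mul_sub, Finset.sum_add_distrib, Finset.sum_sub_distrib]
  simp
  ring

theorem prod_step {m : ℕ} {R : Type*} [CommRing R] (s : Fin m → R) (X : State m) (k : Fin m) :
    ∏ j, s j ^ step X k j
      = (∏ j, s j ^ (X - Pi.single k 1 : State m) j) * ∏ j, s j ^ offspring k j := by
  simp only [step, Pi.add_apply, pow_add, Finset.prod_mul_distrib]

theorem sum_mul_offspring_of_lt {m : ℕ} {R : Type*} [CommRing R] (a : Fin m → R) (k : Fin m)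
    (hk : k.val + 1 < m) : ∑ j, a j * (offspring k j : R) = a ⟨k.val + 1, hk⟩ := by
  rw [Finset.sum_eq_single ⟨k.val + 1, hk⟩]
  · simp [offspring, hk]
  · intro j _ hj
    have : j.val ≠ k.val + 1 := fun h => hj (Fin.ext h)
    simp [offspring, hk, this]
  · simp

theorem sum_mul_offspring_of_not_lt {m : ℕ} {R : Type*} [CommRing R] (a : Fin m → R) (k : Fin m)
    (hk : ¬ k.val + 1 < m) : ∑ j, a j * (offspring k j : R) = 2 * a ⟨0, k.pos⟩ := by
  rw [Finset.sum_eq_single ⟨0, k.pos⟩]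
  · simp [offspring, hk]; ring
  · intro j _ hj
    have : j.val ≠ 0 := fun h => hj (Fin.ext h)
    simp [offspring, hk, this]
  · simp

theorem prod_pow_offspring {m : ℕ} {R : Type*} [CommRing R] (s : Fin m → R) (k : Fin m) :
    ∏ j, s j ^ offspring k j
      = if hk : k.val + 1 < m then s ⟨k.val + 1, hk⟩ else s ⟨0, k.pos⟩ ^ 2 := by
  split_ifs with hk
  · rw [Finset.prod_eq_single ⟨k.val + 1, hk⟩]
    · simp [offspring, hk]
    · intro j _ hj
      have : j.val ≠ k.val + 1 := fun h => hj (Fin.ext h)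
      simp [offspring, hk, this]
    · simp
  · rw [Finset.prod_eq_single ⟨0, k.pos⟩]
    · simp [offspring, hk]
    · intro j _ hj
      have : j.val ≠ 0 := fun h => hj (Fin.ext h)
      simp [offspring, hk, this]
    · simp

/-- The weights `v` define an eigenvector of the replacement mechanism: replacing a particle of
index `k` changes the linear form `∑ j, (m + j) * v j * X j` by `l * v k`. -/
def IsEigenweight {m : ℕ} (l : ℂ) (v : Fin m → ℂ) : Prop :=
  ∀ k : Fin m, ∑ j : Fin m, ((m : ℂ) + j.val) * v j * (offspring k j : ℂ)
    - ((m : ℂ) + k.val) * v k = l * v k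

/-- The linear form `∑ j, (m + j) * v j * X j`. -/
def weightForm {m : ℕ} (v : Fin m → ℂ) (X : State m) : ℂ :=
  ∑ j : Fin m, ((m : ℂ) + j.val) * v j * (X j : ℂ)

theorem IsEigenweight.weightForm_step {m : ℕ} {l : ℂ} {v : Fin m → ℂ} (hv : IsEigenweight l v)
    {X : State m} {k : Fin m} (hk : X k ≠ 0) :
    weightForm v (step X k) = weightForm v X + l * v k := by
  rw [weightForm, sum_step _ hk, hv k, weightForm]

theorem isEigenweight_one {m : ℕ} : IsEigenweight (m := m) 1 (fun _ => 1) := by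
  intro k
  by_cases hk : k.val + 1 < m
  · rw [sum_mul_offspring_of_lt _ _ hk]; push_cast; ring
  · rw [sum_mul_offspring_of_not_lt _ _ hk]
    have : (m : ℂ) = k.val + 1 := by
      have : m = k.val + 1 := by omega
      exact_mod_cast this
    rw [this]; push_cast; ring

theorem weightForm_one {m : ℕ} (X : State m) : weightForm (fun _ => 1) X = gapCount X := by
  simp [weightForm, gapCount]

/-- The gap count is the linear form of the eigenvalue `1`. All truncation arguments rest on this:
the finite box of the compositions with at most `N` gaps is left only through the layer of exactly
`N` gaps, and never entered again. -/
theorem gapCount_step {m : ℕ} {X : State m} {k : Fin m} (hk : X k ≠ 0) :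
    gapCount (step X k) = gapCount X + 1 := by
  have := isEigenweight_one.weightForm_step hk
  rw [weightForm_one, weightForm_one] at this
  exact_mod_cast (by simpa using this : (gapCount (step X k) : ℂ) = gapCount X + 1)

theorem le_gapCount {m : ℕ} (X : State m) (k : Fin m) : X k ≤ gapCount X := by
  have h1 : (m + k.val) * X k ≤ gapCount X :=
    Finset.single_le_sum (f := fun k : Fin m => (m + k.val) * X k) (fun _ _ => Nat.zero_le _)
      (Finset.mem_univ k)
  have : 0 < m + k.val := by have := k.pos; omega
  exact (Nat.le_mul_of_pos_left _ this).trans h1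

theorem finite_gapCount_le (m N : ℕ) : {X : State m | gapCount X ≤ N}.Finite := by
  refine (Set.finite_Iic (fun _ => N : State m)).subset fun X hX k => ?_
  exact (le_gapCount X k).trans hX

/-- The finite set of the compositions with at most `N` gaps. -/
noncomputable def stateBox (m N : ℕ) : Finset (State m) := (finite_gapCount_le m N).toFinset

@[simp] theorem mem_stateBox {m N : ℕ} {X : State m} : X ∈ stateBox m N ↔ gapCount X ≤ N := by
  simp [stateBox]

theorem sum_rate {m : ℕ} (X : State m) :
    ∑ k : Fin m, ((m : ℝ) + (k.val : ℝ)) * (X k : ℝ) = gapCount X := by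
  simp [gapCount]

theorem gen_congr {m : ℕ} {f g : State m → ℝ} {X : State m} (h : f X = g X)
    (h' : ∀ k, X k ≠ 0 → f (step X k) = g (step X k)) : gen f X = gen g X := by
  refine Finset.sum_congr rfl fun k _ => ?_
  by_cases hk : X k = 0
  · simp [hk]
  · rw [h, h' k hk]

theorem gen_eq_zero_of_lt {m N : ℕ} {f : State m → ℝ} (hf : ∀ X, N < gapCount X → f X = 0)
    (X : State m) (hX : N < gapCount X) : gen f X = 0 := by
  rw [gen_congr (g := fun _ => 0) (hf X hX)
    (fun k hk => hf _ (by rw [gapCount_step hk]; omega))]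
  simp [gen]

theorem gen_sum_mul {m : ℕ} {ι : Type*} (s : Finset ι) (c : ι → ℝ) (f : ι → State m → ℝ)
    (X : State m) : gen (fun Y => ∑ i ∈ s, c i * f i Y) X = ∑ i ∈ s, c i * gen (f i) X := by
  simp only [gen, ← Finset.sum_sub_distrib, Finset.mul_sum]
  rw [Finset.sum_comm]
  refine Finset.sum_congr rfl fun i _ => Finset.sum_congr rfl fun k _ => ?_
  ring

theorem abs_le_of_eq_zero_of_lt {m N : ℕ} {f : State m → ℝ}
    (hf : ∀ X, N < gapCount X → f X = 0) : ∃ C, 0 ≤ C ∧ ∀ X, |f X| ≤ C := by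
  refine ⟨∑ X ∈ stateBox m N, |f X|, Finset.sum_nonneg fun _ _ => abs_nonneg _, fun X => ?_⟩
  by_cases hX : gapCount X ≤ N
  · exact Finset.single_le_sum (f := fun X => |f X|) (fun _ _ => abs_nonneg _)
      (mem_stateBox.2 hX)
  · rw [hf X (by omega)]; simpa using Finset.sum_nonneg fun _ _ => abs_nonneg _

theorem support_finite_of_eq_zero {m N : ℕ} {f : State m → ℝ}
    (hf : ∀ X, N < gapCount X → f X = 0) : f.support.Finite := by
  refine (finite_gapCount_le m N).subset fun X hX => ?_
  by_contra h
  exact hX (hf X (by simpa using h))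

/-! ### Forward equation for functions supported in a box -/

section Trajectory

variable {m : ℕ} {Ω : Type*} [MeasurableSpace Ω] {μ : Measure Ω} {V : State m}
  {L : ℝ≥0 → Ω → State m}

/-- Each time is approached from the right by a grid of mesh `1 / (n + 1)`, where only countably
many `L (d n k)` occur. Joint measurability is what Fubini requires in `expOn_sub`. -/
theorem measurable_uncurry_of_rightCont (hm : ∀ t, Measurable (L t))
    (hc : ∀ ω t, ContinuousWithinAt (fun s => L s ω) (Set.Ici t) t) :
    Measurable (fun p : ℝ≥0 × Ω => L p.1 p.2) := by
  let d : ℕ → ℕ → ℝ≥0 := fun n k => ((k : ℝ≥0) + 1) / ((n : ℝ≥0) + 1)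
  have hd : ∀ n : ℕ, Measurable (fun p : ℝ≥0 × Ω => L (d n ⌊p.1 * ((n : ℝ≥0) + 1)⌋₊) p.2) := by
    intro n
    have h0 : ∀ (g : ℕ → Ω → State m) (q : ℝ≥0 → ℕ), (∀ k, Measurable (g k)) → Measurable q →
        Measurable (fun p : ℝ≥0 × Ω => g (q p.1) p.2) := fun g q hg hq =>
      (measurable_from_prod_countable_right (f := fun z : ℕ × Ω => g z.1 z.2) hg).comp
        ((hq.comp measurable_fst).prodMk measurable_snd)
    exact h0 (fun k => L (d n k)) (fun x => ⌊x * ((n : ℝ≥0) + 1)⌋₊) (fun k => hm (d n k))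
      (Nat.measurable_floor.comp (measurable_id.mul_const _))
  refine measurable_of_tendsto_metrizable hd (tendsto_pi_nhds.2 fun p => ?_)
  have hle : ∀ n : ℕ, p.1 ≤ d n ⌊p.1 * ((n : ℝ≥0) + 1)⌋₊ := fun n => by
    rw [le_div_iff₀ (by positivity)]
    exact (Nat.lt_floor_add_one _).le
  have hge : ∀ n : ℕ, d n ⌊p.1 * ((n : ℝ≥0) + 1)⌋₊ ≤ p.1 + 1 / ((n : ℝ≥0) + 1) := fun n => by
    simp only [d, add_div _ (1 : ℝ≥0)]
    gcongr
    rw [div_le_iff₀ (by positivity)]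
    exact Nat.floor_le (zero_le)
  have ht : Tendsto (fun n : ℕ => d n ⌊p.1 * ((n : ℝ≥0) + 1)⌋₊) atTop (𝓝[Set.Ici p.1] p.1) := by
    refine tendsto_nhdsWithin_iff.2 ⟨?_, Eventually.of_forall hle⟩
    refine tendsto_of_tendsto_of_tendsto_of_le_of_le tendsto_const_nhds ?_ hle hge
    have : Tendsto (fun n : ℕ => 1 / ((n : ℝ≥0) + 1)) atTop (𝓝 0) :=
      tendsto_one_div_add_atTop_nhds_zero_nat
    simpa using this.const_add p.1
  exact (hc p.2 p.1).tendsto.comp ht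

/-- The natural filtration of a fringe process. -/
noncomputable def IsFringeProcess.filtration (hL : IsFringeProcess μ V L) :
    Filtration ℝ≥0 ‹MeasurableSpace Ω› :=
  Filtration.natural L fun t => (hL.measurable t).stronglyMeasurable

/-- The expectation of `g (L t)` on the event `A`. -/
noncomputable def expOn (μ : Measure Ω) (L : ℝ≥0 → Ω → State m) (A : Set Ω) (g : State m → ℝ)
    (t : ℝ) : ℝ := ∫ ω in A, g (L t.toNNReal ω) ∂μ

theorem IsFringeProcess.measurable_real (hL : IsFringeProcess μ V L) :
    Measurable (fun p : ℝ × Ω => L p.1.toNNReal p.2) :=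
  (measurable_uncurry_of_rightCont hL.measurable hL.rightCont).comp
    ((measurable_real_toNNReal.comp measurable_fst).prodMk measurable_snd)

variable [IsProbabilityMeasure μ]

theorem IsFringeProcess.integrable_of_bounded (hL : IsFringeProcess μ V L) {g : State m → ℝ}
    {C : ℝ} (hg : ∀ X, |g X| ≤ C) (t : ℝ≥0) : Integrable (fun ω => g (L t ω)) μ :=
  Integrable.of_bound ((measurable_of_countable g).comp (hL.measurable t)).aestronglyMeasurable C
    (Eventually.of_forall fun _ => hg _)

theorem abs_expOn_le {g : State m → ℝ} {C : ℝ} (hg : ∀ X, |g X| ≤ C) (A : Set Ω) (t : ℝ) :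
    |expOn μ L A g t| ≤ C := by
  have hC : 0 ≤ C := (abs_nonneg _).trans (hg 0)
  have h1 := norm_setIntegral_le_of_norm_le_const (μ := μ) (s := A) (C := C)
    (f := fun ω => g (L t.toNNReal ω)) (measure_lt_top μ A) (fun ω _ => hg _)
  refine h1.trans (mul_le_of_le_one_right hC ?_)
  exact measureReal_le_one

/-- The martingale property integrated over `A`, followed by an exchange of the time integral and
the expectation. Keeping an event `A` of the past gives conditional statements without conditional
expectations. -/
theorem IsFringeProcess.expOn_sub (hL : IsFringeProcess μ V L) {N : ℕ} {f : State m → ℝ}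
    (hf : ∀ X, N < gapCount X → f X = 0) {s : ℝ≥0} {A : Set Ω}
    (hA : MeasurableSet[hL.filtration s] A) {a b : ℝ} (ha : (s : ℝ) ≤ a) (hab : a ≤ b) :
    expOn μ L A f b - expOn μ L A f a = ∫ r in a..b, expOn μ L A (gen f) r := by
  have hmart := hL.martingale f (support_finite_of_eq_zero hf)
  have ha0 : 0 ≤ a := s.2.trans ha
  have hb0 : 0 ≤ b := ha0.trans hab
  have hA' : MeasurableSet[hL.filtration a.toNNReal] A :=
    hL.filtration.mono ((Real.le_toNNReal_iff_coe_le ha0).2 ha) A hA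
  have hAm : MeasurableSet A := hL.filtration.le _ A hA
  have h1 := hmart.setIntegral_eq (Real.toNNReal_le_toNNReal hab) hA'
  obtain ⟨C, hC0, hC⟩ := abs_le_of_eq_zero_of_lt hf
  obtain ⟨C', hC0', hC'⟩ := abs_le_of_eq_zero_of_lt (gen_eq_zero_of_lt hf)
  have hfi : ∀ t, Integrable (fun ω => f (L t ω)) μ := hL.integrable_of_bounded hC
  have hmeas : Measurable (fun p : ℝ × Ω => gen f (L p.1.toNNReal p.2)) :=
    (measurable_of_countable (gen f)).comp hL.measurable_real
  have hint : ∀ t : ℝ≥0, Integrable (fun ω => ∫ r in (0 : ℝ)..(t : ℝ), gen f (L r.toNNReal ω)) μ :=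
    fun t => by
      have := (hfi t).sub (hmart.integrable t)
      refine this.congr (Eventually.of_forall fun ω => ?_)
      simp
  rw [integral_sub (hfi _).integrableOn (hint _).integrableOn,
    integral_sub (hfi _).integrableOn (hint _).integrableOn] at h1
  have hpath : ∀ ω (x y : ℝ), IntervalIntegrable (fun r => gen f (L r.toNNReal ω)) volume x y := by
    intro ω x y
    refine (intervalIntegrable_const (c := C')).mono_fun
      (hmeas.comp measurable_prodMk_right).aestronglyMeasurable ?_
    exact Eventually.of_forall fun r => by simpa [abs_of_nonneg hC0'] using hC' _
  have h2 : (∫ ω in A, (∫ r in (0 : ℝ)..(b.toNNReal : ℝ), gen f (L r.toNNReal ω)) ∂μ)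
      - (∫ ω in A, (∫ r in (0 : ℝ)..(a.toNNReal : ℝ), gen f (L r.toNNReal ω)) ∂μ)
      = ∫ ω in A, (∫ r in a..b, gen f (L r.toNNReal ω)) ∂μ := by
    rw [← integral_sub (hint _).integrableOn (hint _).integrableOn]
    refine integral_congr_ae (Eventually.of_forall fun ω => ?_)
    simp only [Real.coe_toNNReal _ ha0, Real.coe_toNNReal _ hb0]
    exact intervalIntegral.integral_interval_sub_left (hpath ω _ _) (hpath ω _ _)
  have h3 : ∫ ω in A, (∫ r in a..b, gen f (L r.toNNReal ω)) ∂μ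
      = ∫ r in a..b, expOn μ L A (gen f) r := by
    simp only [intervalIntegral.integral_of_le hab, expOn]
    refine integral_integral_swap (f := fun (ω : Ω) (r : ℝ) => gen f (L r.toNNReal ω)) ?_
    refine Integrable.of_bound (hmeas.comp measurable_swap).aestronglyMeasurable C' ?_
    exact Eventually.of_forall fun p => hC' _
  rw [← h3, ← h2]
  simp only [expOn]
  linarith

theorem IsFringeProcess.stronglyMeasurable_expOn (hL : IsFringeProcess μ V L) (A : Set Ω)
    (g : State m → ℝ) : StronglyMeasurable (expOn μ L A g) := by
  have h : StronglyMeasurable (fun p : ℝ × Ω => g (L p.1.toNNReal p.2)) :=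
    ((measurable_of_countable g).comp hL.measurable_real).stronglyMeasurable
  exact h.integral_prod_right

theorem IsFringeProcess.continuousOn_expOn (hL : IsFringeProcess μ V L) {N : ℕ}
    {f : State m → ℝ} (hf : ∀ X, N < gapCount X → f X = 0) {s : ℝ≥0} {A : Set Ω}
    (hA : MeasurableSet[hL.filtration s] A) :
    ContinuousOn (expOn μ L A f) (Set.Ici (s : ℝ)) := by
  obtain ⟨C', hC0', hC'⟩ := abs_le_of_eq_zero_of_lt (gen_eq_zero_of_lt hf)
  have key : ∀ a b : ℝ, (s : ℝ) ≤ a → a ≤ b →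
      |expOn μ L A f b - expOn μ L A f a| ≤ C' * (b - a) := by
    intro a b ha hab
    rw [hL.expOn_sub hf hA ha hab]
    have := intervalIntegral.norm_integral_le_of_norm_le_const (a := a) (b := b)
      (f := expOn μ L A (gen f)) (C := C') (fun r _ => abs_expOn_le hC' A r)
    rwa [abs_of_nonneg (by linarith : 0 ≤ b - a)] at this
  refine LipschitzOnWith.continuousOn (K := C'.toNNReal) (LipschitzOnWith.of_dist_le_mul ?_)
  intro x hx y hy
  rw [Real.coe_toNNReal _ hC0', Real.dist_eq, Real.dist_eq]
  rcases le_total x y with h | h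
  · rw [abs_sub_comm, abs_sub_comm x y, abs_of_nonneg (by linarith : 0 ≤ y - x)]
    exact key x y hx h
  · rw [abs_of_nonneg (by linarith : 0 ≤ x - y)]
    exact key y x hy h

theorem IsFringeProcess.hasDerivAt_expOn (hL : IsFringeProcess μ V L) {N : ℕ}
    {f : State m → ℝ} (hf : ∀ X, N < gapCount X → f X = 0) {s : ℝ≥0} {A : Set Ω}
    (hA : MeasurableSet[hL.filtration s] A) {t : ℝ} (ht : (s : ℝ) < t) :
    HasDerivAt (expOn μ L A f) (expOn μ L A (gen f) t) t := by
  have hcont := hL.continuousOn_expOn (gen_eq_zero_of_lt hf) hA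
  have h1 : HasDerivAt (fun u => ∫ r in (s : ℝ)..u, expOn μ L A (gen f) r)
      (expOn μ L A (gen f) t) t := by
    refine intervalIntegral.integral_hasDerivAt_right ?_ ?_ ?_
    · refine (hcont.mono ?_).intervalIntegrable
      rw [Set.uIcc_of_le ht.le]; exact Set.Icc_subset_Ici_self
    · exact (hL.stronglyMeasurable_expOn A (gen f)).stronglyMeasurableAtFilter
    · exact hcont.continuousAt (Ici_mem_nhds ht)
  refine (h1.const_add (expOn μ L A f s)).congr_of_eventuallyEq ?_
  filter_upwards [Ici_mem_nhds ht] with u hu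
  rw [← hL.expOn_sub hf hA le_rfl hu]; ring

/-- Writing a function supported in a box as a finite combination of indicators separates its values
from the law of the process. Time-dependent functions are then handled by the ordinary product rule.
-/
theorem expOn_eq_sum (hL : IsFringeProcess μ V L) {N : ℕ} {g : State m → ℝ}
    (hg : ∀ X, N < gapCount X → g X = 0) (A : Set Ω) (t : ℝ) :
    expOn μ L A g t = ∑ x ∈ stateBox m N, g x * expOn μ L A (Pi.single x 1) t := by
  have h1 : ∀ Y, g Y = ∑ x ∈ stateBox m N, g x * (Pi.single x 1 : State m → ℝ) Y := by
    intro Y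
    simp only [Pi.single_apply, mul_ite, mul_one, mul_zero, Finset.sum_ite_eq]
    split_ifs with h
    · rfl
    · exact hg Y (by simpa using h)
  simp only [expOn]
  rw [integral_congr_ae (Eventually.of_forall fun ω => h1 (L t.toNNReal ω)), integral_finsetSum]
  · simp only [integral_const_mul]
  · intro x _
    refine Integrable.const_mul ?_ _
    refine (hL.integrable_of_bounded (C := 1) (fun X => ?_) _).integrableOn
    simp only [Pi.single_apply]; split_ifs <;> simp

theorem single_eq_zero_of_lt {N : ℕ} {x : State m} (hx : gapCount x ≤ N) (X : State m)
    (hX : N < gapCount X) : (Pi.single x 1 : State m → ℝ) X = 0 := by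
  rw [Pi.single_apply, if_neg]
  rintro rfl
  omega

theorem IsFringeProcess.continuousOn_expOn_time (hL : IsFringeProcess μ V L) {N : ℕ}
    {f : ℝ → State m → ℝ} (hf : ∀ t X, N < gapCount X → f t X = 0) {s : ℝ≥0} {A : Set Ω}
    (hA : MeasurableSet[hL.filtration s] A)
    {S : Set ℝ} (hS : S ⊆ Set.Ici (s : ℝ)) (hc : ∀ X, ContinuousOn (fun t => f t X) S) :
    ContinuousOn (fun t => expOn μ L A (f t) t) S := by
  simp only [fun t => expOn_eq_sum hL (hf t) A t]
  refine continuousOn_finsetSum _ fun x hx => (hc x).mul ?_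
  exact (hL.continuousOn_expOn (single_eq_zero_of_lt (mem_stateBox.1 hx)) hA).mono hS

theorem IsFringeProcess.hasDerivAt_expOn_time (hL : IsFringeProcess μ V L) {N : ℕ}
    {f f' : ℝ → State m → ℝ} (hf : ∀ t X, N < gapCount X → f t X = 0)
    (hf' : ∀ t X, N < gapCount X → f' t X = 0) {s : ℝ≥0} {A : Set Ω}
    (hA : MeasurableSet[hL.filtration s] A) {t : ℝ} (ht : (s : ℝ) < t)
    (hd : ∀ X, HasDerivAt (fun t => f t X) (f' t X) t) :
    HasDerivAt (fun t => expOn μ L A (f t) t)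
      (expOn μ L A (fun X => f' t X + gen (f t) X) t) t := by
  simp only [fun t => expOn_eq_sum hL (hf t) A t]
  have h1 : HasDerivAt (fun t => ∑ x ∈ stateBox m N, f t x * expOn μ L A (Pi.single x 1) t)
      (∑ x ∈ stateBox m N, (f' t x * expOn μ L A (Pi.single x 1) t
        + f t x * expOn μ L A (gen (Pi.single x 1)) t)) t := by
    refine HasDerivAt.fun_sum fun x hx => (hd x).mul ?_
    exact hL.hasDerivAt_expOn (single_eq_zero_of_lt (mem_stateBox.1 hx)) hA ht
  convert h1 using 1
  rw [Finset.sum_add_distrib, ← expOn_eq_sum hL (hf' t) A t]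
  have hgen : ∀ Y, gen (f t) Y = ∑ x ∈ stateBox m N, f t x * gen (Pi.single x 1) Y := by
    intro Y
    rw [← gen_sum_mul]
    congr 1
    ext Z
    simp only [Pi.single_apply, mul_ite, mul_one, mul_zero, Finset.sum_ite_eq]
    split_ifs with h
    · rfl
    · exact hf t Z (by simpa using h)
  obtain ⟨C, hC0, hC⟩ := abs_le_of_eq_zero_of_lt (hf' t)
  obtain ⟨C', hC0', hC'⟩ := abs_le_of_eq_zero_of_lt (gen_eq_zero_of_lt (hf t))
  simp only [expOn]
  rw [integral_add (hL.integrable_of_bounded hC _).integrableOn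
    (hL.integrable_of_bounded hC' _).integrableOn]
  congr 1
  rw [integral_congr_ae (Eventually.of_forall fun ω => hgen (L t.toNNReal ω)),
    integral_finsetSum]
  · simp only [integral_const_mul]
  · intro x hx
    refine Integrable.const_mul ?_ _
    obtain ⟨D, -, hD⟩ := abs_le_of_eq_zero_of_lt
      (gen_eq_zero_of_lt (single_eq_zero_of_lt (mem_stateBox.1 hx)))
    exact (hL.integrable_of_bounded hD _).integrableOn

end Trajectory

/-! ### Superharmonic and harmonic functions beyond bounded support -/

/-- Restriction of a function to the compositions with at most `N` gaps. -/
def truncate {m : ℕ} (N : ℕ) (f : State m → ℝ) (X : State m) : ℝ :=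
  if gapCount X ≤ N then f X else 0

theorem truncate_of_le {m N : ℕ} {f : State m → ℝ} {X : State m} (h : gapCount X ≤ N) :
    truncate N f X = f X := if_pos h

theorem truncate_of_lt {m N : ℕ} {f : State m → ℝ} (X : State m) (h : N < gapCount X) :
    truncate N f X = 0 := if_neg (by omega)

theorem abs_truncate_le {m N : ℕ} (f : State m → ℝ) (X : State m) :
    |truncate N f X| ≤ |f X| := by
  unfold truncate
  split_ifs <;> simp

theorem tendsto_truncate {m : ℕ} (f : State m → ℝ) (X : State m) :
    Tendsto (fun N => truncate N f X) atTop (𝓝 (f X)) :=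
  tendsto_atTop_of_eventually_const (i₀ := gapCount X) fun _ hN => truncate_of_le hN

theorem gen_comp_gapCount {m : ℕ} (φ : ℕ → ℝ) (X : State m) :
    gen (fun Y => φ (gapCount Y)) X = gapCount X * (φ (gapCount X + 1) - φ (gapCount X)) := by
  rw [← sum_rate, Finset.sum_mul]
  refine Finset.sum_congr rfl fun k _ => ?_
  by_cases hk : X k = 0
  · simp [hk]
  · simp only [gapCount_step hk]

theorem gen_const_mul {m : ℕ} (c : ℝ) (f : State m → ℝ) (X : State m) :
    gen (fun Y => c * f Y) X = c * gen f X := by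
  simp only [gen, Finset.mul_sum]
  exact Finset.sum_congr rfl fun k _ => by ring

/-- The generator of the fringe process acting on complex functions. -/
noncomputable def complexGen {m : ℕ} (f : State m → ℂ) (X : State m) : ℂ :=
  ∑ k : Fin m, ((m : ℂ) + (k.val : ℂ)) * (X k : ℂ) * (f (step X k) - f X)

theorem re_complexGen {m : ℕ} (f : State m → ℂ) (X : State m) :
    (complexGen f X).re = gen (fun Y => (f Y).re) X := by
  simp only [complexGen, gen, Complex.re_sum]
  refine Finset.sum_congr rfl fun k _ => ?_
  have : ((m : ℂ) + (k.val : ℂ)) * (X k : ℂ) = (((m : ℝ) + (k.val : ℝ)) * (X k : ℝ) : ℝ) := by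
    push_cast; ring
  rw [this, Complex.re_ofReal_mul, Complex.sub_re]

theorem im_complexGen {m : ℕ} (f : State m → ℂ) (X : State m) :
    (complexGen f X).im = gen (fun Y => (f Y).im) X := by
  simp only [complexGen, gen, Complex.im_sum]
  refine Finset.sum_congr rfl fun k _ => ?_
  have : ((m : ℂ) + (k.val : ℂ)) * (X k : ℂ) = (((m : ℝ) + (k.val : ℝ)) * (X k : ℝ) : ℝ) := by
    push_cast; ring
  rw [this, Complex.im_ofReal_mul, Complex.sub_im]

section Trajectory

variable {m : ℕ} {Ω : Type*} [MeasurableSpace Ω] {μ : Measure Ω} {V : State m} {L : ℝ≥0 → Ω → State m}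

theorem IsFringeProcess.measurable_comp (hL : IsFringeProcess μ V L) {E : Type*}
    [MeasurableSpace E] (g : State m → E) (t : ℝ≥0) : Measurable fun ω => g (L t ω) :=
  (measurable_of_countable g).comp (hL.measurable t)

variable [IsProbabilityMeasure μ]

/-- Truncating a nonnegative function keeps it superharmonic: inside the box it can only lower the
values at the neighbours, and outside the box everything vanishes since jumps increase the gap
count. Monotone convergence then removes the truncation, without any integrability assumption. -/
theorem IsFringeProcess.setLIntegral_le_of_superharmonic (hL : IsFringeProcess μ V L)
    {f f' : ℝ → State m → ℝ} {s : ℝ≥0} {A : Set Ω} (hA : MeasurableSet[hL.filtration s] A)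
    (hf0 : ∀ t X, 0 ≤ f t X) (hd : ∀ t X, HasDerivAt (fun t => f t X) (f' t X) t)
    (hsup : ∀ t X, (s : ℝ) ≤ t → f' t X + gen (f t) X ≤ 0) {t : ℝ≥0} (hst : s ≤ t) :
    ∫⁻ ω in A, ENNReal.ofReal (f t (L t ω)) ∂μ ≤ ∫⁻ ω in A, ENNReal.ofReal (f s (L s ω)) ∂μ := by
  have htr0 : ∀ N t X, 0 ≤ truncate N (f t) X := fun N t X => by
    unfold truncate; split_ifs
    exacts [hf0 t X, le_rfl]
  have hdN : ∀ N t X, HasDerivAt (fun t => truncate N (f t) X) (truncate N (f' t) X) t := by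
    intro N t X
    by_cases h : gapCount X ≤ N
    · simpa only [truncate, h, if_true] using hd t X
    · simpa only [truncate, h, if_false] using hasDerivAt_const t (0 : ℝ)
  have hanti : ∀ N, AntitoneOn (fun r => expOn μ L A (truncate N (f r)) r) (Set.Ici (s : ℝ)) := by
    intro N
    have hder : ∀ r : ℝ, (s : ℝ) < r → HasDerivAt (fun r => expOn μ L A (truncate N (f r)) r)
        (expOn μ L A (fun X => truncate N (f' r) X + gen (truncate N (f r)) X) r) r := fun r hr =>
      hL.hasDerivAt_expOn_time (N := N) (fun t X => truncate_of_lt X)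
        (fun t X => truncate_of_lt X) hA hr (hdN N r)
    refine antitoneOn_of_deriv_nonpos (convex_Ici _) ?_ ?_ ?_
    · exact hL.continuousOn_expOn_time (N := N) (fun t X => truncate_of_lt X) hA subset_rfl
        fun X r _ => (hdN N r X).continuousAt.continuousWithinAt
    · rw [interior_Ici]
      exact fun r hr => (hder r hr).differentiableAt.differentiableWithinAt
    · rw [interior_Ici]
      intro r hr
      rw [(hder r hr).deriv]
      refine integral_nonpos fun ω => ?_
      set X := L r.toNNReal ω
      by_cases hX : gapCount X ≤ N
      · refine le_trans ?_ (hsup r X (le_of_lt hr))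
        simp only [truncate_of_le hX, gen]
        gcongr with k
        unfold truncate; split_ifs
        exacts [le_rfl, hf0 _ _]
      · have h1 := truncate_of_lt (f := f' r) X (not_le.1 hX)
        have h2 := gen_eq_zero_of_lt (fun X => truncate_of_lt (N := N) (f := f r) X) X (not_le.1 hX)
        simp only [h1, h2]; simp
  have hlint : ∀ N (r : ℝ≥0), ∫⁻ ω in A, ENNReal.ofReal (truncate N (f r) (L r ω)) ∂μ
      = ENNReal.ofReal (expOn μ L A (truncate N (f r)) r) := by
    intro N r
    obtain ⟨C, -, hC⟩ := abs_le_of_eq_zero_of_lt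
      (fun X => truncate_of_lt (N := N) (f := f r) X)
    rw [expOn, Real.toNNReal_coe, ofReal_integral_eq_lintegral_ofReal]
    · exact (hL.integrable_of_bounded hC _).integrableOn
    · exact Eventually.of_forall fun ω => htr0 _ _ _
  have hle : ∀ N, ∫⁻ ω in A, ENNReal.ofReal (truncate N (f t) (L t ω)) ∂μ
      ≤ ∫⁻ ω in A, ENNReal.ofReal (f s (L s ω)) ∂μ := by
    intro N
    rw [hlint]
    refine (ENNReal.ofReal_le_ofReal
      (hanti N (Set.mem_Ici.2 le_rfl) (Set.mem_Ici.2 hst) hst)).trans ?_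
    rw [← hlint]
    refine lintegral_mono fun ω => ENNReal.ofReal_le_ofReal ?_
    have := abs_truncate_le (N := N) (f s) (L s ω)
    rwa [abs_of_nonneg (htr0 _ _ _), abs_of_nonneg (hf0 _ _)] at this
  refine le_of_tendsto' (lintegral_tendsto_of_tendsto_of_monotone (μ := μ.restrict A)
    (f := fun N ω => ENNReal.ofReal (truncate N (f t) (L t ω)))
    (F := fun ω => ENNReal.ofReal (f t (L t ω))) ?_ ?_ ?_) hle
  · intro N
    exact (hL.measurable_comp (fun X => ENNReal.ofReal (truncate N (f t) X)) t).aemeasurable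
  · refine Eventually.of_forall fun ω N N' hN => ENNReal.ofReal_le_ofReal ?_
    unfold truncate
    split_ifs with h1 h2
    exacts [le_rfl, absurd (h1.trans hN) h2, hf0 _ _, le_rfl]
  · exact Eventually.of_forall fun ω =>
      (ENNReal.continuous_ofReal.tendsto _).comp (tendsto_truncate _ _)

theorem IsFringeProcess.integrable_of_superharmonic (hL : IsFringeProcess μ V L)
    {f f' : ℝ → State m → ℝ} (hf0 : ∀ t X, 0 ≤ f t X)
    (hd : ∀ t X, HasDerivAt (fun t => f t X) (f' t X) t)
    (hsup : ∀ t X, 0 ≤ t → f' t X + gen (f t) X ≤ 0) (t : ℝ≥0) :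
    Integrable (fun ω => f t (L t ω)) μ ∧ ∫ ω, f t (L t ω) ∂μ ≤ f 0 V := by
  have h1 := hL.setLIntegral_le_of_superharmonic (s := 0) (t := t) (A := Set.univ)
    MeasurableSet.univ hf0 hd (by simpa using hsup) zero_le
  rw [setLIntegral_univ, setLIntegral_univ] at h1
  have h2 : ∫⁻ ω, ENNReal.ofReal (f (0 : ℝ≥0) (L 0 ω)) ∂μ = ENNReal.ofReal (f 0 V) := by
    rw [lintegral_congr_ae (g := fun _ => ENNReal.ofReal (f 0 V))]
    · simp
    · filter_upwards [hL.init] with ω hω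
      simp [hω]
  rw [h2] at h1
  have hm := (hL.measurable_comp (f t) t).aestronglyMeasurable (μ := μ)
  have hint : Integrable (fun ω => f t (L t ω)) μ := by
    refine ⟨hm, ?_⟩
    rw [hasFiniteIntegral_iff_ofReal (Eventually.of_forall fun ω => hf0 _ _)]
    exact h1.trans_lt ENNReal.ofReal_lt_top
  refine ⟨hint, ?_⟩
  rw [← ofReal_integral_eq_lintegral_ofReal hint (Eventually.of_forall fun ω => hf0 _ _)] at h1
  exact (ENNReal.ofReal_le_ofReal_iff (hf0 _ _)).1 h1

theorem IsFringeProcess.integral_le_of_superharmonic (hL : IsFringeProcess μ V L)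
    {f f' : ℝ → State m → ℝ} {s : ℝ≥0} (hf0 : ∀ t X, 0 ≤ f t X)
    (hd : ∀ t X, HasDerivAt (fun t => f t X) (f' t X) t)
    (hsup : ∀ t X, (s : ℝ) ≤ t → f' t X + gen (f t) X ≤ 0) {t : ℝ≥0} (hst : s ≤ t)
    (hs : Integrable (fun ω => f s (L s ω)) μ) (ht : Integrable (fun ω => f t (L t ω)) μ) :
    ∫ ω, f t (L t ω) ∂μ ≤ ∫ ω, f s (L s ω) ∂μ := by
  have h1 := hL.setLIntegral_le_of_superharmonic (s := s) (t := t) (A := Set.univ)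
    MeasurableSet.univ hf0 hd hsup hst
  rw [setLIntegral_univ, setLIntegral_univ,
    ← ofReal_integral_eq_lintegral_ofReal hs (Eventually.of_forall fun ω => hf0 _ _),
    ← ofReal_integral_eq_lintegral_ofReal ht (Eventually.of_forall fun ω => hf0 _ _)] at h1
  exact (ENNReal.ofReal_le_ofReal_iff (integral_nonneg fun ω => hf0 _ _)).1 h1

/-- The gap count jumps by one at a rate equal to itself (a Yule process), and rising factorials are
the eigenfunctions of its generator. They provide all moments of the gap count. -/
theorem gen_ascFactorial {m : ℕ} (n : ℕ) (X : State m) :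
    gen (fun Y => ((gapCount Y).ascFactorial n : ℝ)) X = n * (gapCount X).ascFactorial n := by
  rw [gen_comp_gapCount (fun G => (G.ascFactorial n : ℝ))]
  have : (gapCount X : ℝ) * ((gapCount X + 1).ascFactorial n : ℝ)
      = (gapCount X + n) * (gapCount X).ascFactorial n := by
    exact_mod_cast Nat.succ_ascFactorial (gapCount X) n
  rw [mul_sub, this]; ring

theorem hasDerivAt_exp_neg_mul (a c t : ℝ) :
    HasDerivAt (fun t => Real.exp (-(a * t)) * c) (-a * (Real.exp (-(a * t)) * c)) t := by
  have h := (((hasDerivAt_id t).const_mul a).neg.exp).mul_const c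
  refine h.congr_deriv ?_
  simp only [Pi.neg_apply, id]
  ring

theorem superharmonic_ascFactorial (n : ℕ) (t : ℝ) (X : State m) :
    -(n : ℝ) * (Real.exp (-(n * t)) * (gapCount X).ascFactorial n)
      + gen (fun X => Real.exp (-(n * t)) * ((gapCount X).ascFactorial n : ℝ)) X ≤ 0 := by
  rw [gen_const_mul, gen_ascFactorial]
  apply le_of_eq; ring

theorem IsFringeProcess.integrable_ascFactorial (hL : IsFringeProcess μ V L) (n : ℕ) (t : ℝ≥0) :
    Integrable (fun ω => ((gapCount (L t ω)).ascFactorial n : ℝ)) μ ∧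
      ∫ ω, ((gapCount (L t ω)).ascFactorial n : ℝ) ∂μ
        ≤ Real.exp (n * t) * (gapCount V).ascFactorial n := by
  have h := hL.integrable_of_superharmonic
    (f := fun t X => Real.exp (-(n * t)) * ((gapCount X).ascFactorial n : ℝ))
    (fun t X => by positivity) (fun t X => hasDerivAt_exp_neg_mul n _ t)
    (fun t X _ => superharmonic_ascFactorial n t X) t
  have hpos : 0 < Real.exp (-(n * t)) := Real.exp_pos _
  have h1 : Integrable (fun ω => ((gapCount (L t ω)).ascFactorial n : ℝ)) μ :=
    (integrable_const_mul_iff (isUnit_iff_ne_zero.2 hpos.ne') _).1 h.1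
  refine ⟨h1, ?_⟩
  have h2 := h.2
  rw [integral_const_mul, Real.exp_neg, ← div_eq_inv_mul, div_le_iff₀ (Real.exp_pos _)] at h2
  simpa [mul_comm] using h2

theorem IsFringeProcess.integrable_gapCount (hL : IsFringeProcess μ V L) (t : ℝ≥0) :
    Integrable (fun ω => (gapCount (L t ω) : ℝ)) μ := by
  simpa [Nat.ascFactorial] using (hL.integrable_ascFactorial 1 t).1

/-- Truncation spoils harmonicity only on the layer of exactly `N` gaps. For a function of linear
growth the error there is at most `C * N * (N + 2)`, which is the third rising factorial of `N`
times `C / (N + 1)`. As the third rising factorial has bounded expectation on `[0, t]`, the total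
error is `O(1 / N)`. -/
theorem IsFringeProcess.setIntegral_eq_of_harmonic_real (hL : IsFringeProcess μ V L)
    {f f' : ℝ → State m → ℝ} {s : ℝ≥0} {A : Set Ω} (hA : MeasurableSet[hL.filtration s] A)
    {t : ℝ≥0} (hst : s ≤ t)
    (hc : ∀ X, ContinuousOn (fun r => f r X) (Set.Icc (s : ℝ) t))
    (hd : ∀ r X, (s : ℝ) < r → r < t → HasDerivAt (fun r => f r X) (f' r X) r)
    (hharm : ∀ r X, (s : ℝ) ≤ r → r ≤ t → f' r X + gen (f r) X = 0)
    {C : ℝ} (hC : ∀ r X, (s : ℝ) ≤ r → r ≤ t → |f r X| ≤ C * (1 + gapCount X)) :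
    ∫ ω in A, f t (L t ω) ∂μ = ∫ ω in A, f s (L s ω) ∂μ := by
  rcases hst.eq_or_lt with rfl | hlt
  · rfl
  have hlt' : (s : ℝ) < t := hlt
  have hC0 : 0 ≤ C := by
    have := (abs_nonneg _).trans (hC s 0 le_rfl hst)
    exact nonneg_of_mul_nonneg_left this (by positivity)
  have hdN : ∀ N r X, (s : ℝ) < r → r < t →
      HasDerivAt (fun r => truncate N (f r) X) (truncate N (f' r) X) r := by
    intro N r X h1 h2
    by_cases h : gapCount X ≤ N
    · simpa only [truncate, h, if_true] using hd r X h1 h2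
    · simpa only [truncate, h, if_false] using hasDerivAt_const r (0 : ℝ)
  have hcN : ∀ N X, ContinuousOn (fun r => truncate N (f r) X) (Set.Icc (s : ℝ) t) := by
    intro N X
    by_cases h : gapCount X ≤ N
    · simpa only [truncate, h, if_true] using hc X
    · simpa only [truncate, h, if_false] using continuousOn_const
  set K : ℝ := C * (Real.exp (3 * t) * (gapCount V).ascFactorial 3) with hK
  have hpt : ∀ (N : ℕ) (r : ℝ) (X : State m), (s : ℝ) ≤ r → r ≤ t →
      |truncate N (f' r) X + gen (truncate N (f r)) X|
        ≤ C / (N + 1) * (gapCount X).ascFactorial 3 := by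
    intro N r X hsr hrt
    rcases lt_trichotomy (gapCount X) N with hX | hX | hX
    · rw [truncate_of_le hX.le, gen_congr (g := f r) (truncate_of_le hX.le)
        (fun k hk => truncate_of_le (by rw [gapCount_step hk]; omega)), hharm r X hsr hrt]
      simp only [abs_zero]
      positivity
    -- All neighbours of a composition with exactly `N` gaps are cut off, so the harmonic identity
    -- misses precisely the terms `f r (step X k)`.
    · have h1 : truncate N (f' r) X + gen (truncate N (f r)) X
          = -∑ k : Fin m, ((m : ℝ) + (k.val : ℝ)) * (X k : ℝ) * f r (step X k) := by
        rw [truncate_of_le hX.le, eq_neg_iff_add_eq_zero, ← hharm r X hsr hrt, add_assoc]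
        congr 1
        simp only [gen, ← Finset.sum_add_distrib]
        refine Finset.sum_congr rfl fun k _ => ?_
        by_cases hk : X k = 0
        · simp [hk]
        · rw [truncate_of_le hX.le, truncate_of_lt (step X k) (by rw [gapCount_step hk]; omega)]
          ring
      rw [h1, abs_neg]
      have h2 : |∑ k : Fin m, ((m : ℝ) + (k.val : ℝ)) * (X k : ℝ) * f r (step X k)|
          ≤ ∑ k : Fin m, ((m : ℝ) + (k.val : ℝ)) * (X k : ℝ) * (C * (2 + gapCount X)) := by
        refine (Finset.abs_sum_le_sum_abs _ _).trans (Finset.sum_le_sum fun k _ => ?_)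
        by_cases hk : X k = 0
        · simp [hk]
        · rw [abs_mul, abs_of_nonneg (by positivity)]
          gcongr
          refine (hC r _ hsr hrt).trans (le_of_eq ?_)
          rw [gapCount_step hk]; push_cast; ring
      refine h2.trans (le_of_eq ?_)
      rw [← Finset.sum_mul, sum_rate]
      have h3 : ((gapCount X).ascFactorial 3 : ℝ) = gapCount X * (gapCount X + 1) * (gapCount X + 2)
          := by
        simp only [Nat.ascFactorial]; push_cast; ring
      rw [h3, ← hX]
      field_simp
      ring
    · rw [truncate_of_lt X hX, gen_eq_zero_of_lt
        (fun X => truncate_of_lt (N := N) (f := f r) X) X hX]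
      simp only [add_zero, abs_zero]
      positivity
  have hdiff : ∀ N : ℕ, |expOn μ L A (truncate N (f t)) t - expOn μ L A (truncate N (f s)) s|
      ≤ K * (t - s) / (N + 1) := by
    intro N
    obtain ⟨c, hc, hslope⟩ := exists_hasDerivAt_eq_slope
      (fun r => expOn μ L A (truncate N (f r)) r)
      (fun r => expOn μ L A (fun X => truncate N (f' r) X + gen (truncate N (f r)) X) r) hlt'
      (hL.continuousOn_expOn_time (N := N) (fun t X => truncate_of_lt X) hA
        Set.Icc_subset_Ici_self (hcN N))
      (fun r hr => hL.hasDerivAt_expOn_time (N := N) (fun t X => truncate_of_lt X)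
        (fun t X => truncate_of_lt X) hA hr.1 fun X => hdN N r X hr.1 hr.2)
    have hts : (0 : ℝ) < t - s := sub_pos.2 hlt'
    rw [eq_div_iff hts.ne'] at hslope
    rw [← hslope, abs_mul, abs_of_pos hts, mul_div_right_comm]
    gcongr
    have hc0 : (0 : ℝ) ≤ c := s.2.trans hc.1.le
    obtain ⟨hi, hle⟩ := hL.integrable_ascFactorial 3 c.toNNReal
    calc |expOn μ L A (fun X => truncate N (f' c) X + gen (truncate N (f c)) X) c|
        ≤ ∫ ω in A, |truncate N (f' c) (L c.toNNReal ω)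
            + gen (truncate N (f c)) (L c.toNNReal ω)| ∂μ := abs_integral_le_integral_abs
      _ ≤ ∫ ω in A, C / (N + 1) * (gapCount (L c.toNNReal ω)).ascFactorial 3 ∂μ := by
          refine integral_mono_of_nonneg (Eventually.of_forall fun ω => abs_nonneg _)
            (hi.const_mul _).integrableOn (Eventually.of_forall fun ω => ?_)
          exact hpt N c _ hc.1.le hc.2.le
      _ ≤ ∫ ω, C / (N + 1) * (gapCount (L c.toNNReal ω)).ascFactorial 3 ∂μ :=
          setIntegral_le_integral (hi.const_mul _) (Eventually.of_forall fun ω => by positivity)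
      _ ≤ K / (N + 1) := by
          rw [integral_const_mul, hK, div_mul_eq_mul_div]
          gcongr
          refine hle.trans ?_
          rw [Real.coe_toNNReal _ hc0]
          push_cast
          gcongr
          exact hc.2.le
  have hlim : ∀ r : ℝ≥0, (s : ℝ) ≤ r → (r : ℝ) ≤ t →
      Tendsto (fun N => expOn μ L A (truncate N (f r)) r) atTop
        (𝓝 (∫ ω in A, f r (L r ω) ∂μ)) := by
    intro r hsr hrt
    simp only [expOn, Real.toNNReal_coe]
    refine tendsto_integral_of_dominated_convergence
      (fun ω => C * (1 + gapCount (L r ω))) ?_ ?_ ?_ ?_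
    · exact fun N => (hL.measurable_comp (truncate N (f r)) r).aestronglyMeasurable
    · exact (((integrable_const (1 : ℝ)).add (hL.integrable_gapCount r)).const_mul C).integrableOn
    · exact fun N => Eventually.of_forall fun ω =>
        (abs_truncate_le _ _).trans (hC r _ hsr hrt)
    · exact Eventually.of_forall fun ω => tendsto_truncate _ _
  have h0 : Tendsto (fun N : ℕ => K * (t - s) / ((N : ℝ) + 1)) atTop (𝓝 0) :=
    tendsto_const_nhds.div_atTop (tendsto_natCast_atTop_atTop.atTop_add tendsto_const_nhds)
  have h1 := ((hlim t hst le_rfl).sub (hlim s le_rfl hst)).abs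
  have h2 := le_of_tendsto_of_tendsto' h1 h0 hdiff
  exact sub_eq_zero.1 (abs_nonpos_iff.1 h2)

theorem IsFringeProcess.integrable_of_norm_le (hL : IsFringeProcess μ V L) {E : Type*}
    [NormedAddCommGroup E] [MeasurableSpace E] [BorelSpace E] [SecondCountableTopology E]
    {f : State m → E} {C : ℝ} (hC : ∀ X, ‖f X‖ ≤ C * (1 + gapCount X)) (t : ℝ≥0) :
    Integrable (fun ω => f (L t ω)) μ :=
  (((integrable_const (1 : ℝ)).add (hL.integrable_gapCount t)).const_mul C).mono'
    (hL.measurable_comp f t).aestronglyMeasurable (Eventually.of_forall fun _ => hC _)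

theorem IsFringeProcess.setIntegral_eq_of_harmonic (hL : IsFringeProcess μ V L)
    {f f' : ℝ → State m → ℂ} {s : ℝ≥0} {A : Set Ω} (hA : MeasurableSet[hL.filtration s] A)
    {t : ℝ≥0} (hst : s ≤ t)
    (hc : ∀ X, ContinuousOn (fun r => f r X) (Set.Icc (s : ℝ) t))
    (hd : ∀ r X, (s : ℝ) < r → r < t → HasDerivAt (fun r => f r X) (f' r X) r)
    (hharm : ∀ r X, (s : ℝ) ≤ r → r ≤ t → f' r X + complexGen (f r) X = 0)
    {C : ℝ} (hC : ∀ r X, (s : ℝ) ≤ r → r ≤ t → ‖f r X‖ ≤ C * (1 + gapCount X)) :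
    ∫ ω in A, f t (L t ω) ∂μ = ∫ ω in A, f s (L s ω) ∂μ := by
  have hi : ∀ r : ℝ≥0, (s : ℝ) ≤ r → (r : ℝ) ≤ t → Integrable (fun ω => f r (L r ω)) μ :=
    fun r hsr hrt => hL.integrable_of_norm_le (fun X => hC r X hsr hrt) r
  have hre := hL.setIntegral_eq_of_harmonic_real (f := fun r X => (f r X).re)
    (f' := fun r X => (f' r X).re) hA hst
    (fun X => Complex.continuous_re.comp_continuousOn (hc X))
    (fun r X h1 h2 => Complex.reCLM.hasFDerivAt.comp_hasDerivAt r (hd r X h1 h2))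
    (fun r X h1 h2 => by rw [← re_complexGen, ← Complex.add_re, hharm r X h1 h2, Complex.zero_re])
    (fun r X h1 h2 => (Complex.abs_re_le_norm _).trans (hC r X h1 h2))
  have him := hL.setIntegral_eq_of_harmonic_real (f := fun r X => (f r X).im)
    (f' := fun r X => (f' r X).im) hA hst
    (fun X => Complex.continuous_im.comp_continuousOn (hc X))
    (fun r X h1 h2 => Complex.imCLM.hasFDerivAt.comp_hasDerivAt r (hd r X h1 h2))
    (fun r X h1 h2 => by rw [← im_complexGen, ← Complex.add_im, hharm r X h1 h2, Complex.zero_im])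
    (fun r X h1 h2 => (Complex.abs_im_le_norm _).trans (hC r X h1 h2))
  have e : ∀ r : ℝ≥0, (s : ℝ) ≤ r → (r : ℝ) ≤ t →
      ((∫ ω in A, f r (L r ω) ∂μ).re = ∫ ω in A, (f r (L r ω)).re ∂μ ∧
        (∫ ω in A, f r (L r ω) ∂μ).im = ∫ ω in A, (f r (L r ω)).im ∂μ) := fun r h1 h2 =>
    ⟨(Complex.reCLM.integral_comp_comm (hi r h1 h2).integrableOn).symm,
      (Complex.imCLM.integral_comp_comm (hi r h1 h2).integrableOn).symm⟩
  refine Complex.ext ?_ ?_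
  · rw [(e t hst le_rfl).1, (e s le_rfl hst).1, hre]
  · rw [(e t hst le_rfl).2, (e s le_rfl hst).2, him]

end Trajectory

/-! ### The rescaled linear form: martingale property and exponential moments -/

theorem complexGen_weightForm {m : ℕ} {l : ℂ} {v : Fin m → ℂ} (hv : IsEigenweight l v)
    (X : State m) : complexGen (weightForm v) X = l * weightForm v X := by
  rw [weightForm, Finset.mul_sum]
  refine Finset.sum_congr rfl fun k _ => ?_
  by_cases hk : X k = 0
  · simp [hk]
  · rw [hv.weightForm_step hk]; ring

theorem norm_weightForm_le {m : ℕ} {v : Fin m → ℂ} {C : ℝ} (hC : ∀ k, ‖v k‖ ≤ C)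
    (X : State m) : ‖weightForm v X‖ ≤ C * gapCount X := by
  rw [← sum_rate, Finset.mul_sum]
  refine (norm_sum_le _ _).trans (Finset.sum_le_sum fun k _ => ?_)
  have h : ‖(m : ℂ) + (k.val : ℂ)‖ = (m : ℝ) + k.val := by
    rw [← Nat.cast_add, Complex.norm_natCast]; push_cast; ring
  rw [norm_mul, norm_mul, h, Complex.norm_natCast]
  have := hC k
  calc ((m : ℝ) + k.val) * ‖v k‖ * X k ≤ ((m : ℝ) + k.val) * C * X k := by gcongr
    _ = C * (((m : ℝ) + k.val) * X k) := by ring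

theorem exists_norm_le {m : ℕ} (v : Fin m → ℂ) : ∃ C : ℝ, 0 ≤ C ∧ ∀ k, ‖v k‖ ≤ C :=
  ⟨‖v‖, norm_nonneg _, norm_le_pi_norm v⟩

/-- The rescaled linear form `exp (- l t) * weightForm v X`. -/
noncomputable def scaledForm {m : ℕ} (l : ℂ) (v : Fin m → ℂ) (t : ℝ) (X : State m) : ℂ :=
  Complex.exp (-l * (t : ℂ)) * weightForm v X

theorem hasDerivAt_scaledForm {m : ℕ} (l : ℂ) (v : Fin m → ℂ) (t : ℝ) (X : State m) :
    HasDerivAt (fun t => scaledForm l v t X) (-l * scaledForm l v t X) t := by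
  have h := ((((hasDerivAt_id t).ofReal_comp).const_mul (-l)).cexp).mul_const (weightForm v X)
  refine h.congr_deriv ?_
  simp only [scaledForm, id, Complex.ofReal_one]
  ring

theorem complexGen_scaledForm {m : ℕ} {l : ℂ} {v : Fin m → ℂ} (hv : IsEigenweight l v)
    (t : ℝ) (X : State m) :
    complexGen (scaledForm l v t) X = l * scaledForm l v t X := by
  have h := complexGen_weightForm hv X
  simp only [scaledForm, complexGen, ← mul_sub] at h ⊢
  rw [mul_left_comm l, ← h, Finset.mul_sum]
  exact Finset.sum_congr rfl fun k _ => by ring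

theorem norm_cexp_neg_mul (l : ℂ) (t : ℝ) :
    ‖Complex.exp (-l * (t : ℂ))‖ = Real.exp (-(l.re * t)) := by
  rw [Complex.norm_exp]; simp

section Trajectory

variable {m : ℕ} {Ω : Type*} [MeasurableSpace Ω] {μ : Measure Ω}
  {V : State m} {L : ℝ≥0 → Ω → State m} {l : ℂ} {v : Fin m → ℂ}

theorem IsFringeProcess.measurable_filtration (hL : IsFringeProcess μ V L) (t : ℝ≥0) :
    Measurable[hL.filtration t] (L t) :=
  ((Filtration.stronglyAdapted_natural
    (fun t => (hL.measurable t).stronglyMeasurable)) t).measurable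

/-- The state space is discrete, so a right-continuous path stays constant for some time after each
instant. -/
theorem IsFringeProcess.exists_eq_of_mem_Ico (hL : IsFringeProcess μ V L) (ω : Ω) (t : ℝ≥0) :
    ∃ u, t < u ∧ ∀ r ∈ Set.Ico t u, L r ω = L t ω := by
  have h : {r | L r ω = L t ω} ∈ 𝓝[≥] t :=
    (hL.rightCont ω t).preimage_mem_nhdsWithin ((isOpen_discrete {L t ω}).mem_nhds rfl)
  obtain ⟨u, hu, hsub⟩ := (mem_nhdsGE_iff_exists_Ico_subset).1 h
  exact ⟨u, hu, hsub⟩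

variable [IsProbabilityMeasure μ]

/-- The relation `R x` with the state `x` at time `s` holds at `x` and is preserved by every jump,
since a jump costs at most `C` and adds one gap. The indicator of its failure is therefore
superharmonic and starts from `0`. This controls paths without describing their jump times. -/
theorem IsFringeProcess.ae_norm_weightForm_sub_le_of_le (hL : IsFringeProcess μ V L)
    (hv : IsEigenweight l v) {C : ℝ} (hC : ∀ k, ‖l * v k‖ ≤ C) {s t : ℝ≥0} (hst : s ≤ t) :
    ∀ᵐ ω ∂μ, ‖weightForm v (L t ω) - weightForm v (L s ω)‖
      ≤ C * ((gapCount (L t ω) : ℝ) - gapCount (L s ω)) := by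
  classical
  let R : State m → State m → Prop := fun x Y =>
    ‖weightForm v Y - weightForm v x‖ ≤ C * ((gapCount Y : ℝ) - gapCount x)
  have hR : ∀ x Y k, R x Y → Y k ≠ 0 → R x (step Y k) := by
    intro x Y k h hk
    simp only [R] at h ⊢
    rw [hv.weightForm_step hk, gapCount_step hk]
    calc ‖weightForm v Y + l * v k - weightForm v x‖
        = ‖(weightForm v Y - weightForm v x) + l * v k‖ := by ring_nf
      _ ≤ C * ((gapCount Y : ℝ) - gapCount x) + C := (norm_add_le _ _).trans (add_le_add h (hC k))
      _ = _ := by push_cast; ring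
  let f : State m → State m → ℝ := fun x Y => if R x Y then 0 else 1
  have hgen : ∀ x Y, gen (f x) Y ≤ 0 := by
    intro x Y
    refine Finset.sum_nonpos fun k _ => ?_
    by_cases hk : Y k = 0
    · simp [hk]
    refine mul_nonpos_of_nonneg_of_nonpos (by positivity) ?_
    by_cases h : R x Y
    · simp [f, h, hR x Y k h hk]
    · simp only [f, h, if_false]; split_ifs <;> norm_num
  have key : ∀ x, ∀ᵐ ω ∂μ, L s ω = x → R x (L t ω) := by
    intro x
    have hA : MeasurableSet[hL.filtration s] (L s ⁻¹' {x}) :=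
      hL.measurable_filtration s (measurableSet_singleton x)
    have hAm : MeasurableSet (L s ⁻¹' {x}) := hL.filtration.le s _ hA
    have h := hL.setLIntegral_le_of_superharmonic (f := fun _ => f x) (f' := fun _ _ => 0) hA
      (fun _ Y => by simp only [f]; split_ifs <;> norm_num) (fun t _ => hasDerivAt_const t _)
      (fun _ Y _ => by simpa using hgen x Y) hst
    have h0 : ∫⁻ ω in L s ⁻¹' {x}, ENNReal.ofReal (f x (L s ω)) ∂μ = 0 := by
      rw [setLIntegral_congr_fun (g := fun _ => 0) hAm]
      · simp
      · intro ω hω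
        have : L s ω = x := hω
        simp [f, R, this]
    have h1 := le_antisymm (h.trans h0.le) zero_le
    rw [lintegral_eq_zero_iff (hL.measurable_comp (fun Y => ENNReal.ofReal (f x Y)) t)] at h1
    filter_upwards [(ae_restrict_iff' hAm).1 h1] with ω hω hx
    by_contra hn
    have := hω hx
    simp [f, hn] at this
  filter_upwards [ae_all_iff.2 key] with ω hω using hω _ rfl

theorem IsFringeProcess.ae_norm_weightForm_sub_le (hL : IsFringeProcess μ V L)
    (hv : IsEigenweight l v) {C : ℝ} (hC : ∀ k, ‖l * v k‖ ≤ C) :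
    ∀ᵐ ω ∂μ, ∀ s t, s ≤ t → ‖weightForm v (L t ω) - weightForm v (L s ω)‖
      ≤ C * ((gapCount (L t ω) : ℝ) - gapCount (L s ω)) := by
  obtain ⟨S, hSc, hSd⟩ := TopologicalSpace.exists_countable_dense ℝ≥0
  have : Countable S := hSc.to_subtype
  have h : ∀ᵐ ω ∂μ, ∀ (p : S × S), (p.1 : ℝ≥0) ≤ p.2 →
      ‖weightForm v (L p.2 ω) - weightForm v (L p.1 ω)‖
      ≤ C * ((gapCount (L p.2 ω) : ℝ) - gapCount (L p.1 ω)) := by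
    refine ae_all_iff.2 fun p => ?_
    by_cases hp : (p.1 : ℝ≥0) ≤ p.2
    · filter_upwards [hL.ae_norm_weightForm_sub_le_of_le hv hC hp] with ω hω _ using hω
    · exact Eventually.of_forall fun ω h => absurd h hp
  filter_upwards [h] with ω hω s t hst
  rcases hst.eq_or_lt with rfl | hlt
  · simp
  obtain ⟨u, hu, hus⟩ := hL.exists_eq_of_mem_Ico ω s
  obtain ⟨w, hw, hwt⟩ := hL.exists_eq_of_mem_Ico ω t
  -- Points of the dense set are taken just to the right of `s` and of `t`, where the path still has
  -- the same values; `p < t` keeps them in order.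
  obtain ⟨p, hpS, hp1, hp2⟩ := hSd.exists_between (lt_min hu hlt)
  obtain ⟨q, hqS, hq1, hq2⟩ := hSd.exists_between hw
  have := hω (⟨p, hpS⟩, ⟨q, hqS⟩) ((hp2.le.trans (min_le_right _ _)).trans hq1.le)
  rwa [hus p ⟨hp1.le, hp2.trans_le (min_le_left _ _)⟩, hwt q ⟨hq1.le, hq2⟩] at this

theorem IsFringeProcess.integrable_scaledForm (hL : IsFringeProcess μ V L) (t : ℝ) (r : ℝ≥0) :
    Integrable (fun ω => scaledForm l v t (L r ω)) μ := by
  obtain ⟨C, hC0, hC⟩ := exists_norm_le v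
  refine (hL.integrable_of_norm_le (f := weightForm v) (C := C) (fun X => ?_) r).const_mul _
  refine (norm_weightForm_le hC X).trans ?_
  gcongr; linarith

theorem IsFringeProcess.setIntegral_scaledForm (hL : IsFringeProcess μ V L)
    (hv : IsEigenweight l v) {s t : ℝ≥0} (hst : s ≤ t) {A : Set Ω}
    (hA : MeasurableSet[hL.filtration s] A) :
    ∫ ω in A, scaledForm l v t (L t ω) ∂μ = ∫ ω in A, scaledForm l v s (L s ω) ∂μ := by
  obtain ⟨C, hC0, hC⟩ := exists_norm_le v
  refine hL.setIntegral_eq_of_harmonic (f := fun r => scaledForm l v r) hA hst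
    (fun X r _ => (hasDerivAt_scaledForm l v r X).continuousAt.continuousWithinAt)
    (fun r X _ _ => hasDerivAt_scaledForm l v r X)
    (C := Real.exp (|l.re| * t) * C) (fun r X _ _ => ?_) (fun r X h1 h2 => ?_)
  · rw [complexGen_scaledForm hv]; ring
  · rw [scaledForm, norm_mul, norm_cexp_neg_mul, mul_assoc]
    have hr : 0 ≤ r := s.2.trans h1
    have h3 : -(l.re * r) ≤ |l.re| * t := by
      rw [← neg_mul]
      exact (mul_le_mul_of_nonneg_right (neg_le_abs _) hr).trans
        (mul_le_mul_of_nonneg_left h2 (abs_nonneg _))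
    gcongr
    refine (norm_weightForm_le hC X).trans ?_
    gcongr; linarith

/-- Uniform exponential moments of the rescaled linear form in the large phase. -/
theorem IsFringeProcess.exists_integral_exp_scaledForm_le (hL : IsFringeProcess μ V L)
    (hv : IsEigenweight l v) (hl : 1 / 2 < l.re) :
    ∃ ε > 0, ∃ B, ∀ z : ℂ, ‖z‖ ≤ ε → ∀ t : ℝ≥0,
      Integrable (fun ω => Real.exp (z * (starRingEnd ℂ) (scaledForm l v t (L t ω))).re) μ ∧
      ∫ ω, Real.exp (z * (starRingEnd ℂ) (scaledForm l v t (L t ω))).re ∂μ ≤ B := by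
  obtain ⟨C, hC0, hC⟩ := exists_norm_le (fun k => l * v k)
  obtain ⟨C', hC0', hC'⟩ := exists_norm_le v
  set δ := 2 * l.re - 1 with hδ
  have hδ0 : 0 < δ := by rw [hδ]; linarith
  -- The bounds by `1 / 2` keep the jumps of the exponent at most `1`, so that `exp y - 1 - y ≤ y ^
  -- 2` applies. The bounds in terms of `δ` make the quadratic terms `2 c ^ 2 + 2 κ ^ 2` smaller
  -- than the drift `δ κ`.
  obtain ⟨κ, hκ0, hκ1, hκ2⟩ : ∃ κ : ℝ, 0 < κ ∧ κ ≤ 1 / 2 ∧ κ ≤ δ / 4 :=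
    ⟨min (1 / 2) (δ / 4), by positivity, min_le_left _ _, min_le_right _ _⟩
  obtain ⟨c, hc0, hc1, hc2⟩ : ∃ c : ℝ, 0 < c ∧ c ≤ 1 / 2 ∧ c ≤ δ * κ / 4 :=
    ⟨min (1 / 2) (δ * κ / 4), by positivity, min_le_left _ _, min_le_right _ _⟩
  have hc3 : 2 * c ^ 2 + 2 * κ ^ 2 ≤ δ * κ := by nlinarith
  refine ⟨c / (C + 1), by positivity, Real.exp (c / (C + 1) * (C' * gapCount V) + κ * gapCount V),
    fun z hz t => ?_⟩
  have hzC : ‖z‖ * C ≤ c := by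
    calc ‖z‖ * C ≤ c / (C + 1) * (C + 1) := by gcongr; linarith
      _ = c := by field_simp
  -- The exponential of the martingale alone is a submartingale. The added term, of size `κ * exp
  -- (-2 Re l t)` per gap, has negative drift `-δ κ exp (-2 Re l t)` per gap because `2 Re l > 1`,
  -- which outweighs the second-order contribution of the jumps.
  let g : ℝ → State m → ℝ := fun t X => (z * (starRingEnd ℂ) (scaledForm l v t X)).re
    + κ * (Real.exp (-(2 * l.re * t)) * gapCount X)
  let g' : ℝ → State m → ℝ := fun t X => (z * (starRingEnd ℂ) (-l * scaledForm l v t X)).re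
    + κ * (-(2 * l.re) * (Real.exp (-(2 * l.re * t)) * gapCount X))
  have hg : ∀ t X, HasDerivAt (fun t => g t X) (g' t X) t := by
    intro t X
    refine HasDerivAt.add ?_ ((hasDerivAt_exp_neg_mul (2 * l.re) _ t).const_mul κ)
    have h1 : HasDerivAt (fun t => (starRingEnd ℂ) (scaledForm l v t X))
        ((starRingEnd ℂ) (-l * scaledForm l v t X)) t :=
      Complex.conjCLE.toContinuousLinearMap.hasFDerivAt.comp_hasDerivAt t
        (hasDerivAt_scaledForm l v t X)
    exact Complex.reCLM.hasFDerivAt.comp_hasDerivAt t (h1.const_mul z)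
  have hsup : ∀ t X, 0 ≤ t →
      Real.exp (g t X) * g' t X + gen (fun X => Real.exp (g t X)) X ≤ 0 := by
    intro t X ht
    set θ := Real.exp (-(2 * l.re * t)) with hθ
    have hθ0 : 0 < θ := Real.exp_pos _
    have hθ1 : θ ≤ 1 := Real.exp_le_one_iff.2 (by
      have : 0 ≤ l.re * t := mul_nonneg (by linarith) ht
      linarith)
    set e := Complex.exp (-l * (t : ℂ)) with he
    have he2 : ‖e‖ ^ 2 = θ := by
      rw [he, norm_cexp_neg_mul, hθ, ← Real.exp_nat_mul]
      congr 1; push_cast; ring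
    -- The time derivative is spread over the particles with the same rates as in the generator, so
    -- that the inequality can be checked jump by jump.
    have hwf : ∀ X : State m, (z * (starRingEnd ℂ) (-l * (e * weightForm v X))).re
        = ∑ k : Fin m, ((m : ℝ) + (k.val : ℝ)) * (X k : ℝ)
          * -(z * (starRingEnd ℂ) (e * (l * v k))).re := by
      intro X
      rw [weightForm, Finset.mul_sum, Finset.mul_sum, map_sum, Finset.mul_sum, Complex.re_sum]
      refine Finset.sum_congr rfl fun k _ => ?_
      have : z * (starRingEnd ℂ) (-l * (e * (((m : ℂ) + k.val) * v k * X k)))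
          = ((((m : ℝ) + (k.val : ℝ)) * (X k : ℝ) : ℝ) : ℂ)
            * -(z * (starRingEnd ℂ) (e * (l * v k))) := by
        simp only [map_mul, map_add, map_neg, Complex.conj_natCast]
        push_cast; ring
      rw [this, Complex.re_ofReal_mul, Complex.neg_re]
    have hg'X : g' t X = ∑ k : Fin m, ((m : ℝ) + (k.val : ℝ)) * (X k : ℝ)
        * (-(z * (starRingEnd ℂ) (e * (l * v k))).re - 2 * l.re * κ * θ) := by
      simp only [g', scaledForm, ← he, ← hθ, hwf X, mul_sub, Finset.sum_sub_distrib,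
        ← Finset.sum_mul, sum_rate]
      ring
    have hstep : ∀ k, X k ≠ 0 → g t (step X k)
        = g t X + ((z * (starRingEnd ℂ) (e * (l * v k))).re + κ * θ) := by
      intro k hk
      simp only [g, scaledForm, ← he, ← hθ, hv.weightForm_step hk, gapCount_step hk, mul_add,
        map_add, Complex.add_re, Nat.cast_add, Nat.cast_one]
      ring
    rw [hg'X, gen, Finset.mul_sum, ← Finset.sum_add_distrib]
    refine Finset.sum_nonpos fun k _ => ?_
    by_cases hk : X k = 0
    · simp [hk]
    simp only [hstep k hk, Real.exp_add (g t X)]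
    set a := (z * (starRingEnd ℂ) (e * (l * v k))).re
    have ha : |a| ≤ c * ‖e‖ := by
      refine (Complex.abs_re_le_norm _).trans ?_
      rw [norm_mul, RCLike.norm_conj, norm_mul]
      calc ‖z‖ * (‖e‖ * ‖l * v k‖) ≤ ‖z‖ * (‖e‖ * C) := by gcongr; exact hC k
        _ = (‖z‖ * C) * ‖e‖ := by ring
        _ ≤ c * ‖e‖ := by gcongr
    have ha2 : a ^ 2 ≤ c ^ 2 * θ := by
      rw [← he2, ← mul_pow]; exact sq_le_sq' (abs_le.1 ha).1 (abs_le.1 ha).2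
    have hae : |a| ≤ 1 / 2 := by
      have : ‖e‖ ≤ 1 := by
        have h := norm_nonneg e
        nlinarith
      nlinarith
    have hy : |a + κ * θ| ≤ 1 := by
      refine (abs_add_le _ _).trans ?_
      rw [abs_of_pos (by positivity : 0 < κ * θ)]
      nlinarith
    have hexp := (abs_le.1 (Real.abs_exp_sub_one_sub_id_le hy)).2
    have hbr : -a - 2 * l.re * κ * θ + (Real.exp (a + κ * θ) - 1) ≤ 0 := by
      have h1 : (a + κ * θ) ^ 2 ≤ 2 * a ^ 2 + 2 * (κ * θ) ^ 2 := by
        nlinarith [sq_nonneg (a - κ * θ)]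
      have h2 : (κ * θ) ^ 2 ≤ κ ^ 2 * θ := by
        rw [mul_pow]; gcongr; nlinarith
      have h3 : (2 * c ^ 2 + 2 * κ ^ 2) * θ ≤ δ * κ * θ := by gcongr
      have h4 : δ * κ * θ = 2 * l.re * κ * θ - κ * θ := by rw [hδ]; ring
      linarith
    have : Real.exp (g t X) * (((m : ℝ) + (k.val : ℝ)) * (X k : ℝ) * (-a - 2 * l.re * κ * θ))
        + ((m : ℝ) + (k.val : ℝ)) * (X k : ℝ)
          * (Real.exp (g t X) * Real.exp (a + κ * θ) - Real.exp (g t X))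
        = (Real.exp (g t X) * (((m : ℝ) + (k.val : ℝ)) * (X k : ℝ)))
          * (-a - 2 * l.re * κ * θ + (Real.exp (a + κ * θ) - 1)) := by ring
    rw [this]
    exact mul_nonpos_of_nonneg_of_nonpos (by positivity) hbr
  obtain ⟨hint, hle⟩ := hL.integrable_of_superharmonic (f := fun t X => Real.exp (g t X))
    (fun t X => (Real.exp_pos _).le) (fun t X => (hg t X).exp) hsup t
  have hmono : ∀ ω, Real.exp (z * (starRingEnd ℂ) (scaledForm l v t (L t ω))).re
      ≤ Real.exp (g t (L t ω)) := fun ω => by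
    refine Real.exp_le_exp.2 (le_add_of_nonneg_right (by positivity))
  have hint' : Integrable
      (fun ω => Real.exp (z * (starRingEnd ℂ) (scaledForm l v t (L t ω))).re) μ :=
    hint.mono' (hL.measurable_comp
      (fun X => Real.exp (z * (starRingEnd ℂ) (scaledForm l v t X)).re) t).aestronglyMeasurable
      (Eventually.of_forall fun ω => by
        rw [Real.norm_of_nonneg (Real.exp_pos _).le]; exact hmono ω)
  refine ⟨hint', (integral_mono hint' hint hmono).trans (hle.trans (Real.exp_le_exp.2 ?_))⟩
  simp only [g, scaledForm, Complex.ofReal_zero, mul_zero, neg_zero, Real.exp_zero, Complex.exp_zero,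
    one_mul]
  gcongr
  refine (Complex.re_le_norm _).trans ?_
  rw [norm_mul, RCLike.norm_conj]
  gcongr
  exact norm_weightForm_le hC' V

end Trajectory

/-! ### Almost sure convergence in continuous time -/

theorem scaledForm_one {m : ℕ} (t : ℝ) (X : State m) :
    scaledForm 1 (fun _ => 1) t X = ((Real.exp (-t) * gapCount X : ℝ) : ℂ) := by
  rw [scaledForm, weightForm_one]; push_cast; ring_nf

theorem abs_le_of_exp_add_exp {ε x : ℝ} (hε : 0 < ε) :
    |x| ≤ ε⁻¹ * (Real.exp (ε * x) + Real.exp (-ε * x)) := by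
  rw [← div_eq_inv_mul, le_div_iff₀ hε]
  have h1 := Real.add_one_le_exp (ε * x)
  have h2 := Real.add_one_le_exp (-ε * x)
  have h3 := Real.exp_pos (ε * x)
  have h4 := Real.exp_pos (-ε * x)
  rcases abs_cases x with ⟨h, _⟩ | ⟨h, _⟩ <;> rw [h] <;> nlinarith

/-- Almost sure convergence along a sequence of times of an `L¹`-bounded continuous-time
martingale. -/
theorem ae_exists_tendsto_of_setIntegral_eq {Ω : Type*} [mΩ : MeasurableSpace Ω] {μ : Measure Ω}
    [IsProbabilityMeasure μ] {F : Filtration ℝ≥0 mΩ} {M : ℝ≥0 → Ω → ℝ}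
    (hadp : ∀ t, StronglyMeasurable[F t] (M t)) (hint : ∀ t, Integrable (M t) μ) {B : ℝ}
    (hB : ∀ t, ∫ ω, |M t ω| ∂μ ≤ B)
    (heq : ∀ s t, s ≤ t → ∀ A, MeasurableSet[F s] A → ∫ ω in A, M t ω ∂μ = ∫ ω in A, M s ω ∂μ)
    {τ : ℕ → ℝ≥0} (hτ : Monotone τ) :
    ∀ᵐ ω ∂μ, ∃ c, Tendsto (fun n => M (τ n) ω) atTop (𝓝 c) := by
  let 𝒢 : Filtration ℕ mΩ :=
    { seq := fun n => F (τ n)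
      mono' := fun _ _ h => F.mono (hτ h)
      le' := fun n => F.le (τ n) }
  have hM : Martingale (fun n => M (τ n)) 𝒢 μ :=
    martingale_of_setIntegral_eq_succ (fun n => hadp (τ n)) (fun n => hint (τ n))
      fun n A hA => (heq _ _ (hτ n.le_succ) A hA).symm
  refine hM.submartingale.exists_ae_tendsto_of_bdd (R := B.toNNReal) fun n => ?_
  rw [eLpNorm_one_eq_lintegral_enorm, ← ofReal_integral_norm_eq_lintegral_enorm (hint _)]
  exact ENNReal.ofReal_le_ofReal (hB _)

/-- The times `log n`. -/
noncomputable def logTime (n : ℕ) : ℝ≥0 := (Real.log n).toNNReal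

theorem coe_logTime (n : ℕ) : (logTime n : ℝ) = Real.log n :=
  Real.coe_toNNReal _ (Real.log_natCast_nonneg n)

theorem monotone_logTime : Monotone logTime := by
  intro a b h
  refine Real.toNNReal_le_toNNReal ?_
  rcases Nat.eq_zero_or_pos a with rfl | ha
  · simpa using Real.log_natCast_nonneg b
  · exact Real.log_le_log (by exact_mod_cast ha) (by exact_mod_cast h)

section Trajectory

variable {m : ℕ} {Ω : Type*} [MeasurableSpace Ω] {μ : Measure Ω} [IsProbabilityMeasure μ]
  {V : State m} {L : ℝ≥0 → Ω → State m} {l : ℂ} {v : Fin m → ℂ}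

theorem IsFringeProcess.exists_integral_norm_scaledForm_le (hL : IsFringeProcess μ V L)
    (hv : IsEigenweight l v) (hl : 1 / 2 < l.re) :
    ∃ B, ∀ t : ℝ≥0, ∫ ω, |(scaledForm l v t (L t ω)).re| ∂μ ≤ B ∧
      ∫ ω, |(scaledForm l v t (L t ω)).im| ∂μ ≤ B := by
  obtain ⟨ε, hε, B, hB⟩ := hL.exists_integral_exp_scaledForm_le hv hl
  refine ⟨ε⁻¹ * (B + B), fun t => ?_⟩
  have key : ∀ (φ : ℂ → ℝ) (z : ℂ), ‖z‖ ≤ ε →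
      (∀ w, (z * (starRingEnd ℂ) w).re = ε * φ w) →
      ∫ ω, |φ (scaledForm l v t (L t ω))| ∂μ ≤ ε⁻¹ * (B + B) := by
    intro φ z hz hφ
    have h1 := hB z hz t
    have h2 := hB (-z) (by simpa using hz) t
    simp only [neg_mul, Complex.neg_re, hφ] at h1 h2
    calc ∫ ω, |φ (scaledForm l v t (L t ω))| ∂μ
        ≤ ∫ ω, ε⁻¹ * (Real.exp (ε * φ (scaledForm l v t (L t ω)))
          + Real.exp (-(ε * φ (scaledForm l v t (L t ω))))) ∂μ := by
          refine integral_mono_of_nonneg (Eventually.of_forall fun ω => abs_nonneg _)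
            ((h1.1.add h2.1).const_mul _) (Eventually.of_forall fun ω => ?_)
          simpa [neg_mul] using abs_le_of_exp_add_exp (x := φ (scaledForm l v t (L t ω))) hε
      _ ≤ ε⁻¹ * (B + B) := by
          rw [integral_const_mul, integral_add h1.1 h2.1]
          gcongr
          exacts [h1.2, h2.2]
  refine ⟨key Complex.re ε ?_ ?_, key Complex.im (ε * Complex.I) ?_ ?_⟩
  · simp [abs_of_pos hε]
  · intro w; simp
  · simp [abs_of_pos hε]
  · intro w; simp

theorem IsFringeProcess.ae_exists_tendsto_scaledForm (hL : IsFringeProcess μ V L)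
    (hv : IsEigenweight l v) (hl : 1 / 2 < l.re) {τ : ℕ → ℝ≥0} (hτ : Monotone τ) :
    ∀ᵐ ω ∂μ, ∃ c, Tendsto (fun n => scaledForm l v (τ n) (L (τ n) ω)) atTop (𝓝 c) := by
  obtain ⟨B, hB⟩ := hL.exists_integral_norm_scaledForm_le hv hl
  have hmeas : ∀ (φ : ℂ → ℝ) t,
      StronglyMeasurable[hL.filtration t] fun ω => φ (scaledForm l v t (L t ω)) := fun φ t =>
    ((measurable_of_countable fun X => φ (scaledForm l v t X)).comp
      (hL.measurable_filtration t)).stronglyMeasurable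
  have hi : ∀ t : ℝ≥0, Integrable (fun ω => scaledForm l v t (L t ω)) μ :=
    fun t => hL.integrable_scaledForm t t
  have hre := ae_exists_tendsto_of_setIntegral_eq (F := hL.filtration)
    (M := fun t ω => (scaledForm l v t (L t ω)).re) (hmeas Complex.re)
    (fun t => Complex.reCLM.integrable_comp (hi t)) (fun t => (hB t).1)
    (fun s t hst A hA => by
      have h := congrArg Complex.re (hL.setIntegral_scaledForm hv hst hA)
      have e1 := Complex.reCLM.integral_comp_comm (hi t).integrableOn (μ := μ.restrict A)
      have e2 := Complex.reCLM.integral_comp_comm (hi s).integrableOn (μ := μ.restrict A)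
      simp only [Complex.reCLM_apply] at e1 e2
      rw [e1, e2, h]) hτ
  have him := ae_exists_tendsto_of_setIntegral_eq (F := hL.filtration)
    (M := fun t ω => (scaledForm l v t (L t ω)).im) (hmeas Complex.im)
    (fun t => Complex.imCLM.integrable_comp (hi t)) (fun t => (hB t).2)
    (fun s t hst A hA => by
      have h := congrArg Complex.im (hL.setIntegral_scaledForm hv hst hA)
      have e1 := Complex.imCLM.integral_comp_comm (hi t).integrableOn (μ := μ.restrict A)
      have e2 := Complex.imCLM.integral_comp_comm (hi s).integrableOn (μ := μ.restrict A)
      simp only [Complex.imCLM_apply] at e1 e2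
      rw [e1, e2, h]) hτ
  filter_upwards [hre, him] with ω ⟨a, ha⟩ ⟨b, hb⟩
  refine ⟨a + b * Complex.I, ?_⟩
  have h := ((Complex.continuous_ofReal.tendsto a).comp ha).add
    (((Complex.continuous_ofReal.tendsto b).comp hb).mul_const Complex.I)
  refine h.congr fun n => ?_
  simp [Complex.re_add_im]

theorem IsFringeProcess.setIntegral_gapCount (hL : IsFringeProcess μ V L) {s t : ℝ≥0}
    (hst : s ≤ t) {A : Set Ω} (hA : MeasurableSet[hL.filtration s] A) :
    ∫ ω in A, (gapCount (L t ω) : ℝ) ∂μ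
      = Real.exp (t - s) * ∫ ω in A, (gapCount (L s ω) : ℝ) ∂μ := by
  have h := hL.setIntegral_scaledForm isEigenweight_one hst hA
  simp only [scaledForm_one, integral_complex_ofReal, integral_const_mul] at h
  have h' := Complex.ofReal_injective h
  rw [Real.exp_sub, div_mul_eq_mul_div, eq_div_iff (Real.exp_pos _).ne']
  rw [Real.exp_neg, Real.exp_neg, ← div_eq_inv_mul, ← div_eq_inv_mul,
    div_eq_div_iff (Real.exp_pos _).ne' (Real.exp_pos _).ne'] at h'
  linarith

theorem IsFringeProcess.integrable_gapCount_sq (hL : IsFringeProcess μ V L) (t : ℝ≥0) :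
    Integrable (fun ω => (gapCount (L t ω) : ℝ) ^ 2) μ := by
  refine (hL.integrable_ascFactorial 2 t).1.mono'
    (hL.measurable_comp (fun X => (gapCount X : ℝ) ^ 2) t).aestronglyMeasurable
    (Eventually.of_forall fun ω => ?_)
  rw [Real.norm_of_nonneg (by positivity)]
  simp only [Nat.ascFactorial]
  push_cast
  nlinarith [(Nat.cast_nonneg (gapCount (L t ω)) : (0 : ℝ) ≤ _)]

/-- Expand the square. The cross term is `q * E (G_s ^ 2)` because `exp (-t) * G_t` is a martingale,
and `E (G_t ^ 2)` is bounded through the second rising factorial. -/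
theorem IsFringeProcess.integral_gapCount_sub_sq_le (hL : IsFringeProcess μ V L) {s t : ℝ≥0}
    (hst : s ≤ t) :
    ∫ ω, ((gapCount (L t ω) : ℝ) - gapCount (L s ω)) ^ 2 ∂μ
      ≤ (Real.exp (t - s) - 1) ^ 2 * ∫ ω, (gapCount (L s ω) : ℝ) ^ 2 ∂μ
        + Real.exp (t - s) * (Real.exp (t - s) - 1) * ∫ ω, (gapCount (L s ω) : ℝ) ∂μ := by
  set q := Real.exp (t - s) with hq
  have i1 := fun r => hL.integrable_gapCount r
  have i2 := fun r => hL.integrable_gapCount_sq r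
  have hmean : ∫ ω, (gapCount (L t ω) : ℝ) ∂μ = q * ∫ ω, (gapCount (L s ω) : ℝ) ∂μ := by
    simpa using hL.setIntegral_gapCount hst MeasurableSet.univ
  have hasc : ∀ r ω, ((gapCount (L r ω)).ascFactorial 2 : ℝ)
      = (gapCount (L r ω) : ℝ) ^ 2 + gapCount (L r ω) := fun r ω => by
    simp only [Nat.ascFactorial]; push_cast; ring
  have hsq : ∫ ω, (gapCount (L t ω) : ℝ) ^ 2 ∂μ + ∫ ω, (gapCount (L t ω) : ℝ) ∂μ
      ≤ q ^ 2 * (∫ ω, (gapCount (L s ω) : ℝ) ^ 2 ∂μ + ∫ ω, (gapCount (L s ω) : ℝ) ∂μ) := by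
    have h := hL.integral_le_of_superharmonic (s := s)
      (f := fun t X => Real.exp (-(((2 : ℕ) : ℝ) * t)) * ((gapCount X).ascFactorial 2 : ℝ))
      (fun t X => by positivity) (fun t X => hasDerivAt_exp_neg_mul ((2 : ℕ) : ℝ) _ t)
      (fun t X _ => superharmonic_ascFactorial 2 t X) hst
      ((hL.integrable_ascFactorial 2 s).1.const_mul _)
      ((hL.integrable_ascFactorial 2 t).1.const_mul _)
    simp only [integral_const_mul, hasc] at h
    rw [integral_add (i2 t) (i1 t), integral_add (i2 s) (i1 s)] at h
    have e : q ^ 2 = Real.exp (((2 : ℕ) : ℝ) * t) * Real.exp (-(((2 : ℕ) : ℝ) * s)) := by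
      rw [hq, ← Real.exp_nat_mul, ← Real.exp_add]; congr 1; ring
    rw [e, mul_assoc, ← div_le_iff₀' (Real.exp_pos _), div_eq_inv_mul, ← Real.exp_neg]
    exact h
  have hprod : Integrable (fun ω => (gapCount (L s ω) : ℝ) * gapCount (L t ω)) μ := by
    refine ((i2 s).add (i2 t)).mono' (((hL.measurable_comp (fun X => (gapCount X : ℝ)) s).mul
      (hL.measurable_comp (fun X => (gapCount X : ℝ)) t)).aestronglyMeasurable)
      (Eventually.of_forall fun ω => ?_)
    rw [Real.norm_of_nonneg (by positivity)]
    simp only [Pi.add_apply]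
    nlinarith [sq_nonneg ((gapCount (L s ω) : ℝ) - gapCount (L t ω))]
  have hcross : ∫ ω, (gapCount (L s ω) : ℝ) * gapCount (L t ω) ∂μ
      = q * ∫ ω, (gapCount (L s ω) : ℝ) ^ 2 ∂μ := by
    have hsm : StronglyMeasurable[hL.filtration s] fun ω => (gapCount (L s ω) : ℝ) :=
      ((measurable_of_countable fun X : State m => (gapCount X : ℝ)).comp
        (hL.measurable_filtration s)).stronglyMeasurable
    have hc : (fun ω => q * (gapCount (L s ω) : ℝ))
        =ᵐ[μ] μ[fun ω => (gapCount (L t ω) : ℝ) | hL.filtration s] := by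
      refine ae_eq_condExp_of_forall_setIntegral_eq (hL.filtration.le s) (i1 t)
        (fun A _ _ => ((i1 s).const_mul q).integrableOn) (fun A hA _ => ?_)
        (hsm.const_mul q).aestronglyMeasurable
      rw [integral_const_mul, hL.setIntegral_gapCount hst hA]
    have hpull := condExp_mul_of_stronglyMeasurable_left (μ := μ) hsm
      (g := fun ω => (gapCount (L t ω) : ℝ)) hprod (i1 t)
    calc ∫ ω, (gapCount (L s ω) : ℝ) * gapCount (L t ω) ∂μ
        = ∫ ω, (μ[(fun ω => (gapCount (L s ω) : ℝ)) * (fun ω => (gapCount (L t ω) : ℝ))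
            | hL.filtration s]) ω ∂μ := (integral_condExp (hL.filtration.le s)).symm
      _ = ∫ ω, q * (gapCount (L s ω) : ℝ) ^ 2 ∂μ := by
          refine integral_congr_ae ?_
          filter_upwards [hpull, hc] with ω h1 h2
          rw [h1, Pi.mul_apply, ← h2]; ring
      _ = _ := integral_const_mul _ _
  have hexp : ∫ ω, ((gapCount (L t ω) : ℝ) - gapCount (L s ω)) ^ 2 ∂μ
      = ∫ ω, (gapCount (L t ω) : ℝ) ^ 2 ∂μ
        - 2 * ∫ ω, (gapCount (L s ω) : ℝ) * gapCount (L t ω) ∂μ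
        + ∫ ω, (gapCount (L s ω) : ℝ) ^ 2 ∂μ := by
    rw [← integral_const_mul, ← integral_sub (i2 t) (hprod.const_mul 2),
      ← integral_add (((i2 t).sub (hprod.const_mul 2)).congr
        (Eventually.of_forall fun ω => by simp only [Pi.sub_apply])) (i2 s)]
    refine integral_congr_ae (Eventually.of_forall fun ω => ?_)
    ring
  rw [hexp, hcross]
  rw [hmean] at hsq
  nlinarith

/-- At time `log n` the mean gap count is of order `n`, while `exp (log (n + 1) - log n) - 1 = 1 /
n`. The two factors compensate in both terms of the preceding estimate. -/
theorem IsFringeProcess.exists_integral_logTime_sq_le (hL : IsFringeProcess μ V L) :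
    ∃ B, ∀ n : ℕ, n ≠ 0 →
      ∫ ω, ((gapCount (L (logTime (n + 1)) ω) : ℝ) - gapCount (L (logTime n) ω)) ^ 2 ∂μ ≤ B := by
  set K1 : ℝ := (((gapCount V).ascFactorial 1 : ℕ) : ℝ)
  set K2 : ℝ := (((gapCount V).ascFactorial 2 : ℕ) : ℝ)
  refine ⟨K2 + 2 * K1, fun n hn => ?_⟩
  have hn0 : (0 : ℝ) < n := by exact_mod_cast Nat.pos_of_ne_zero hn
  have hn1 : (1 : ℝ) ≤ n := by exact_mod_cast Nat.pos_of_ne_zero hn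
  refine (hL.integral_gapCount_sub_sq_le (monotone_logTime n.le_succ)).trans ?_
  have hexpn : Real.exp (logTime n) = n := by rw [coe_logTime, Real.exp_log hn0]
  have hq : Real.exp (logTime (n + 1) - logTime n) = 1 + 1 / n := by
    rw [Real.exp_sub, hexpn, coe_logTime, Real.exp_log (by positivity)]
    push_cast; field_simp
  have h1 : ∫ ω, (gapCount (L (logTime n) ω) : ℝ) ∂μ ≤ n * K1 := by
    have := (hL.integrable_ascFactorial 1 (logTime n)).2
    rw [Nat.cast_one, one_mul, hexpn] at this
    simpa [Nat.ascFactorial, K1] using this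
  have h2 : ∫ ω, (gapCount (L (logTime n) ω) : ℝ) ^ 2 ∂μ ≤ n ^ 2 * K2 := by
    have h := hL.integrable_ascFactorial 2 (logTime n)
    have h3 := h.2
    rw [Real.exp_nat_mul, hexpn] at h3
    refine le_trans (integral_mono (hL.integrable_gapCount_sq _) h.1 fun ω => ?_) h3
    simp only [Nat.ascFactorial]
    push_cast
    nlinarith [(Nat.cast_nonneg (gapCount (L (logTime n) ω)) : (0 : ℝ) ≤ _)]
  rw [hq]
  have h3 : (1 + 1 / (n : ℝ) - 1) ^ 2 * ∫ ω, (gapCount (L (logTime n) ω) : ℝ) ^ 2 ∂μ ≤ K2 := by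
    calc _ ≤ (1 + 1 / (n : ℝ) - 1) ^ 2 * (n ^ 2 * K2) := by gcongr
      _ = K2 := by field_simp; ring
  have h4 : (1 + 1 / (n : ℝ)) * (1 + 1 / (n : ℝ) - 1)
      * ∫ ω, (gapCount (L (logTime n) ω) : ℝ) ∂μ ≤ 2 * K1 := by
    have h5 : 1 / (n : ℝ) ≤ 1 := by rw [div_le_one hn0]; exact hn1
    calc (1 + 1 / (n : ℝ)) * (1 + 1 / (n : ℝ) - 1) * ∫ ω, (gapCount (L (logTime n) ω) : ℝ) ∂μ
        = (1 + 1 / (n : ℝ)) * (1 / n * ∫ ω, (gapCount (L (logTime n) ω) : ℝ) ∂μ) := by ring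
      _ ≤ (1 + 1) * (1 / n * (n * K1)) := by gcongr
      _ = 2 * K1 := by field_simp; ring
  linarith

/-- The squared increments have bounded mean and `∑ n ^ (-2 σ)` converges for `σ > 1 / 2`. The
series of the weighted squares is therefore almost surely finite and its terms tend to `0`. -/
theorem IsFringeProcess.ae_tendsto_rpow_mul_gapCount_sub (hL : IsFringeProcess μ V L) {σ : ℝ}
    (hσ : 1 / 2 < σ) :
    ∀ᵐ ω ∂μ, Tendsto (fun n : ℕ => (n : ℝ) ^ (-σ)
      * ((gapCount (L (logTime (n + 1)) ω) : ℝ) - gapCount (L (logTime n) ω))) atTop (𝓝 0) := by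
  obtain ⟨B, hB⟩ := hL.exists_integral_logTime_sq_le
  let D : ℕ → Ω → ℝ := fun n ω =>
    (gapCount (L (logTime (n + 1)) ω) : ℝ) - gapCount (L (logTime n) ω)
  have hDm : ∀ n, Measurable (D n) := fun n =>
    (hL.measurable_comp (fun X => (gapCount X : ℝ)) _).sub
      (hL.measurable_comp (fun X => (gapCount X : ℝ)) _)
  have hDi : ∀ n, Integrable (fun ω => D n ω ^ 2) μ := by
    intro n
    refine (((hL.integrable_gapCount_sq (logTime (n + 1))).add
      (hL.integrable_gapCount_sq (logTime n))).const_mul 2).mono'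
      ((hDm n).pow_const 2).aestronglyMeasurable (Eventually.of_forall fun ω => ?_)
    rw [Real.norm_of_nonneg (by positivity)]
    simp only [Pi.add_apply, D]
    nlinarith [sq_nonneg ((gapCount (L (logTime (n + 1)) ω) : ℝ) + gapCount (L (logTime n) ω))]
  let g : ℕ → Ω → ℝ := fun n ω => (n : ℝ) ^ (-(2 * σ)) * D n ω ^ 2
  have hg0 : ∀ n ω, 0 ≤ g n ω := fun n ω => by positivity
  have hsum : ∫⁻ ω, ∑' n, ENNReal.ofReal (g n ω) ∂μ ≠ ⊤ := by
    rw [lintegral_tsum fun n => ((hDm n).pow_const 2 |>.const_mul _).ennreal_ofReal.aemeasurable]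
    have hle : ∀ n, ∫⁻ ω, ENNReal.ofReal (g n ω) ∂μ
        ≤ ENNReal.ofReal ((n : ℝ) ^ (-(2 * σ)) * B) := by
      intro n
      rw [← ofReal_integral_eq_lintegral_ofReal ((hDi n).const_mul _)
        (Eventually.of_forall fun ω => hg0 n ω), integral_const_mul]
      refine ENNReal.ofReal_le_ofReal ?_
      by_cases hn : n = 0
      · subst hn
        have : -(2 * σ) ≠ 0 := by linarith
        simp [Real.zero_rpow this]
      · gcongr
        exact hB n hn
    refine ne_top_of_le_ne_top ?_ (ENNReal.tsum_le_tsum hle)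
    have hs : Summable fun n : ℕ => (n : ℝ) ^ (-(2 * σ)) * B :=
      (Real.summable_nat_rpow.2 (by linarith)).mul_right B
    exact hs.tsum_ofReal_ne_top
  have hm : Measurable fun ω => ∑' n, ENNReal.ofReal (g n ω) :=
    Measurable.tsum fun n => ((hDm n).pow_const 2 |>.const_mul _).ennreal_ofReal
  filter_upwards [ae_lt_top hm hsum] with ω hω
  have h1 := ENNReal.tendsto_atTop_zero_of_tsum_ne_top hω.ne
  have h2 : Tendsto (fun n => g n ω) atTop (𝓝 0) := by
    have h := (ENNReal.tendsto_toReal ENNReal.zero_ne_top).comp h1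
    simpa [Function.comp_def, ENNReal.toReal_ofReal (hg0 _ ω)] using h
  have h3 := (Real.continuous_sqrt.tendsto 0).comp h2
  rw [Real.sqrt_zero] at h3
  refine (tendsto_zero_iff_abs_tendsto_zero _).2 (h3.congr fun n => ?_)
  have : g n ω = ((n : ℝ) ^ (-σ) * D n ω) ^ 2 := by
    simp only [g, mul_pow]
    rw [← Real.rpow_natCast ((n : ℝ) ^ (-σ)), ← Real.rpow_mul (by positivity)]
    congr 2; push_cast; ring
  simp only [Function.comp_def, this, Real.sqrt_sq_eq_abs, D]

/-- Martingale convergence gives the limit along the times `log n`. Between two of them, the linear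
form varies by at most `C` times the increment of the gap count, which is negligible after rescaling
in the large phase. -/
theorem IsFringeProcess.ae_tendsto_scaledForm (hL : IsFringeProcess μ V L)
    (hv : IsEigenweight l v) (hl : 1 / 2 < l.re) :
    ∃ W : Ω → ℂ, Measurable W ∧ ∀ᵐ ω ∂μ,
      Tendsto (fun t : ℝ≥0 => scaledForm l v t (L t ω)) atTop (𝓝 (W ω)) := by
  obtain ⟨C, hC0, hC⟩ := exists_norm_le (fun k => l * v k)
  obtain ⟨W, hWm, hW⟩ := measurable_limit_of_tendsto_metrizable_ae (μ := μ)
    (f := fun n ω => scaledForm l v (logTime n) (L (logTime n) ω)) (L := atTop)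
    (fun n => (hL.measurable_comp _ _).aemeasurable)
    (hL.ae_exists_tendsto_scaledForm hv hl monotone_logTime)
  refine ⟨W, hWm, ?_⟩
  filter_upwards [hW, hL.ae_tendsto_rpow_mul_gapCount_sub hl, hL.ae_norm_weightForm_sub_le hv hC,
    -- For the eigenvalue `1` this estimate says that the gap count is nondecreasing along almost
    -- every path.
    hL.ae_norm_weightForm_sub_le isEigenweight_one (C := 1) (by simp)] with ω h1 h2 h3 h4
  let N : ℝ≥0 → ℕ := fun t => ⌊Real.exp t⌋₊
  have hN1 : ∀ t, 1 ≤ N t := fun t => Nat.le_floor (by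
    rw [Nat.cast_one]; exact Real.one_le_exp t.2)
  have hNt : Tendsto N atTop atTop :=
    tendsto_nat_floor_atTop.comp (Real.tendsto_exp_atTop.comp (NNReal.tendsto_coe_atTop.2 tendsto_id))
  have hlow : ∀ t, logTime (N t) ≤ t := fun t => by
    rw [← NNReal.coe_le_coe, coe_logTime,
      Real.log_le_iff_le_exp (by exact_mod_cast hN1 t)]
    exact Nat.floor_le (Real.exp_pos _).le
  have hupp : ∀ t, t ≤ logTime (N t + 1) := fun t => by
    rw [← NNReal.coe_le_coe, coe_logTime, Real.le_log_iff_exp_le (by positivity)]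
    push_cast
    exact (Nat.lt_floor_add_one _).le
  have hgap : Tendsto (fun t : ℝ≥0 => (t : ℝ) - logTime (N t)) atTop (𝓝 0) := by
    have h0 : Tendsto (fun t : ℝ≥0 => 1 / (N t : ℝ)) atTop (𝓝 0) :=
      tendsto_const_nhds.div_atTop (tendsto_natCast_atTop_atTop.comp hNt)
    refine squeeze_zero (fun t => sub_nonneg.2 (hlow t)) (fun t => ?_) h0
    have hpos : (0 : ℝ) < N t := by exact_mod_cast hN1 t
    have h5 : (t : ℝ) ≤ logTime (N t + 1) := hupp t
    have h6 : Real.log ((N t + 1 : ℕ) : ℝ) - Real.log (N t) ≤ 1 / N t := by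
      rw [← Real.log_div (by positivity) hpos.ne']
      refine (Real.log_le_sub_one_of_pos (by positivity)).trans (le_of_eq ?_)
      push_cast; field_simp; ring
    rw [coe_logTime] at h5 ⊢
    linarith
  have hfac : Tendsto (fun t : ℝ≥0 => Complex.exp (-l * (((t : ℝ) - logTime (N t) : ℝ) : ℂ)))
      atTop (𝓝 1) := by
    have : Continuous fun x : ℝ => Complex.exp (-l * (x : ℂ)) := by fun_prop
    have h := (this.tendsto 0).comp hgap
    simp only [Complex.ofReal_zero, mul_zero, Complex.exp_zero] at h
    exact h
  have herr : Tendsto (fun t : ℝ≥0 => scaledForm l v t (L t ω)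
      - Complex.exp (-l * (((t : ℝ) - logTime (N t) : ℝ) : ℂ))
        * scaledForm l v (logTime (N t)) (L (logTime (N t)) ω)) atTop (𝓝 0) := by
    have h0 : Tendsto (fun t : ℝ≥0 => C * ((N t : ℝ) ^ (-l.re)
        * ((gapCount (L (logTime (N t + 1)) ω) : ℝ) - gapCount (L (logTime (N t)) ω)))) atTop
        (𝓝 0) := by
      have h := (h2.comp hNt).const_mul C
      rw [mul_zero] at h
      exact h
    refine squeeze_zero_norm (fun t => ?_) h0
    have e : scaledForm l v t (L t ω)
        - Complex.exp (-l * (((t : ℝ) - logTime (N t) : ℝ) : ℂ))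
          * scaledForm l v (logTime (N t)) (L (logTime (N t)) ω)
        = Complex.exp (-l * ((t : ℝ) : ℂ))
          * (weightForm v (L t ω) - weightForm v (L (logTime (N t)) ω)) := by
      simp only [scaledForm, ← mul_assoc, ← Complex.exp_add, mul_sub]
      congr 3; push_cast; ring
    rw [e, norm_mul, norm_cexp_neg_mul]
    have hpos : (0 : ℝ) < N t := by exact_mod_cast hN1 t
    have h5 : Real.exp (-(l.re * t)) ≤ (N t : ℝ) ^ (-l.re) := by
      rw [Real.rpow_def_of_pos hpos, Real.exp_le_exp]
      have := hlow t
      rw [← NNReal.coe_le_coe, coe_logTime] at this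
      nlinarith
    have h6 := h3 _ _ (hlow t)
    have h7 := (norm_nonneg _).trans (h4 _ _ (hupp t))
    have h8 : (gapCount (L t ω) : ℝ) - gapCount (L (logTime (N t)) ω)
        ≤ gapCount (L (logTime (N t + 1)) ω) - gapCount (L (logTime (N t)) ω) := by linarith
    calc Real.exp (-(l.re * t)) * ‖weightForm v (L t ω) - weightForm v (L (logTime (N t)) ω)‖
        ≤ (N t : ℝ) ^ (-l.re) * (C * (gapCount (L (logTime (N t + 1)) ω)
            - gapCount (L (logTime (N t)) ω))) := by
          gcongr
          exact h6.trans (by gcongr)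
      _ = _ := by ring
  have hmain := herr.add (hfac.mul (h1.comp hNt))
  simp only [zero_add, one_mul, Function.comp_def, sub_add_cancel] at hmain
  exact hmain

/-- Fatou's lemma along integer times, from the uniform exponential moments. -/
theorem IsFringeProcess.exists_integrable_exp_limit (hL : IsFringeProcess μ V L)
    (hv : IsEigenweight l v) (hl : 1 / 2 < l.re) {W : Ω → ℂ} (hWm : Measurable W)
    (hW : ∀ᵐ ω ∂μ, Tendsto (fun t : ℝ≥0 => scaledForm l v t (L t ω)) atTop (𝓝 (W ω))) :
    ∃ ε > 0, ∀ z : ℂ, ‖z‖ ≤ ε →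
      Integrable (fun ω => Real.exp (z * (starRingEnd ℂ) (W ω)).re) μ := by
  obtain ⟨ε, hε, B, hB⟩ := hL.exists_integral_exp_scaledForm_le hv hl
  refine ⟨ε, hε, fun z hz => ?_⟩
  have hcont : Continuous fun w : ℂ => Real.exp (z * (starRingEnd ℂ) w).re := by
    have := Complex.continuous_conj
    fun_prop
  refine ⟨(hcont.measurable.comp hWm).aestronglyMeasurable, ?_⟩
  rw [hasFiniteIntegral_iff_ofReal (Eventually.of_forall fun ω => (Real.exp_pos _).le)]
  let F : ℕ → Ω → ENNReal := fun n ω =>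
    ENNReal.ofReal (Real.exp (z * (starRingEnd ℂ) (scaledForm l v (n : ℝ≥0) (L n ω))).re)
  have hF : ∀ n, ∫⁻ ω, F n ω ∂μ ≤ ENNReal.ofReal B := by
    intro n
    rw [← ofReal_integral_eq_lintegral_ofReal (hB z hz n).1
      (Eventually.of_forall fun ω => (Real.exp_pos _).le)]
    exact ENNReal.ofReal_le_ofReal (hB z hz n).2
  have hlim : ∀ᵐ ω ∂μ, ENNReal.ofReal (Real.exp (z * (starRingEnd ℂ) (W ω)).re)
      = liminf (fun n => F n ω) atTop := by
    filter_upwards [hW] with ω hω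
    have h := ((ENNReal.continuous_ofReal.comp hcont).tendsto _).comp
      (hω.comp (tendsto_natCast_atTop_atTop (R := ℝ≥0)))
    exact h.liminf_eq.symm
  rw [lintegral_congr_ae hlim]
  have hFm : ∀ n, Measurable (F n) := fun n => hL.measurable_comp
    (fun X => ENNReal.ofReal (Real.exp (z * (starRingEnd ℂ) (scaledForm l v (n : ℝ≥0) X)).re)) n
  refine (lintegral_liminf_le hFm).trans_lt (lt_of_le_of_lt ?_ (ENNReal.ofReal_lt_top (r := B)))
  exact (liminf_le_liminf (Eventually.of_forall hF)).trans (by simp)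

end Trajectory

/-! ### Generating functions and the backward equation -/

/-- The radial retraction of the plane onto the closed unit disc. -/
noncomputable def discRetract (z : ℂ) : ℂ := ((max 1 ‖z‖)⁻¹ : ℝ) • z

theorem norm_discRetract_le (z : ℂ) : ‖discRetract z‖ ≤ 1 := by
  have h : 0 < max 1 ‖z‖ := lt_max_of_lt_left one_pos
  rw [discRetract, norm_smul, Real.norm_of_nonneg (by positivity), ← div_eq_inv_mul, div_le_one h]
  exact le_max_right _ _

theorem discRetract_of_norm_le {z : ℂ} (hz : ‖z‖ ≤ 1) : discRetract z = z := by
  rw [discRetract, max_eq_left hz, inv_one, one_smul]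

theorem norm_discRetract_sub_le (z w : ℂ) : ‖discRetract z - discRetract w‖ ≤ 2 * ‖z - w‖ := by
  have ha : 0 < max 1 ‖z‖ := lt_max_of_lt_left one_pos
  have hb : 0 < max 1 ‖w‖ := lt_max_of_lt_left one_pos
  have e : discRetract z - discRetract w = ((max 1 ‖z‖)⁻¹ : ℝ) • (z - w)
      + ((max 1 ‖z‖)⁻¹ * (max 1 ‖w‖ - max 1 ‖z‖) : ℝ) • discRetract w := by
    rw [discRetract, discRetract, smul_smul, smul_sub, mul_sub, sub_mul, mul_assoc, mul_assoc,
      mul_inv_cancel₀ hb.ne', sub_smul, mul_one]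
    have : (max 1 ‖z‖)⁻¹ * (max 1 ‖z‖ * (max 1 ‖w‖)⁻¹) = (max 1 ‖w‖)⁻¹ := by
      field_simp
    rw [this]; abel
  have hinv : (max 1 ‖z‖)⁻¹ ≤ 1 := inv_le_one_of_one_le₀ (le_max_left _ _)
  have hmax : |max 1 ‖w‖ - max 1 ‖z‖| ≤ ‖z - w‖ := by
    refine (abs_max_sub_max_le_max 1 ‖w‖ 1 ‖z‖).trans ?_
    rw [sub_self, abs_zero, max_eq_right (abs_nonneg _), norm_sub_rev]
    exact abs_norm_sub_norm_le w z
  rw [e]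
  refine (norm_add_le _ _).trans ?_
  rw [norm_smul, norm_smul, Real.norm_eq_abs, Real.norm_eq_abs, abs_mul,
    abs_of_pos (inv_pos.2 ha)]
  calc (max 1 ‖z‖)⁻¹ * ‖z - w‖ + (max 1 ‖z‖)⁻¹ * |max 1 ‖w‖ - max 1 ‖z‖| * ‖discRetract w‖
      ≤ 1 * ‖z - w‖ + 1 * ‖z - w‖ * 1 := by
        gcongr
        exact norm_discRetract_le w
    _ = 2 * ‖z - w‖ := by ring

/-- The offspring generating function of a particle of index `k`. -/
def offspringGF {m : ℕ} (s : Fin m → ℂ) (k : Fin m) : ℂ := ∏ j, s j ^ offspring k j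

theorem offspringGF_of_lt {m : ℕ} (s : Fin m → ℂ) {k : Fin m} (hk : k.val + 1 < m) :
    offspringGF s k = s ⟨k.val + 1, hk⟩ := by
  rw [offspringGF, prod_pow_offspring, dif_pos hk]

theorem offspringGF_of_not_lt {m : ℕ} (s : Fin m → ℂ) {k : Fin m} (hk : ¬ k.val + 1 < m) :
    offspringGF s k = s ⟨0, k.pos⟩ ^ 2 := by
  rw [offspringGF, prod_pow_offspring, dif_neg hk]

theorem norm_offspringGF_le {m : ℕ} {s : Fin m → ℂ} (hs : ∀ j, ‖s j‖ ≤ 1) (k : Fin m) :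
    ‖offspringGF s k‖ ≤ 1 := by
  rw [offspringGF, norm_prod]
  refine Finset.prod_le_one (fun _ _ => norm_nonneg _) fun j _ => ?_
  rw [norm_pow]
  exact pow_le_one₀ (norm_nonneg _) (hs j)

theorem norm_offspringGF_sub_le {m : ℕ} {s t : Fin m → ℂ} (hs : ∀ j, ‖s j‖ ≤ 1)
    (ht : ∀ j, ‖t j‖ ≤ 1) {D : ℝ} (hD : ∀ j, ‖s j - t j‖ ≤ D) (k : Fin m) :
    ‖offspringGF s k - offspringGF t k‖ ≤ 2 * D := by
  have hD0 : 0 ≤ D := (norm_nonneg _).trans (hD k)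
  by_cases hk : k.val + 1 < m
  · rw [offspringGF_of_lt s hk, offspringGF_of_lt t hk]
    linarith [hD ⟨k.val + 1, hk⟩]
  · rw [offspringGF_of_not_lt s hk, offspringGF_of_not_lt t hk, sq_sub_sq, norm_mul]
    have h1 := (norm_add_le (s ⟨0, k.pos⟩) (t ⟨0, k.pos⟩)).trans
      (add_le_add (hs ⟨0, k.pos⟩) (ht ⟨0, k.pos⟩))
    have h2 := hD ⟨0, k.pos⟩
    calc _ ≤ (1 + 1) * D := by gcongr
      _ = 2 * D := by ring

theorem continuous_offspringGF {m : ℕ} (k : Fin m) :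
    Continuous fun s : Fin m → ℂ => offspringGF s k := by
  unfold offspringGF; fun_prop

/-- The backward equation of the generating functions, cut off outside the unit polydisc. -/
noncomputable def cutField {m : ℕ} (s : Fin m → ℂ) (k : Fin m) : ℂ :=
  ((m : ℂ) + k.val) * (offspringGF (fun j => discRetract (s j)) k - discRetract (s k))

theorem norm_natCast_add_natCast (m k : ℕ) : ‖(m : ℂ) + (k : ℂ)‖ = (m : ℝ) + k := by
  rw [← Nat.cast_add, Complex.norm_natCast]; push_cast; ring

theorem norm_cutField_le {m : ℕ} (s : Fin m → ℂ) : ‖cutField s‖ ≤ 4 * m := by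
  refine (pi_norm_le_iff_of_nonneg (by positivity)).2 fun k => ?_
  rw [cutField, norm_mul, norm_natCast_add_natCast]
  have h1 := (norm_sub_le (offspringGF (fun j => discRetract (s j)) k) (discRetract (s k))).trans
    (add_le_add (norm_offspringGF_le (fun j => norm_discRetract_le _) k) (norm_discRetract_le _))
  have h2 : (k.val : ℝ) ≤ m := by exact_mod_cast k.isLt.le
  calc _ ≤ ((m : ℝ) + m) * (1 + 1) := by gcongr
    _ = 4 * m := by ring

theorem norm_cutField_sub_le {m : ℕ} (s t : Fin m → ℂ) :
    ‖cutField s - cutField t‖ ≤ 12 * m * ‖s - t‖ := by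
  refine (pi_norm_le_iff_of_nonneg (by positivity)).2 fun k => ?_
  have hD : ∀ j, ‖discRetract (s j) - discRetract (t j)‖ ≤ 2 * ‖s - t‖ := fun j =>
    (norm_discRetract_sub_le _ _).trans (by gcongr; exact norm_le_pi_norm (s - t) j)
  have e : (cutField s - cutField t) k = ((m : ℂ) + k.val)
      * ((offspringGF (fun j => discRetract (s j)) k - offspringGF (fun j => discRetract (t j)) k)
        - (discRetract (s k) - discRetract (t k))) := by
    simp only [Pi.sub_apply, cutField]; ring
  rw [e, norm_mul, norm_natCast_add_natCast]
  have h1 := (norm_sub_le (offspringGF (fun j => discRetract (s j)) k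
    - offspringGF (fun j => discRetract (t j)) k) (discRetract (s k) - discRetract (t k))).trans
    (add_le_add (norm_offspringGF_sub_le (fun j => norm_discRetract_le _)
      (fun j => norm_discRetract_le _) hD k) (hD k))
  have h2 : (k.val : ℝ) ≤ m := by exact_mod_cast k.isLt.le
  calc _ ≤ ((m : ℝ) + m) * (2 * (2 * ‖s - t‖) + 2 * ‖s - t‖) := by gcongr
    _ = 12 * m * ‖s - t‖ := by ring

/-- Existence on any time interval of a solution of the backward equation in the closed unit
polydisc. -/
theorem exists_backward_solution {m : ℕ} {s : Fin m → ℂ} (hs : ∀ k, ‖s k‖ ≤ 1) {T : ℝ}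
    (hT : 0 ≤ T) :
    ∃ σ : ℝ → Fin m → ℂ, σ 0 = s ∧ (∀ t ∈ Set.Icc 0 T, ∀ k, ‖σ t k‖ ≤ 1) ∧
      ∀ t ∈ Set.Icc 0 T, ∀ k, HasDerivWithinAt (fun t => σ t k)
        (((m : ℂ) + k.val) * (offspringGF (σ t) k - σ t k)) (Set.Icc 0 T) t := by
  -- The cut-off field is globally bounded by `4 m` and globally `12 m`-Lipschitz, so a ball of
  -- radius `4 m T` serves for the whole interval at once.
  have hPL : IsPicardLindelof (fun _ : ℝ => cutField (m := m)) (tmin := 0) (tmax := T)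
      ⟨0, Set.left_mem_Icc.2 hT⟩ s ((4 * m : ℝ≥0) * T.toNNReal) 0 (4 * m) (12 * m) :=
    { lipschitzOnWith := fun t _ => LipschitzWith.lipschitzOnWith <|
        LipschitzWith.of_dist_le_mul fun x y => by
          rw [dist_eq_norm, dist_eq_norm]
          simpa using norm_cutField_sub_le x y
      continuousOn := fun x _ => continuousOn_const
      norm_le := fun t _ x _ => by simpa using norm_cutField_le x
      mul_max_le := by
        simp [hT] }
  obtain ⟨σ, hσ0, hσ⟩ := hPL.exists_eq_forall_mem_Icc_hasDerivWithinAt₀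
  have hσk : ∀ t ∈ Set.Icc 0 T, ∀ k,
      HasDerivWithinAt (fun t => σ t k) (cutField (σ t) k) (Set.Icc 0 T) t :=
    fun t ht k => (hasDerivWithinAt_pi.1 (hσ t ht)) k
  have hbound : ∀ t ∈ Set.Icc 0 T, ∀ k, ‖σ t k‖ ≤ 1 := by
    intro t ht k
    -- A barrier with positive slope `ε` is used because the derivative of `‖σ t k‖ ^ 2` is only
    -- known to be nonpositive where the modulus is at least one.
    have key : ∀ ε > 0, ‖σ t k‖ ^ 2 ≤ 1 + ε * (1 + t) := by
      intro ε hε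
      refine image_le_of_deriv_right_lt_deriv_boundary (a := 0) (b := T)
        (f := fun t => ‖σ t k‖ ^ 2) (f' := fun t => 2 * inner ℝ (σ t k) (cutField (σ t) k))
        (B := fun t => 1 + ε * (1 + t)) (B' := fun _ => ε) ?_ ?_ ?_ ?_ ?_ ht
      · exact fun t ht => ((hσk t ht k).norm_sq).continuousWithinAt
      · exact fun t ht => ((hσk t (Set.Ico_subset_Icc_self ht) k).norm_sq).mono_of_mem_nhdsWithin
          (Icc_mem_nhdsGE_of_mem ht)
      · have h1 : ‖s k‖ ^ 2 ≤ 1 := pow_le_one₀ (norm_nonneg _) (hs k)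
        have h2 : σ 0 = s := hσ0
        simp only [h2]; linarith
      · intro x
        simpa using ((hasDerivAt_id x).const_add 1).const_mul ε |>.const_add 1
      · intro x hx hxe
        refine lt_of_le_of_lt ?_ hε
        have hx1 : 1 ≤ ‖σ x k‖ := by
          have h3 : 1 ≤ ‖σ x k‖ ^ 2 := by
            rw [hxe]; have := hx.1
            have : 0 ≤ ε * (1 + x) := by positivity
            linarith
          exact (one_le_sq_iff₀ (norm_nonneg _)).1 h3
        -- Outside the unit disc the term `-discRetract` points inwards with inner product `-‖σ x
        -- k‖`, and the offspring term, of modulus at most one, cannot exceed it.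
        have h4 : inner ℝ (σ x k) (discRetract (σ x k)) = ‖σ x k‖ := by
          rw [discRetract, max_eq_right hx1, real_inner_smul_right, real_inner_self_eq_norm_sq]
          field_simp
        have h5 : inner ℝ (σ x k) (offspringGF (fun j => discRetract (σ x j)) k) ≤ ‖σ x k‖ := by
          refine (real_inner_le_norm _ _).trans (mul_le_of_le_one_right (norm_nonneg _) ?_)
          exact norm_offspringGF_le (fun j => norm_discRetract_le _) k
        have e : cutField (σ x) k = ((m : ℝ) + k.val)
            • (offspringGF (fun j => discRetract (σ x j)) k - discRetract (σ x k)) := by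
          rw [cutField, Complex.real_smul]; push_cast; rfl
        rw [e, real_inner_smul_right, inner_sub_right, h4]
        have h6 : 0 ≤ (m : ℝ) + k.val := by positivity
        nlinarith
    have ht0 : 0 ≤ t := ht.1
    have h1 : ‖σ t k‖ ^ 2 ≤ 1 := by
      refine le_of_forall_pos_le_add fun ε hε => ?_
      have := key (ε / (1 + t)) (by positivity)
      rwa [div_mul_cancel₀ _ (by positivity)] at this
    exact (sq_le_one_iff₀ (norm_nonneg _)).1 h1
  refine ⟨σ, hσ0, hbound, fun t ht k => ?_⟩
  have h := hσk t ht k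
  rw [cutField, discRetract_of_norm_le (hbound t ht k)] at h
  simpa only [discRetract_of_norm_le (hbound t ht _)] using h

theorem norm_prod_pow_le {m : ℕ} {s : Fin m → ℂ} (hs : ∀ k, ‖s k‖ ≤ 1) (X : State m) :
    ‖∏ j, s j ^ X j‖ ≤ 1 := by
  rw [norm_prod]
  refine Finset.prod_le_one (fun _ _ => norm_nonneg _) fun j _ => ?_
  rw [norm_pow]
  exact pow_le_one₀ (norm_nonneg _) (hs j)

theorem prod_pow_sub_single {m : ℕ} (s : Fin m → ℂ) (X : State m) (k : Fin m) :
    ∏ j, s j ^ (X - Pi.single k 1 : State m) j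
      = (∏ j ∈ Finset.univ.erase k, s j ^ X j) * s k ^ (X k - 1) := by
  rw [← Finset.prod_erase_mul _ _ (Finset.mem_univ k)]
  congr 1
  · refine Finset.prod_congr rfl fun j hj => ?_
    simp [Finset.ne_of_mem_erase hj]
  · simp

/-- The right side is the derivative of the monomial along the backward vector field. After time
reversal the two cancel, which makes the monomial space-time harmonic. -/
theorem complexGen_prod_pow {m : ℕ} (s : Fin m → ℂ) (X : State m) :
    complexGen (fun X => ∏ j, s j ^ X j) X
      = ∑ k, (∏ j ∈ Finset.univ.erase k, s j ^ X j)
        * (X k * s k ^ (X k - 1) * (((m : ℂ) + k.val) * (offspringGF s k - s k))) := by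
  refine Finset.sum_congr rfl fun k _ => ?_
  by_cases hk : X k = 0
  · simp [hk]
  · have h1 : ∏ j, s j ^ X j = (∏ j ∈ Finset.univ.erase k, s j ^ X j) * s k ^ (X k - 1) * s k := by
      rw [← Finset.prod_erase_mul _ _ (Finset.mem_univ k), mul_assoc, pow_sub_one_mul hk]
    beta_reduce
    rw [prod_step, prod_pow_sub_single, ← offspringGF, h1]
    ring

section Trajectory

variable {m : ℕ} {Ω : Type*} [MeasurableSpace Ω] {μ : Measure Ω} [IsProbabilityMeasure μ]
  {V : State m} {L : ℝ≥0 → Ω → State m}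

/-- The generating function of a fringe process follows the backward equation. -/
theorem IsFringeProcess.integral_prod_pow (hL : IsFringeProcess μ V L) {T : ℝ}
    {σ : ℝ → Fin m → ℂ} (hσ1 : ∀ t ∈ Set.Icc 0 T, ∀ k, ‖σ t k‖ ≤ 1)
    (hσ : ∀ t ∈ Set.Icc 0 T, ∀ k, HasDerivWithinAt (fun t => σ t k)
        (((m : ℂ) + k.val) * (offspringGF (σ t) k - σ t k)) (Set.Icc 0 T) t)
    {t : ℝ≥0} (ht : (t : ℝ) ≤ T) :
    ∫ ω, ∏ j, σ 0 j ^ L t ω j ∂μ = ∏ j, σ t j ^ V j := by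
  have hmem : ∀ r : ℝ, 0 ≤ r → r ≤ t → (t : ℝ) - r ∈ Set.Icc 0 T := fun r h1 h2 =>
    ⟨by linarith, by linarith⟩
  have h := hL.setIntegral_eq_of_harmonic (s := 0) (t := t) (A := Set.univ)
    (f := fun r X => ∏ j, σ (t - r) j ^ X j)
    (f' := fun r X => ∑ k, (∏ j ∈ Finset.univ.erase k, σ (t - r) j ^ X j)
        * (X k * σ (t - r) k ^ (X k - 1)
          * -(((m : ℂ) + k.val) * (offspringGF (σ (t - r)) k - σ (t - r) k))))
    MeasurableSet.univ zero_le ?_ ?_ ?_ (C := 1) ?_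
  · simp only [Measure.restrict_univ, sub_self, NNReal.coe_zero, sub_zero] at h
    rw [h, integral_congr_ae (g := fun _ => ∏ j, σ t j ^ V j)]
    · simp
    · filter_upwards [hL.init] with ω hω
      rw [hω]
  · intro X
    refine continuousOn_finsetProd _ fun j _ => ContinuousOn.pow ?_ _
    have hc : ContinuousOn (fun t => σ t j) (Set.Icc 0 T) :=
      fun x hx => (hσ x hx j).continuousWithinAt
    exact hc.comp (continuous_const.sub continuous_id).continuousOn fun r hr => hmem r hr.1 hr.2
  · intro r X h1 h2
    simp only [NNReal.coe_zero] at h1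
    have hd : ∀ k, HasDerivAt (fun r => σ (t - r) k)
        (-(((m : ℂ) + k.val) * (offspringGF (σ (t - r)) k - σ (t - r) k))) r := by
      intro k
      have h3 := (hσ (t - r) (hmem r h1.le h2.le) k).hasDerivAt
        (Icc_mem_nhds (by linarith) (by linarith))
      have h4 := h3.scomp r ((hasDerivAt_id r).const_sub (t : ℝ))
      refine h4.congr_deriv ?_
      simp
    have hp := HasDerivAt.fun_finsetProd (u := Finset.univ) (x := r)
      fun k (_ : k ∈ Finset.univ) => (hd k).pow (X k)
    exact hp
  · intro r X h1 h2
    rw [complexGen_prod_pow, ← Finset.sum_add_distrib]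
    exact Finset.sum_eq_zero fun k _ => by ring
  · intro r X h1 h2
    refine (norm_prod_pow_le (hσ1 _ (hmem r h1 h2)) X).trans ?_
    rw [one_mul]
    exact le_add_of_nonneg_right (Nat.cast_nonneg _)

end Trajectory

/-! ### The branching equation for characteristic functions -/

/-- The characteristic functions of the limit variables satisfy the branching equation along the
flow `z ↦ exp (conj l * h) * z`. -/
theorem integral_cexp_flow {m : ℕ} {Ω : Fin m → Type*} [∀ k, MeasurableSpace (Ω k)]
    {μ : ∀ k, Measure (Ω k)} [∀ k, IsProbabilityMeasure (μ k)]
    {L : ∀ k, ℝ≥0 → Ω k → State m} (hL : ∀ k, IsFringeProcess (μ k) (Pi.single k 1) (L k))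
    {l : ℂ} {v : Fin m → ℂ} {W : ∀ k, Ω k → ℂ}
    (hW : ∀ k, ∀ᵐ ω ∂μ k,
      Tendsto (fun t : ℝ≥0 => scaledForm l v t (L k t ω)) atTop (𝓝 (W k ω)))
    (z : ℂ) {χ : ℝ → Fin m → ℂ} (hχ : ∀ h k, χ h k = ∫ ω, Complex.exp (Complex.I
      * ((z * (starRingEnd ℂ) (Complex.exp (l * h) * W k ω)).re : ℂ)) ∂μ k)
    {h : ℝ} (hh : 0 ≤ h) (k : Fin m) :
    χ h k - χ 0 k = ∫ r in (0 : ℝ)..h, ((m : ℂ) + k.val) * (offspringGF (χ r) k - χ r k) := by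
  -- These values turn the monomial `∏ j, s n j ^ X j` into a character of `weightForm v X`,
  -- rescaled as at time `n`. Evaluating at time `n + r` leaves the factor `exp (l r)`, which
  -- produces the flow.
  let s : ℕ → Fin m → ℂ := fun n j => Complex.exp (Complex.I
    * ((z * (starRingEnd ℂ) (Complex.exp (-l * (n : ℝ)) * (((m : ℂ) + j.val) * v j))).re : ℂ))
  have hs1 : ∀ n j, ‖s n j‖ ≤ 1 := fun n j => by
    simp only [s]; rw [mul_comm, Complex.norm_exp_ofReal_mul_I]
  have hsX : ∀ n (X : State m), ∏ j, s n j ^ X j = Complex.exp (Complex.I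
      * ((z * (starRingEnd ℂ) (Complex.exp (-l * (n : ℝ)) * weightForm v X)).re : ℂ)) := by
    intro n X
    simp only [s, ← Complex.exp_nat_mul, ← Complex.exp_sum]
    congr 1
    rw [weightForm, Finset.mul_sum, map_sum, Finset.mul_sum, Complex.re_sum, Complex.ofReal_sum,
      Finset.mul_sum]
    refine Finset.sum_congr rfl fun j _ => ?_
    have : z * (starRingEnd ℂ) (Complex.exp (-l * (n : ℝ)) * (((m : ℂ) + j.val) * v j * X j))
        = ((X j : ℝ) : ℂ)
          * (z * (starRingEnd ℂ) (Complex.exp (-l * (n : ℝ)) * (((m : ℂ) + j.val) * v j))) := by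
      simp only [map_mul, Complex.conj_natCast]; push_cast; ring
    rw [this, Complex.re_ofReal_mul]
    push_cast; ring
  choose σ hσ0 hσ1 hσ using fun n : ℕ =>
    exists_backward_solution (hs1 n) (T := n + h) (by positivity)
  have hval : ∀ (n : ℕ) (r : ℝ), 0 ≤ r → r ≤ h → ∀ k, σ n (n + r) k
      = ∫ ω, Complex.exp (Complex.I * ((z * (starRingEnd ℂ) (Complex.exp (l * r)
        * scaledForm l v (n + r) (L k (n + r).toNNReal ω))).re : ℂ)) ∂μ k := by
    intro n r hr0 hrh k
    have hc : (((n + r).toNNReal : ℝ≥0) : ℝ) = n + r := Real.coe_toNNReal _ (by positivity)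
    have h1 := (hL k).integral_prod_pow (hσ1 n) (hσ n) (t := (n + r).toNNReal)
      (by rw [hc]; linarith)
    rw [hσ0, hc] at h1
    have h2 : ∏ j, σ n (n + r) j ^ (Pi.single k 1 : State m) j = σ n (n + r) k := by
      rw [Finset.prod_eq_single k]
      · simp
      · intro j _ hj; simp [hj]
      · simp
    rw [← h2, ← h1]
    refine integral_congr_ae (Eventually.of_forall fun ω => ?_)
    simp only [hsX, scaledForm]
    rw [← mul_assoc, ← Complex.exp_add]
    congr 6
    push_cast; ring_nf
  have hlim : ∀ r : ℝ, 0 ≤ r → r ≤ h → ∀ k,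
      Tendsto (fun n : ℕ => σ n (n + r) k) atTop (𝓝 (χ r k)) := by
    intro r hr0 hrh k
    simp only [fun n : ℕ => hval n r hr0 hrh k, hχ]
    have hcont : Continuous fun w : ℂ => Complex.exp (Complex.I
        * ((z * (starRingEnd ℂ) (Complex.exp (l * r) * w)).re : ℂ)) := by
      have := Complex.continuous_conj
      fun_prop
    refine tendsto_integral_of_dominated_convergence (fun _ => 1) ?_ (integrable_const _) ?_ ?_
    · intro n
      exact ((hL k).measurable_comp (fun X => Complex.exp (Complex.I
        * ((z * (starRingEnd ℂ) (Complex.exp (l * r)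
          * scaledForm l v (n + r) X)).re : ℂ))) _).aestronglyMeasurable
    · refine fun n => Eventually.of_forall fun ω => ?_
      rw [mul_comm, Complex.norm_exp_ofReal_mul_I]
    · filter_upwards [hW k] with ω hω
      have ht : Tendsto (fun n : ℕ => ((n : ℝ) + r).toNNReal) atTop atTop :=
        tendsto_real_toNNReal_atTop.comp
          (tendsto_natCast_atTop_atTop.atTop_add tendsto_const_nhds)
      refine ((hcont.tendsto _).comp (hω.comp ht)).congr fun n => ?_
      simp only [Function.comp_def]
      rw [Real.coe_toNNReal _ (by positivity)]
  have hcontσ : ∀ n : ℕ, ContinuousOn (fun r => σ n (n + r)) (Set.Icc 0 h) := by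
    intro n
    refine continuousOn_pi.2 fun k => ?_
    have hc : ContinuousOn (fun t => σ n t k) (Set.Icc 0 (n + h)) :=
      fun x hx => (hσ n x hx k).continuousWithinAt
    exact hc.comp (continuous_const.add continuous_id).continuousOn fun r hr =>
      ⟨add_nonneg (Nat.cast_nonneg n) hr.1, by simpa using hr.2⟩
  have hfield : ∀ n : ℕ, ContinuousOn
      (fun r => ((m : ℂ) + k.val) * (offspringGF (σ n (n + r)) k - σ n (n + r) k))
      (Set.Icc 0 h) := fun n =>
    continuousOn_const.mul (((continuous_offspringGF k).comp_continuousOn (hcontσ n)).sub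
      ((continuous_apply k).comp_continuousOn (hcontσ n)))
  have hint : ∀ n : ℕ, σ n (n + h) k - σ n (n + 0) k
      = ∫ r in (0 : ℝ)..h, ((m : ℂ) + k.val) * (offspringGF (σ n (n + r)) k - σ n (n + r) k) := by
    intro n
    refine (intervalIntegral.integral_eq_sub_of_hasDerivAt_of_le hh
      (f := fun r => σ n (n + r) k) ((continuous_apply k).comp_continuousOn (hcontσ n))
      (fun r hr => ?_) ?_).symm
    · have h1 := (hσ n (n + r) ⟨add_nonneg (Nat.cast_nonneg n) hr.1.le, by simpa using hr.2.le⟩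
        k).hasDerivAt (Icc_mem_nhds (add_pos_of_nonneg_of_pos (Nat.cast_nonneg n) hr.1)
          (by simpa using hr.2))
      exact h1.comp_const_add (n : ℝ) r
    · refine ContinuousOn.intervalIntegrable ?_
      rw [Set.uIcc_of_le hh]
      exact hfield n
  have hl1 : Tendsto (fun n : ℕ => σ n (n + h) k - σ n (n + 0) k) atTop (𝓝 (χ h k - χ 0 k)) :=
    (hlim h hh le_rfl k).sub (hlim 0 le_rfl hh k)
  -- The integrated equation passes to the limit because all the `σ n` stay in the unit polydisc; no
  -- convergence of derivatives is needed.
  refine tendsto_nhds_unique hl1 ?_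
  simp only [hint]
  refine intervalIntegral.tendsto_integral_filter_of_dominated_convergence
    (fun _ => ((m : ℝ) + k.val) * (1 + 1)) ?_ ?_ intervalIntegrable_const ?_
  · refine Eventually.of_forall fun n => ContinuousOn.aestronglyMeasurable ?_ measurableSet_uIoc
    refine (hfield n).mono ?_
    rw [Set.uIoc_of_le hh]
    exact Set.Ioc_subset_Icc_self
  · refine Eventually.of_forall fun n => Eventually.of_forall fun r hr => ?_
    rw [Set.uIoc_of_le hh] at hr
    have hm : (n : ℝ) + r ∈ Set.Icc 0 (n + h) :=
      ⟨add_nonneg (Nat.cast_nonneg n) hr.1.le, by simpa using hr.2⟩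
    rw [norm_mul, norm_natCast_add_natCast]
    gcongr
    exact (norm_sub_le _ _).trans
      (add_le_add (norm_offspringGF_le (hσ1 n _ hm) k) (hσ1 n _ hm k))
  · refine Eventually.of_forall fun r hr => ?_
    rw [Set.uIoc_of_le hh] at hr
    have hr' : Tendsto (fun n : ℕ => σ n (n + r)) atTop (𝓝 (χ r)) :=
      tendsto_pi_nhds.2 fun j => hlim r hr.1.le hr.2 j
    exact ((((continuous_offspringGF k).tendsto _).comp hr').sub
      (hlim r hr.1.le hr.2 k)).const_mul _

/-! ### Holomorphy of the two-variable Laplace transform -/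

section Transform

variable {Ω : Type*} [MeasurableSpace Ω]

/-- The weighted two-variable Laplace transform
`(a, b) ↦ E (g W * exp (a * W + b * conj W))`. -/
noncomputable def transform (μ : Measure Ω) (W : Ω → ℂ) (g : ℂ → ℂ) (p : ℂ × ℂ) : ℂ :=
  ∫ ω, g (W ω) * Complex.exp (p.1 * W ω + p.2 * (starRingEnd ℂ) (W ω)) ∂μ

theorem re_exponent (p : ℂ × ℂ) (w : ℂ) :
    (p.1 * w + p.2 * (starRingEnd ℂ) w).re = inner ℝ ((starRingEnd ℂ) p.1 + p.2) w := by
  simp [Complex.inner]; ring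

theorem norm_cexp_exponent (p : ℂ × ℂ) (w : ℂ) :
    ‖Complex.exp (p.1 * w + p.2 * (starRingEnd ℂ) w)‖
      = Real.exp (inner ℝ ((starRingEnd ℂ) p.1 + p.2) w) := by
  rw [Complex.norm_exp, re_exponent]

/-- The four exponentials correspond to the four quadrants: in the quadrant of `w` one of them is
`exp (η (|re w| + |im w|))`. -/
theorem exp_mul_norm_le {η : ℝ} (hη : 0 ≤ η) (w : ℂ) :
    Real.exp (η * ‖w‖) ≤ Real.exp (inner ℝ (⟨η, η⟩ : ℂ) w) + Real.exp (inner ℝ (⟨η, -η⟩ : ℂ) w)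
      + Real.exp (inner ℝ (⟨-η, η⟩ : ℂ) w) + Real.exp (inner ℝ (⟨-η, -η⟩ : ℂ) w) := by
  have h1 : ‖w‖ ≤ |w.re| + |w.im| := Complex.norm_le_abs_re_add_abs_im w
  have p1 := Real.exp_pos (inner ℝ (⟨η, η⟩ : ℂ) w)
  have p2 := Real.exp_pos (inner ℝ (⟨η, -η⟩ : ℂ) w)
  have p3 := Real.exp_pos (inner ℝ (⟨-η, η⟩ : ℂ) w)
  have p4 := Real.exp_pos (inner ℝ (⟨-η, -η⟩ : ℂ) w)
  have key : ∀ c : ℂ, η * |w.re| + η * |w.im| = inner ℝ c w →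
      Real.exp (η * ‖w‖) ≤ Real.exp (inner ℝ c w) := fun c hc => by
    rw [← hc, Real.exp_le_exp, ← mul_add]; gcongr
  rcases abs_cases w.re with ⟨hr, -⟩ | ⟨hr, -⟩ <;> rcases abs_cases w.im with ⟨hi, -⟩ | ⟨hi, -⟩
  · have := key ⟨η, η⟩ (by rw [hr, hi]; simp [Complex.inner]; ring)
    linarith
  · have := key ⟨η, -η⟩ (by rw [hr, hi]; simp [Complex.inner]; ring)
    linarith
  · have := key ⟨-η, η⟩ (by rw [hr, hi]; simp [Complex.inner]; ring)
    linarith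
  · have := key ⟨-η, -η⟩ (by rw [hr, hi]; simp [Complex.inner]; ring)
    linarith

variable {μ : Measure Ω} {W : Ω → ℂ}

theorem exists_integrable_exp_add (hW : Measurable W) {z : ℂ}
    (hz : z ∈ interior {z : ℂ | Integrable (fun ω => Real.exp (inner ℝ z (W ω))) μ}) :
    ∃ η > 0, Integrable (fun ω => Real.exp (inner ℝ z (W ω) + η * ‖W ω‖)) μ := by
  obtain ⟨δ, hδ, hball⟩ := Metric.isOpen_iff.1 isOpen_interior z hz
  have hη : 0 < δ / 4 := by positivity
  refine ⟨δ / 4, hη, ?_⟩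
  have hc : ∀ c : ℂ, |c.re| ≤ δ / 4 → |c.im| ≤ δ / 4 →
      Integrable (fun ω => Real.exp (inner ℝ (z + c) (W ω))) μ := by
    intro c h1 h2
    have : z + c ∈ Metric.ball z δ := by
      rw [Metric.mem_ball, dist_eq_norm, add_sub_cancel_left]
      have := Complex.norm_le_abs_re_add_abs_im c
      linarith
    have h : z + c ∈ {z : ℂ | Integrable (fun ω => Real.exp (inner ℝ z (W ω))) μ} :=
      interior_subset (hball this)
    exact h
  have ha : |δ / 4| ≤ δ / 4 := (abs_of_pos hη).le
  have hb : |-(δ / 4)| ≤ δ / 4 := by rw [abs_neg]; exact ha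
  refine ((((hc ⟨δ / 4, δ / 4⟩ ha ha).add (hc ⟨δ / 4, -(δ / 4)⟩ ha hb)).add
    (hc ⟨-(δ / 4), δ / 4⟩ hb ha)).add (hc ⟨-(δ / 4), -(δ / 4)⟩ hb hb)).mono' ?_ ?_
  · have : Continuous fun w : ℂ => Real.exp (inner ℝ z w + δ / 4 * ‖w‖) := by fun_prop
    exact (this.measurable.comp hW).aestronglyMeasurable
  · refine Eventually.of_forall fun ω => ?_
    rw [Real.norm_of_nonneg (Real.exp_pos _).le]
    simp only [Pi.add_apply, inner_add_left, Real.exp_add, ← mul_add]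
    gcongr
    exact exp_mul_norm_le hη.le (W ω)

/-- Differentiation under the integral. In the interior of the domain there is room for a factor
`exp (η ‖w‖)`: half of `η` allows `p` to vary, the other half absorbs the polynomial factor, which
is quadratic since `g` grows linearly and differentiation brings down one more `w`. -/
theorem hasFDerivAt_transform (hW : Measurable W) {g : ℂ → ℂ} (hg : Continuous g) {C : ℝ}
    (hC : ∀ w, ‖g w‖ ≤ C * (1 + ‖w‖)) {p : ℂ × ℂ}
    (hp : (starRingEnd ℂ) p.1 + p.2
      ∈ interior {z : ℂ | Integrable (fun ω => Real.exp (inner ℝ z (W ω))) μ}) :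
    HasFDerivAt (transform μ W g)
      (transform μ W (fun w => g w * w) p • ContinuousLinearMap.fst ℂ ℂ ℂ
        + transform μ W (fun w => g w * (starRingEnd ℂ) w) p • ContinuousLinearMap.snd ℂ ℂ ℂ)
      p := by
  obtain ⟨η, hη, hint⟩ := exists_integrable_exp_add hW hp
  have hconj := Complex.continuous_conj
  have hC0 : 0 ≤ C := by
    have := (norm_nonneg _).trans (hC 0)
    simpa using this
  obtain ⟨K, hK0, hK⟩ : ∃ K : ℝ, 0 ≤ K ∧ ∀ x : ℝ, 0 ≤ x →
      (1 + x) * (1 + x) ≤ K * Real.exp (η / 2 * x) := by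
    refine ⟨(1 + 4 / η) ^ 2, by positivity, fun x hx => ?_⟩
    have h1 : 1 + x ≤ (1 + 4 / η) * Real.exp (η / 4 * x) := by
      calc 1 + x ≤ (1 + 4 / η) * (1 + η / 4 * x) := by
            have : (1 + 4 / η) * (1 + η / 4 * x) = 1 + x + (4 / η + η / 4 * x) := by
              field_simp; ring
            rw [this]
            have : 0 ≤ 4 / η + η / 4 * x := by positivity
            linarith
        _ ≤ _ := by
            gcongr
            have := Real.add_one_le_exp (η / 4 * x)
            linarith
    calc (1 + x) * (1 + x)
        ≤ ((1 + 4 / η) * Real.exp (η / 4 * x)) * ((1 + 4 / η) * Real.exp (η / 4 * x)) := by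
          gcongr
      _ = (1 + 4 / η) ^ 2 * (Real.exp (η / 4 * x) * Real.exp (η / 4 * x)) := by ring
      _ = _ := by rw [← Real.exp_add]; ring_nf
  let S : Set (ℂ × ℂ) := {q | ‖((starRingEnd ℂ) q.1 + q.2) - ((starRingEnd ℂ) p.1 + p.2)‖ < η / 2}
  have hS : S ∈ 𝓝 p := by
    refine IsOpen.mem_nhds (isOpen_lt (by fun_prop) continuous_const) ?_
    simp only [S, Set.mem_ofPred_eq, sub_self, norm_zero]
    positivity
  have hexp : ∀ q ∈ S, ∀ w : ℂ, ‖Complex.exp (q.1 * w + q.2 * (starRingEnd ℂ) w)‖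
      ≤ Real.exp (inner ℝ ((starRingEnd ℂ) p.1 + p.2) w + η / 2 * ‖w‖) := by
    intro q hq w
    rw [norm_cexp_exponent, Real.exp_le_exp]
    have h1 : (starRingEnd ℂ) q.1 + q.2 = ((starRingEnd ℂ) p.1 + p.2)
        + (((starRingEnd ℂ) q.1 + q.2) - ((starRingEnd ℂ) p.1 + p.2)) := by ring
    rw [h1, inner_add_left]
    gcongr
    refine (real_inner_le_norm _ _).trans ?_
    gcongr
    exact le_of_lt hq
  have hbd : ∀ q ∈ S, ∀ (w : ℂ) (a : ℂ), ‖a‖ ≤ C * (1 + ‖w‖) * (1 + ‖w‖) →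
      ‖a * Complex.exp (q.1 * w + q.2 * (starRingEnd ℂ) w)‖
        ≤ C * K * Real.exp (inner ℝ ((starRingEnd ℂ) p.1 + p.2) w + η * ‖w‖) := by
    intro q hq w a ha
    rw [norm_mul]
    have e : Real.exp (inner ℝ ((starRingEnd ℂ) p.1 + p.2) w + η * ‖w‖)
        = Real.exp (η / 2 * ‖w‖)
          * Real.exp (inner ℝ ((starRingEnd ℂ) p.1 + p.2) w + η / 2 * ‖w‖) := by
      rw [← Real.exp_add]; congr 1; ring
    rw [e, ← mul_assoc]
    refine mul_le_mul (ha.trans ?_) (hexp q hq w) (norm_nonneg _) (by positivity)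
    rw [mul_assoc, mul_assoc]
    exact mul_le_mul_of_nonneg_left (hK _ (norm_nonneg _)) hC0
  have hg1 : ∀ w, ‖g w‖ ≤ C * (1 + ‖w‖) * (1 + ‖w‖) := fun w =>
    (hC w).trans (le_mul_of_one_le_right (by positivity) (by linarith [norm_nonneg w]))
  have hg2 : ∀ w, ‖g w * w‖ ≤ C * (1 + ‖w‖) * (1 + ‖w‖) := fun w => by
    rw [norm_mul]; gcongr; exacts [hC w, by linarith]
  have hg3 : ∀ w, ‖g w * (starRingEnd ℂ) w‖ ≤ C * (1 + ‖w‖) * (1 + ‖w‖) := fun w => by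
    rw [norm_mul, RCLike.norm_conj]; gcongr; exacts [hC w, by linarith]
  have hmeas : ∀ {g : ℂ → ℂ} (_ : Continuous g) (q : ℂ × ℂ), AEStronglyMeasurable
      (fun ω => g (W ω) * Complex.exp (q.1 * W ω + q.2 * (starRingEnd ℂ) (W ω))) μ :=
    fun {g} hg q => by
      have : Continuous fun w => g w * Complex.exp (q.1 * w + q.2 * (starRingEnd ℂ) w) := by
        fun_prop
      exact (this.measurable.comp hW).aestronglyMeasurable
  have hbint := hint.const_mul (C * K)
  have hpS : p ∈ S := mem_of_mem_nhds hS
  have hi2 : Integrable (fun ω => g (W ω) * W ω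
      * Complex.exp (p.1 * W ω + p.2 * (starRingEnd ℂ) (W ω))) μ :=
    hbint.mono' (hmeas (by fun_prop : Continuous fun w => g w * w) p)
      (Eventually.of_forall fun ω => hbd p hpS _ _ (hg2 _))
  have hi3 : Integrable (fun ω => g (W ω) * (starRingEnd ℂ) (W ω)
      * Complex.exp (p.1 * W ω + p.2 * (starRingEnd ℂ) (W ω))) μ :=
    hbint.mono' (hmeas (by fun_prop : Continuous fun w => g w * (starRingEnd ℂ) w) p)
      (Eventually.of_forall fun ω => hbd p hpS _ _ (hg3 _))
  have hmain := hasFDerivAt_integral_of_dominated_of_fderiv_le (𝕜 := ℂ) (μ := μ) (s := S)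
    (F := fun (q : ℂ × ℂ) ω =>
      g (W ω) * Complex.exp (q.1 * W ω + q.2 * (starRingEnd ℂ) (W ω)))
    (F' := fun q ω =>
      (g (W ω) * W ω * Complex.exp (q.1 * W ω + q.2 * (starRingEnd ℂ) (W ω)))
          • ContinuousLinearMap.fst ℂ ℂ ℂ
        + (g (W ω) * (starRingEnd ℂ) (W ω)
          * Complex.exp (q.1 * W ω + q.2 * (starRingEnd ℂ) (W ω)))
          • ContinuousLinearMap.snd ℂ ℂ ℂ)
    (bound := fun ω => 2 * (C * K
      * Real.exp (inner ℝ ((starRingEnd ℂ) p.1 + p.2) (W ω) + η * ‖W ω‖)))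
    (x₀ := p) hS (Eventually.of_forall fun q => hmeas hg q)
    (hbint.mono' (hmeas hg p) (Eventually.of_forall fun ω => hbd p hpS _ _ (hg1 _)))
    ((hi2.aestronglyMeasurable.smul_const _).add (hi3.aestronglyMeasurable.smul_const _))
    (Eventually.of_forall fun ω q hq => ?_) (hbint.const_mul 2)
    (Eventually.of_forall fun ω q _ => ?_)
  · rw [integral_add (hi2.smul_const _) (hi3.smul_const _), integral_smul_const,
      integral_smul_const] at hmain
    exact hmain
  · refine (norm_add_le _ _).trans ?_
    rw [norm_smul, norm_smul, two_mul]
    refine add_le_add ?_ ?_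
    · exact (mul_le_of_le_one_right (norm_nonneg _) (ContinuousLinearMap.norm_fst_le _ _ _)).trans
        (hbd q hq _ _ (hg2 _))
    · exact (mul_le_of_le_one_right (norm_nonneg _) (ContinuousLinearMap.norm_snd_le _ _ _)).trans
        (hbd q hq _ _ (hg3 _))
  · have h1 : HasFDerivAt (fun q : ℂ × ℂ => q.1 * W ω + q.2 * (starRingEnd ℂ) (W ω))
        (W ω • ContinuousLinearMap.fst ℂ ℂ ℂ
          + (starRingEnd ℂ) (W ω) • ContinuousLinearMap.snd ℂ ℂ ℂ) q :=
      (hasFDerivAt_fst.mul_const _).add (hasFDerivAt_snd.mul_const _)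
    refine (h1.cexp.const_mul (g (W ω))).congr_fderiv ?_
    ext <;> simp <;> ring

theorem hasDerivAt_transform_comp (hW : Measurable W) {𝕜 : Type*} [NontriviallyNormedField 𝕜]
    [NormedAlgebra 𝕜 ℂ] {g : ℂ → ℂ} (hg : Continuous g) {C : ℝ}
    (hC : ∀ w, ‖g w‖ ≤ C * (1 + ‖w‖)) {p : 𝕜 → ℂ × ℂ} {p' : ℂ × ℂ} {t : 𝕜}
    (hp : (starRingEnd ℂ) (p t).1 + (p t).2
      ∈ interior {z : ℂ | Integrable (fun ω => Real.exp (inner ℝ z (W ω))) μ})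
    (hd : HasDerivAt p p' t) :
    HasDerivAt (fun t => transform μ W g (p t))
      (transform μ W (fun w => g w * w) (p t) * p'.1
        + transform μ W (fun w => g w * (starRingEnd ℂ) w) (p t) * p'.2) t := by
  have h := ((hasFDerivAt_transform hW hg hC hp).restrictScalars 𝕜).comp_hasDerivAt t hd
  refine h.congr_deriv ?_
  simp

end Transform

/-! ### Analytic continuation of the branching equation to the tube -/

theorem convex_integrable_exp {m : ℕ} {Ω : Fin m → Type*} [∀ k, MeasurableSpace (Ω k)]
    {μ : ∀ k, Measure (Ω k)} {W : ∀ k, Ω k → ℂ} (hW : ∀ k, Measurable (W k)) :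
    Convex ℝ (laplaceDomain μ W) := by
  refine Convex.interior fun x hx y hy a b ha hb hab k => ?_
  refine (((hx k).const_mul a).add ((hy k).const_mul b)).mono' ?_ ?_
  · have : Continuous fun w : ℂ => Real.exp (inner ℝ (a • x + b • y) w) := by fun_prop
    exact (this.measurable.comp (hW k)).aestronglyMeasurable
  · refine Eventually.of_forall fun ω => ?_
    rw [Real.norm_of_nonneg (Real.exp_pos _).le, inner_add_left, real_inner_smul_left,
      real_inner_smul_left]
    exact convexOn_exp.2 (Set.mem_univ _) (Set.mem_univ _) ha hb hab

theorem mem_interior_of_mem_laplaceDomain {m : ℕ} {Ω : Fin m → Type*}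
    [∀ k, MeasurableSpace (Ω k)] {μ : ∀ k, Measure (Ω k)} {W : ∀ k, Ω k → ℂ} {z : ℂ}
    (hz : z ∈ laplaceDomain μ W) (k : Fin m) :
    z ∈ interior {z : ℂ | Integrable (fun ω => Real.exp (inner ℝ z (W k ω))) (μ k)} := by
  refine interior_mono ?_ hz
  intro x hx
  have h : ∀ k, Integrable (fun ω => Real.exp (inner ℝ x (W k ω))) (μ k) := hx
  exact h k

/-- The flow `(a, b) ↦ (exp (l h) a, exp (conj l h) b)`. -/
noncomputable def expFlow (l : ℂ) (p : ℂ × ℂ) (h : ℝ) : ℂ × ℂ :=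
  (Complex.exp (l * h) * p.1, Complex.exp ((starRingEnd ℂ) l * h) * p.2)

theorem hasDerivAt_expFlow (l : ℂ) (p : ℂ × ℂ) (h : ℝ) :
    HasDerivAt (expFlow l p)
      (l * (expFlow l p h).1, (starRingEnd ℂ) l * (expFlow l p h).2) h := by
  have key : ∀ c a : ℂ, HasDerivAt (fun h : ℝ => Complex.exp (c * h) * a)
      (c * (Complex.exp (c * h) * a)) h := fun c a => by
    have h1 := ((((hasDerivAt_id h).ofReal_comp).const_mul c).cexp).mul_const a
    refine h1.congr_deriv ?_
    simp only [id, Complex.ofReal_one]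
    ring
  exact (key l p.1).prodMk (key ((starRingEnd ℂ) l) p.2)

theorem expFlow_zero (l : ℂ) (p : ℂ × ℂ) : expFlow l p 0 = p := by
  simp [expFlow]

theorem conj_expFlow_add (l : ℂ) (p : ℂ × ℂ) (h : ℝ) :
    (starRingEnd ℂ) (expFlow l p h).1 + (expFlow l p h).2
      = Complex.exp ((starRingEnd ℂ) l * h) * ((starRingEnd ℂ) p.1 + p.2) := by
  simp only [expFlow, map_mul, ← Complex.exp_conj, Complex.conj_ofReal]
  ring

section Family

variable {m : ℕ} {Ω : Fin m → Type*} [∀ k, MeasurableSpace (Ω k)]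

/-- The two-variable Laplace transforms of a family of random variables. -/
noncomputable def familyTransform (μ : ∀ k, Measure (Ω k)) (W : ∀ k, Ω k → ℂ) (p : ℂ × ℂ)
    (k : Fin m) : ℂ := transform (μ k) (W k) (fun _ => 1) p

/-- The difference of the two members of the branching equation at `p`. -/
noncomputable def branchingDefect (μ : ∀ k, Measure (Ω k)) (W : ∀ k, Ω k → ℂ) (l : ℂ) (k : Fin m)
    (p : ℂ × ℂ) : ℂ :=
  transform (μ k) (W k) (fun w => w) p * (l * p.1)
    + transform (μ k) (W k) (fun w => (starRingEnd ℂ) w) p * ((starRingEnd ℂ) l * p.2)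
    - ((m : ℂ) + k.val) * (offspringGF (familyTransform μ W p) k - familyTransform μ W p k)

variable {μ : ∀ k, Measure (Ω k)} {W : ∀ k, Ω k → ℂ}

theorem hasDerivAt_familyTransform (hW : ∀ k, Measurable (W k)) {𝕜 : Type*}
    [NontriviallyNormedField 𝕜] [NormedAlgebra 𝕜 ℂ] {p : 𝕜 → ℂ × ℂ} {p' : ℂ × ℂ} {t : 𝕜}
    (hp : (starRingEnd ℂ) (p t).1 + (p t).2 ∈ laplaceDomain μ W) (hd : HasDerivAt p p' t)
    (k : Fin m) :
    HasDerivAt (fun t => familyTransform μ W (p t) k)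
      (transform (μ k) (W k) (fun w => w) (p t) * p'.1
        + transform (μ k) (W k) (fun w => (starRingEnd ℂ) w) (p t) * p'.2) t := by
  have h := hasDerivAt_transform_comp (hW k) (g := fun _ => 1) continuous_const (C := 1)
    (fun w => by simp) (mem_interior_of_mem_laplaceDomain hp k) hd
  simp only [one_mul] at h
  exact h

/-- The differential form of the equation is the derivative at `h = 0` of its integrated form. The
latter is known for `h ≥ 0` only, whence the comparison of right derivatives. -/
theorem branchingDefect_eq_zero_of_flow (hW : ∀ k, Measurable (W k)) {l : ℂ}
    (h0 : (0 : ℂ) ∈ laplaceDomain μ W)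
    (hflow : ∀ p : ℂ × ℂ, (starRingEnd ℂ) p.1 + p.2 = 0 → ∀ h : ℝ, 0 ≤ h → ∀ k,
      familyTransform μ W (expFlow l p h) k - familyTransform μ W p k
        = ∫ r in (0 : ℝ)..h, ((m : ℂ) + k.val) * (offspringGF (familyTransform μ W (expFlow l p r)) k
          - familyTransform μ W (expFlow l p r) k))
    {p : ℂ × ℂ} (hp : (starRingEnd ℂ) p.1 + p.2 = 0) (k : Fin m) :
    branchingDefect μ W l k p = 0 := by
  have hmem : ∀ h, (starRingEnd ℂ) (expFlow l p h).1 + (expFlow l p h).2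
      ∈ laplaceDomain μ W := fun h => by rw [conj_expFlow_add, hp, mul_zero]; exact h0
  have hd : ∀ h k, HasDerivAt (fun h => familyTransform μ W (expFlow l p h) k) _ h := fun h k =>
    hasDerivAt_familyTransform hW (hmem h) (hasDerivAt_expFlow l p h) k
  have hc : Continuous fun h => familyTransform μ W (expFlow l p h) :=
    continuous_pi fun k => continuous_iff_continuousAt.2 fun h => (hd h k).continuousAt
  have hcf : Continuous fun r => ((m : ℂ) + k.val)
      * (offspringGF (familyTransform μ W (expFlow l p r)) k
        - familyTransform μ W (expFlow l p r) k) :=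
    continuous_const.mul (((continuous_offspringGF k).comp hc).sub ((continuous_apply k).comp hc))
  have h1 := (hcf.integral_hasStrictDerivAt 0 0).hasDerivAt
  have h2 : HasDerivWithinAt (fun h => familyTransform μ W (expFlow l p h) k)
      (((m : ℂ) + k.val) * (offspringGF (familyTransform μ W (expFlow l p 0)) k
        - familyTransform μ W (expFlow l p 0) k)) (Set.Ici 0) 0 := by
    refine (h1.const_add (familyTransform μ W p k)).hasDerivWithinAt.congr (fun h hh => ?_) ?_
    · rw [← hflow p hp h hh k]; ring
    · rw [← hflow p hp 0 le_rfl k]; ring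
  have h3 := (uniqueDiffWithinAt_convex (convex_Ici (0 : ℝ)) (by simp)
    (subset_closure Set.self_mem_Ici)).eq_deriv _ (hd 0 k).hasDerivWithinAt h2
  rw [expFlow_zero] at h3
  rw [branchingDefect, h3, sub_self]

/-- The branching equation extends from the imaginary subspace to the whole tube domain. -/
theorem branchingDefect_eq_zero (hW : ∀ k, Measurable (W k)) {l : ℂ}
    (h0 : (0 : ℂ) ∈ laplaceDomain μ W)
    (hi : ∀ p : ℂ × ℂ, (starRingEnd ℂ) p.1 + p.2 = 0 → ∀ k, branchingDefect μ W l k p = 0)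
    {p : ℂ × ℂ} (hp : (starRingEnd ℂ) p.1 + p.2 ∈ laplaceDomain μ W) (k : Fin m) :
    branchingDefect μ W l k p = 0 := by
  set z₀ := (starRingEnd ℂ) p.1 + p.2 with hz₀
  -- The complex line `q` passes through `p` at `t = 1`, and `conj q.1 + q.2 = (re t) z₀`. It meets
  -- the subspace `conj a + b = 0` along the imaginary axis, and stays in the tube for `t` in a
  -- convex strip containing `0` and `1`.
  let d : ℂ × ℂ := ((starRingEnd ℂ) z₀ / 2, z₀ / 2)
  let q : ℂ → ℂ × ℂ := fun t => (p - d) + t • d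
  have hconj : ∀ t, (starRingEnd ℂ) (q t).1 + (q t).2 = t.re • z₀ := by
    intro t
    have ht : (t.re : ℂ) = (t + (starRingEnd ℂ) t) / 2 := Complex.re_eq_add_conj t
    rw [Complex.real_smul, ht]
    simp only [q, d, Prod.fst_add, Prod.snd_add, Prod.fst_sub, Prod.snd_sub, Prod.smul_fst,
      Prod.smul_snd, smul_eq_mul, map_add, map_sub, map_mul, map_div₀, Complex.conj_conj,
      Complex.conj_ofNat, hz₀]
    ring
  have hq : ∀ t, HasDerivAt q d t := fun t => by
    exact (((hasDerivAt_id t).smul_const d).const_add (p - d)).congr_deriv (one_smul _ _)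
  let S : Set ℂ := {t | t.re • z₀ ∈ laplaceDomain μ W}
  have hSo : IsOpen S := isOpen_interior.preimage
    (by fun_prop : Continuous fun t : ℂ => t.re • z₀)
  have hSc : IsPreconnected S :=
    ((convex_integrable_exp hW).linear_preimage
      ((LinearMap.toSpanSingleton ℝ ℂ z₀).comp Complex.reLm)).isPreconnected
  have hS0 : (0 : ℂ) ∈ S := by
    have : (0 : ℂ).re • z₀ ∈ laplaceDomain μ W := by simpa using h0
    exact this
  have hS1 : (1 : ℂ) ∈ S := by
    have : (1 : ℂ).re • z₀ ∈ laplaceDomain μ W := by simpa using hp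
    exact this
  have hmem : ∀ t ∈ S, (starRingEnd ℂ) (q t).1 + (q t).2 ∈ laplaceDomain μ W := fun t ht => by
    rw [hconj]; exact ht
  have hdiff : DifferentiableOn ℂ (fun t => branchingDefect μ W l k (q t)) S := by
    intro t ht
    refine DifferentiableAt.differentiableWithinAt ?_
    have hk := mem_interior_of_mem_laplaceDomain (hmem t ht) k
    have d1 : ∀ j, DifferentiableAt ℂ (fun t => familyTransform μ W (q t) j) t := fun j =>
      (hasDerivAt_familyTransform hW (hmem t ht) (hq t) j).differentiableAt
    have d2 : DifferentiableAt ℂ (fun t => transform (μ k) (W k) (fun w => w) (q t)) t :=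
      (hasDerivAt_transform_comp (hW k) continuous_id (C := 1) (fun w => by simp) hk
        (hq t)).differentiableAt
    have d3 : DifferentiableAt ℂ
        (fun t => transform (μ k) (W k) (fun w => (starRingEnd ℂ) w) (q t)) t :=
      (hasDerivAt_transform_comp (hW k) Complex.continuous_conj (C := 1) (fun w => by simp) hk
        (hq t)).differentiableAt
    have d4 : DifferentiableAt ℂ (fun t => (q t).1) t := (hq t).differentiableAt.fst
    have d5 : DifferentiableAt ℂ (fun t => (q t).2) t := (hq t).differentiableAt.snd
    have d6 : DifferentiableAt ℂ (fun t => offspringGF (familyTransform μ W (q t)) k) t := by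
      simp only [offspringGF]
      exact DifferentiableAt.fun_finsetProd fun j _ => (d1 j).pow _
    simp only [branchingDefect]
    exact ((d2.mul (d4.const_mul l)).add (d3.mul (d5.const_mul _))).sub
      ((d6.sub (d1 k)).const_mul _)
  -- The imaginary axis accumulates at `0`, which suffices for the identity theorem in one variable.
  have hfreq : ∃ᶠ t in 𝓝[≠] (0 : ℂ), branchingDefect μ W l k (q t) = 0 := by
    have ht : Tendsto (fun τ : ℝ => Complex.I * (τ : ℂ)) (𝓝[≠] 0) (𝓝[≠] 0) := by
      refine tendsto_nhdsWithin_iff.2 ⟨?_, ?_⟩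
      · have : Continuous fun τ : ℝ => Complex.I * (τ : ℂ) := by fun_prop
        simpa using (this.tendsto 0).mono_left nhdsWithin_le_nhds
      · filter_upwards [self_mem_nhdsWithin] with τ hτ
        simpa using hτ
    refine ht.frequently (Eventually.frequently (Eventually.of_forall fun τ => hi _ ?_ k))
    rw [hconj]; simp
  have h := (hdiff.analyticOnNhd hSo).eqOn_zero_of_preconnected_of_frequently_eq_zero hSc hS0
    hfreq hS1
  have hq1 : q 1 = p := by simp [q]
  simpa [hq1] using h

end Family

/-- The branching equation for the transforms of the limit variables of the fringe processes. -/
theorem branchingDefect_eq_zero_of_fringe {m : ℕ} {Ω : Fin m → Type*}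
    [∀ k, MeasurableSpace (Ω k)] {μ : ∀ k, Measure (Ω k)} [∀ k, IsProbabilityMeasure (μ k)]
    {L : ∀ k, ℝ≥0 → Ω k → State m} (hL : ∀ k, IsFringeProcess (μ k) (Pi.single k 1) (L k))
    {l : ℂ} {v : Fin m → ℂ} {W : ∀ k, Ω k → ℂ} (hWm : ∀ k, Measurable (W k))
    (hW : ∀ k, ∀ᵐ ω ∂μ k,
      Tendsto (fun t : ℝ≥0 => scaledForm l v t (L k t ω)) atTop (𝓝 (W k ω)))
    (h0 : (0 : ℂ) ∈ laplaceDomain μ W) {p : ℂ × ℂ}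
    (hp : (starRingEnd ℂ) p.1 + p.2 ∈ laplaceDomain μ W) (k : Fin m) :
    branchingDefect μ W l k p = 0 := by
  refine branchingDefect_eq_zero hWm h0 (fun p hp k => ?_) hp k
  refine branchingDefect_eq_zero_of_flow hWm h0 (fun p hp h hh k => ?_) hp k
  -- On the subspace `p.1 = -conj p.2`, so the exponent `p.1 * w + p.2 * conj w` is `2 i Im (p.2 *
  -- conj w) = i Re (-2 i p.2 * conj w)`.
  have key := integral_cexp_flow hL hW (-2 * Complex.I * p.2)
    (χ := fun h => familyTransform μ W (expFlow l p h)) (fun h k => ?_) hh k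
  · simpa only [expFlow_zero] using key
  · have h1 : p.1 = -(starRingEnd ℂ) p.2 := by
      have := congrArg (starRingEnd ℂ) hp
      simp only [map_add, Complex.conj_conj, map_zero] at this
      exact eq_neg_of_add_eq_zero_left this
    refine integral_congr_ae (Eventually.of_forall fun ω => ?_)
    simp only [one_mul]
    congr 1
    rw [Complex.re_eq_add_conj]
    simp only [expFlow, h1, map_mul, map_neg, Complex.conj_I, Complex.conj_conj, ← Complex.exp_conj,
      Complex.conj_ofReal, Complex.conj_ofNat]
    ring_nf
    simp only [Complex.I_sq]
    ring

/-! ### The eigenform as an eigenvector of the replacement matrix -/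

/-- The coefficients of the linear form `eigenform m l`. -/
noncomputable def eigenCoeff (m : ℕ) (l : ℂ) (k : Fin m) : ℂ :=
  ∏ j ∈ Finset.range k.val, (l + (m : ℂ) + (j : ℂ)) / (1 + (m : ℂ) + (j : ℂ))

theorem eigenform_gaps {m : ℕ} (l : ℂ) (X : State m) :
    eigenform m l (gaps X) = weightForm (eigenCoeff m l) X := by
  refine Finset.sum_congr rfl fun k _ => ?_
  simp only [eigenCoeff, gaps]; ring

theorem mulVec_replacementMatrix {m : ℕ} (hm : 2 ≤ m) (x : Fin m → ℂ) (k : Fin m) :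
    (replacementMatrix m).mulVec x k
      = ∑ j : Fin m, ((m : ℂ) + j.val) * x j * (offspring k j : ℂ)
        - ((m : ℂ) + k.val) * x k := by
  by_cases hk : k.val + 1 < m
  · rw [sum_mul_offspring_of_lt (fun j => ((m : ℂ) + j.val) * x j) k hk]
    simp only [Matrix.mulVec, dotProduct, replacementMatrix, add_mul, ite_mul, zero_mul,
      Finset.sum_add_distrib, Finset.sum_ite_eq', Finset.mem_univ, if_true]
    have h1 : ∀ j : Fin m, j.val = k.val + 1 ↔ j = ⟨k.val + 1, hk⟩ := fun j =>
      ⟨fun h => Fin.ext h, fun h => by rw [h]⟩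
    have h2 : ∀ j : Fin m, ¬ (k.val + 1 = m ∧ j.val = 0) := fun j h => by omega
    simp only [h1, h2, if_false, Finset.sum_const_zero, Finset.sum_ite_eq', Finset.mem_univ,
      if_true]
    push_cast; ring
  · rw [sum_mul_offspring_of_not_lt (fun j => ((m : ℂ) + j.val) * x j) k hk]
    simp only [Matrix.mulVec, dotProduct, replacementMatrix, add_mul, ite_mul, zero_mul,
      Finset.sum_add_distrib, Finset.sum_ite_eq', Finset.mem_univ, if_true]
    have h0 : 0 < m := by omega
    have h1 : ∀ j : Fin m, ¬ (j.val = k.val + 1) := fun j h => by have := j.isLt; omega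
    have h2 : ∀ j : Fin m, (k.val + 1 = m ∧ j.val = 0) ↔ j = ⟨0, h0⟩ := fun j =>
      ⟨fun h => Fin.ext h.2, fun h => ⟨by have := k.isLt; omega, by rw [h]⟩⟩
    simp only [h1, h2, if_false, Finset.sum_const_zero, Finset.sum_ite_eq', Finset.mem_univ,
      if_true]
    push_cast; ring

/-- All rows but the last of the eigenvector equation form a recurrence, so an eigenvector is `x 0`
times `eigenCoeff` and `x 0 ≠ 0`. The last row, which is the characteristic equation, is then
inherited from the eigenvector. -/
theorem isEigenweight_eigenCoeff {m : ℕ} (hm : 2 ≤ m) {l : ℂ}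
    (hl : Module.End.HasEigenvalue (Matrix.toLin' (replacementMatrix m)) l) :
    IsEigenweight l (eigenCoeff m l) := by
  obtain ⟨x, hx⟩ := hl.exists_hasEigenvector
  have hxe : ∀ k, ∑ j : Fin m, ((m : ℂ) + j.val) * x j * (offspring k j : ℂ)
      - ((m : ℂ) + k.val) * x k = l * x k := by
    intro k
    rw [← mulVec_replacementMatrix hm]
    have := congrFun hx.apply_eq_smul k
    simpa [Matrix.toLin'_apply] using this
  have h0 : 0 < m := by omega
  have hxk : ∀ (n : ℕ) (hn : n < m), x ⟨n, hn⟩ = x ⟨0, h0⟩ * eigenCoeff m l ⟨n, hn⟩ := by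
    intro n
    induction n with
    | zero => intro hn; simp [eigenCoeff]
    | succ n ih =>
      intro hn
      have h1 := hxe ⟨n, by omega⟩
      rw [sum_mul_offspring_of_lt (fun j => ((m : ℂ) + j.val) * x j) _ hn] at h1
      simp only [ih (by omega)] at h1
      have hne : (1 + (m : ℂ) + (n : ℂ)) ≠ 0 := by
        have : ((1 + m + n : ℕ) : ℂ) ≠ 0 := Nat.cast_ne_zero.2 (by omega)
        exact_mod_cast this
      have h2 : eigenCoeff m l ⟨n + 1, hn⟩
          = eigenCoeff m l ⟨n, by omega⟩ * ((l + (m : ℂ) + (n : ℂ)) / (1 + (m : ℂ) + (n : ℂ))) := by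
        simp only [eigenCoeff, Finset.prod_range_succ]
      rw [h2, mul_div_assoc', mul_div_assoc', eq_div_iff hne]
      push_cast at h1
      linear_combination h1
  have hx0 : x ⟨0, h0⟩ ≠ 0 := by
    intro h
    refine hx.2 (funext fun k => ?_)
    rw [hxk k.val k.isLt, h, zero_mul]; rfl
  intro k
  have h1 := hxe k
  have h2 : ∀ j : Fin m, x j = x ⟨0, h0⟩ * eigenCoeff m l j := fun j => hxk j.val j.isLt
  rw [h2 k, Finset.sum_congr rfl (g := fun j : Fin m => x ⟨0, h0⟩
    * (((m : ℂ) + j.val) * eigenCoeff m l j * (offspring k j : ℂ))) (fun j _ => by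
      rw [h2 j]; ring), ← Finset.mul_sum] at h1
  refine mul_left_cancel₀ hx0 ?_
  linear_combination h1

/-! ### The change of function and the differential system -/

theorem psiCoeff_succ {m : ℕ} (hm : 2 ≤ m) (k : ℕ) :
    psiCoeff m (k + 1) = -((m : ℂ) + k) * psiCoeff m k := by
  have h1 : (m + k + 1 - 1).factorial = (m + k) * (m + k - 1).factorial := by
    rw [Nat.mul_factorial_pred (by omega)]; rfl
  simp only [psiCoeff, ← add_assoc m k 1, h1, pow_succ]
  push_cast
  ring

theorem psiCoeff_zero_sq {m : ℕ} (hm : 2 ≤ m) :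
    psiCoeff m 0 ^ 2 = -((m : ℂ) + (m - 1 : ℕ)) * psiCoeff m (m - 1) := by
  obtain ⟨n, rfl⟩ : ∃ n, m = n + 1 := ⟨m - 1, by omega⟩
  have h1 : 2 * (n + 1) - 1 = 2 * n + 1 := by omega
  have h3 : n + 1 + n = 2 * n + 1 := by omega
  have hf : (n.factorial : ℂ) ≠ 0 := Nat.cast_ne_zero.2 n.factorial_ne_zero
  simp only [psiCoeff, h1, h3, add_zero, Nat.add_sub_cancel, Nat.factorial_succ (2 * n)]
  have h4 : ((-1 : ℂ)) ^ (2 * n + 1) = -1 := by rw [pow_succ, pow_mul]; simp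
  have h5 : (((-1 : ℂ)) ^ (n + 1)) ^ 2 = 1 := by rw [← pow_mul, mul_comm, pow_mul]; simp
  rw [h4, mul_pow, h5]
  push_cast
  field_simp
  ring

/-- The derivative of `z ^ (-(m + k))` cancels the linear term of the branching equation; only the
offspring term survives. -/
theorem hasDerivWithinAt_psi {m : ℕ} {l z : ℂ} {ℓ : ℂ → ℂ} {φ : Fin m → ℂ → ℂ} {s : Set ℂ}
    (hz : z ≠ 0) (k : Fin m)
    (hφ : HasDerivWithinAt (fun w => φ k (negConjPow l ℓ w))
      (-(((m : ℂ) + k.val) * (offspringGF (fun j => φ j (negConjPow l ℓ z)) k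
        - φ k (negConjPow l ℓ z))) / z) s z) :
    HasDerivWithinAt (psi l ℓ φ k) (-((m : ℂ) + k.val) * psiCoeff m k.val
      * (offspringGF (fun j => φ j (negConjPow l ℓ z)) k / z ^ (m + k.val + 1))) s z := by
  have hp := (hasDerivAt_pow (m + k.val) z).hasDerivWithinAt (s := s)
  have hzp : z ^ (m + k.val) ≠ 0 := pow_ne_zero _ hz
  refine ((hφ.div hp hzp).const_mul (psiCoeff m k.val)).congr_deriv ?_
  have hpos : m + k.val ≠ 0 := by have := k.isLt; omega
  have e : z ^ (m + k.val) = z ^ (m + k.val - 1) * z := (pow_sub_one_mul hpos z).symm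
  rw [pow_succ z (m + k.val), e]
  have hzq : z ^ (m + k.val - 1) ≠ 0 := pow_ne_zero _ hz
  push_cast
  field_simp
  ring

theorem hasDerivWithinAt_psi_of_lt {m : ℕ} (hm : 2 ≤ m) {l z : ℂ} {ℓ : ℂ → ℂ}
    {φ : Fin m → ℂ → ℂ} {s : Set ℂ} (hz : z ≠ 0)
    (hφ : ∀ k, HasDerivWithinAt (fun w => φ k (negConjPow l ℓ w))
      (-(((m : ℂ) + k.val) * (offspringGF (fun j => φ j (negConjPow l ℓ z)) k
        - φ k (negConjPow l ℓ z))) / z) s z) (k : ℕ) (hk' : k < m) (hk : k + 1 < m) :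
    HasDerivWithinAt (psi l ℓ φ ⟨k, hk'⟩) (psi l ℓ φ ⟨k + 1, hk⟩ z) s z := by
  refine (hasDerivWithinAt_psi hz ⟨k, hk'⟩ (hφ _)).congr_deriv ?_
  rw [offspringGF_of_lt _ hk, psi, psiCoeff_succ hm]
  rfl

theorem hasDerivWithinAt_psi_last {m : ℕ} (hm : 2 ≤ m) {l z : ℂ} {ℓ : ℂ → ℂ}
    {φ : Fin m → ℂ → ℂ} {s : Set ℂ} (hz : z ≠ 0)
    (hφ : ∀ k, HasDerivWithinAt (fun w => φ k (negConjPow l ℓ w))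
      (-(((m : ℂ) + k.val) * (offspringGF (fun j => φ j (negConjPow l ℓ z)) k
        - φ k (negConjPow l ℓ z))) / z) s z) (h0 : 0 < m) (h1 : m - 1 < m) :
    HasDerivWithinAt (psi l ℓ φ ⟨m - 1, h1⟩) (psi l ℓ φ ⟨0, h0⟩ z ^ 2) s z := by
  refine (hasDerivWithinAt_psi hz ⟨m - 1, h1⟩ (hφ _)).congr_deriv ?_
  have hlast : ¬ (m - 1) + 1 < m := by omega
  have hpow : z ^ (m + (m - 1) + 1) = (z ^ (m + 0)) ^ 2 := by
    rw [← pow_mul]; congr 1; omega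
  rw [offspringGF_of_not_lt _ hlast, psi, mul_pow, div_pow, psiCoeff_zero_sq hm]
  simp only [hpow]

/-- Each differentiation needs the previous identity near the point, not just at it; the open set
`O` provides this. -/
theorem iteratedDerivWithin_eq_of_chain {ψ : ℕ → ℂ → ℂ} {s O : Set ℂ} (hO : IsOpen O) {n : ℕ}
    (hs : ∀ w ∈ s, UniqueDiffWithinAt ℂ s w)
    (hψ : ∀ k < n, ∀ w ∈ O ∩ s, HasDerivWithinAt (ψ k) (ψ (k + 1) w) s w) :
    ∀ k ≤ n, ∀ w ∈ O ∩ s, iteratedDerivWithin k (ψ 0) s w = ψ k w := by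
  intro k
  induction k with
  | zero => intro _ w _; simp
  | succ k ih =>
    intro hk w hw
    rw [iteratedDerivWithin_succ]
    refine HasDerivWithinAt.derivWithin ?_ (hs w hw.2)
    refine (hψ k (by omega) w hw).congr_of_eventuallyEq ?_ (ih (by omega) w hw)
    filter_upwards [inter_mem_nhdsWithin s (hO.mem_nhds hw.1)] with y hy
    exact ih (by omega) y ⟨hy.2, hy.1⟩

/-- The differential system for the functions `psi`, from the branching equation along the curve
`negConjPow l ℓ`. -/
theorem psi_system {m : ℕ} (hm : 2 ≤ m) {l : ℂ} {ℓ : ℂ → ℂ} {φ : Fin m → ℂ → ℂ} {s O : Set ℂ}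
    (hO : IsOpen O) (hO0 : ∀ w ∈ O, w ≠ 0) (hs : ∀ w ∈ s, UniqueDiffWithinAt ℂ s w)
    (hφ : ∀ w ∈ O ∩ s, ∀ k, HasDerivWithinAt (fun w => φ k (negConjPow l ℓ w))
      (-(((m : ℂ) + k.val) * (offspringGF (fun j => φ j (negConjPow l ℓ w)) k
        - φ k (negConjPow l ℓ w))) / w) s w) {z : ℂ} (hz : z ∈ O ∩ s)
    (h0 : 0 < m) (hlast : m - 1 < m) :
    (∀ (k : ℕ) (hk' : k < m) (hk : k + 1 < m),
      HasDerivWithinAt (psi l ℓ φ ⟨k, hk'⟩) (psi l ℓ φ ⟨k + 1, hk⟩ z) s z) ∧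
    HasDerivWithinAt (psi l ℓ φ ⟨m - 1, hlast⟩) (psi l ℓ φ ⟨0, h0⟩ z ^ 2) s z ∧
    iteratedDerivWithin m (psi l ℓ φ ⟨0, h0⟩) s z = psi l ℓ φ ⟨0, h0⟩ z ^ 2 := by
  have h1 := fun (w : ℂ) (hw : w ∈ O ∩ s) => hasDerivWithinAt_psi_of_lt hm (hO0 w hw.1) (hφ w hw)
  have h2 := fun (w : ℂ) (hw : w ∈ O ∩ s) => hasDerivWithinAt_psi_last hm (hO0 w hw.1) (hφ w hw) h0 hlast
  refine ⟨h1 z hz, h2 z hz, ?_⟩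
  have h := iteratedDerivWithin_eq_of_chain (n := m) hO hs
    -- The chain is closed at index `m` by the square of `psi` at index `0`.
    (ψ := fun k => if hk : k < m then psi l ℓ φ ⟨k, hk⟩ else fun w => psi l ℓ φ ⟨0, h0⟩ w ^ 2)
    (fun k hk w hw => ?_) m le_rfl z hz
  · simpa [h0] using h
  · by_cases hk1 : k + 1 < m
    · simpa [hk, hk1] using h1 w hw k hk hk1
    · obtain rfl : k = m - 1 := by omega
      simpa [hk, hk1] using h2 w hw

/-! ### Determinations of the logarithm and derivatives along half-lines -/

theorem hasDerivAt_of_exp_eq {U : Set ℂ} (hU : IsOpen U) {ℓ : ℂ → ℂ} (hℓ : ContinuousOn ℓ U)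
    (hexp : ∀ z ∈ U, Complex.exp (ℓ z) = z) {z : ℂ} (hz : z ∈ U) : HasDerivAt ℓ z⁻¹ z := by
  have h := HasDerivAt.of_local_left_inverse (f := Complex.exp) (g := ℓ) (a := z)
    (hℓ.continuousAt (hU.mem_nhds hz)) (Complex.hasDerivAt_exp (ℓ z)) (Complex.exp_ne_zero _)
    (by filter_upwards [hU.mem_nhds hz] with y hy using hexp y hy)
  rwa [hexp z hz] at h

theorem hasDerivAt_negConjPow {U : Set ℂ} (hU : IsOpen U) {ℓ : ℂ → ℂ} (hℓ : ContinuousOn ℓ U)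
    (hexp : ∀ z ∈ U, Complex.exp (ℓ z) = z) (l : ℂ) {z : ℂ} (hz : z ∈ U) :
    HasDerivAt (negConjPow l ℓ) (-((starRingEnd ℂ) l * negConjPow l ℓ z) / z) z := by
  refine (((hasDerivAt_of_exp_eq hU hℓ hexp hz).const_mul (-(starRingEnd ℂ) l)).cexp).congr_deriv ?_
  rw [negConjPow]; ring

theorem mem_ray_self (z : ℂ) : z ∈ ray z := ⟨1, one_pos, by simp⟩

theorem ray_eq_of_mem {z w : ℂ} (hw : w ∈ ray z) : ray w = ray z := by
  obtain ⟨r, hr, rfl⟩ := hw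
  ext y
  constructor
  · rintro ⟨q, hq, rfl⟩
    exact ⟨q * r, mul_pos hq hr, by push_cast; ring⟩
  · rintro ⟨q, hq, rfl⟩
    refine ⟨q / r, div_pos hq hr, ?_⟩
    have : (r : ℂ) ≠ 0 := by exact_mod_cast hr.ne'
    push_cast; field_simp

/-- Complex derivatives in one variable are unique at any accumulation point of the set, so a
half-line is enough. -/
theorem uniqueDiffWithinAt_ray {z : ℂ} (hz : z ≠ 0) : UniqueDiffWithinAt ℂ (ray z) z := by
  rw [uniqueDiffWithinAt_iff_accPt, accPt_iff_frequently_nhdsNE]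
  have ht : Tendsto (fun r : ℝ => (r : ℂ) * z) (𝓝[>] 1) (𝓝[≠] z) := by
    refine tendsto_nhdsWithin_iff.2 ⟨?_, ?_⟩
    · have : Continuous fun r : ℝ => (r : ℂ) * z := by fun_prop
      simpa using (this.tendsto 1).mono_left nhdsWithin_le_nhds
    · filter_upwards [self_mem_nhdsWithin] with r hr h
      have h1 : (r : ℂ) = 1 := mul_right_cancel₀ hz (by simpa using h)
      have h2 : r = 1 := by exact_mod_cast h1
      have h3 : 1 < r := hr
      linarith
  refine ht.frequently (Eventually.frequently ?_)
  filter_upwards [self_mem_nhdsWithin] with r hr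
  exact ⟨r, one_pos.trans hr, rfl⟩

theorem hasDerivWithinAt_ray {f : ℂ → ℂ} {z f' : ℂ} (hz : z ≠ 0)
    (h : HasDerivAt (fun r : ℝ => f (r * z)) (z * f') 1) : HasDerivWithinAt f f' (ray z) z := by
  rw [hasDerivWithinAt_iff_isLittleO]
  have h1 := hasDerivAt_iff_isLittleO.1 h
  have ht : Tendsto (fun w : ℂ => (w / z).re) (𝓝[ray z] z) (𝓝 1) := by
    have hc : Continuous fun w : ℂ => (w / z).re := by fun_prop
    have := (hc.tendsto z).mono_left (nhdsWithin_le_nhds (s := ray z))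
    simpa [hz] using this
  have h2 := h1.comp_tendsto ht
  have hre : ∀ w ∈ ray z, (((w / z).re : ℝ) : ℂ) * z = w := by
    rintro w ⟨r, -, rfl⟩
    rw [mul_div_assoc, div_self hz, mul_one, Complex.ofReal_re]
  refine (h2.congr' ?_ (Filter.EventuallyEq.refl _ _)).trans_isBigO ?_
  · filter_upwards [self_mem_nhdsWithin] with w hw
    simp only [Function.comp_def]
    rw [hre w hw, Complex.ofReal_one, one_mul, Complex.real_smul]
    have : (((w / z).re - 1 : ℝ) : ℂ) * (z * f') = (w - z) * f' := by
      have := hre w hw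
      push_cast
      linear_combination f' * this
    rw [this, smul_eq_mul]
  · refine Asymptotics.IsBigO.of_bound ‖z‖⁻¹ (Eventually.of_forall fun w => ?_)
    have e : (w / z).re - 1 = ((w - z) / z).re := by
      rw [sub_div, div_self hz, Complex.sub_re, Complex.one_re]
    simp only [Function.comp_def]
    rw [e, Real.norm_eq_abs, ← div_eq_inv_mul, ← norm_div]
    exact Complex.abs_re_le_norm _

/-! ### The two Laplace transforms along the curve `ζ` -/

section Laplace

variable {m : ℕ} {Ω : Fin m → Type*} [∀ k, MeasurableSpace (Ω k)] {μ : ∀ k, Measure (Ω k)}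
  {W : ∀ k, Ω k → ℂ}

theorem laplace_eq_familyTransform (z : ℂ) (k : Fin m) :
    laplace (μ k) (W k) z = familyTransform μ W (0, z) k := by
  simp [laplace, familyTransform, transform]

theorem realLaplace_eq_familyTransform (z : ℂ) (k : Fin m) :
    realLaplace (μ k) (W k) z = familyTransform μ W ((starRingEnd ℂ) z / 2, z / 2) k := by
  rw [realLaplace, familyTransform, transform, ← integral_complex_ofReal]
  refine integral_congr_ae (Eventually.of_forall fun ω => ?_)
  simp only [one_mul, Complex.ofReal_exp, Complex.inner]
  congr 1
  rw [Complex.re_eq_add_conj]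
  simp only [map_mul, Complex.conj_conj]
  ring

/-- The curve `(0, ζ)` has tangent `(0, -conj l * ζ / z)`, which is `-1 / z` times the flow field,
so the branching equation evaluates the derivative. -/
theorem hasDerivAt_laplace_comp (hW : ∀ k, Measurable (W k)) {l : ℂ}
    (heq : ∀ p : ℂ × ℂ, (starRingEnd ℂ) p.1 + p.2 ∈ laplaceDomain μ W → ∀ k,
      branchingDefect μ W l k p = 0) {ζ : ℂ → ℂ} {z : ℂ}
    (hζ : HasDerivAt ζ (-((starRingEnd ℂ) l * ζ z) / z) z)
    (hmem : ζ z ∈ laplaceDomain μ W) (k : Fin m) :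
    HasDerivAt (fun w => laplace (μ k) (W k) (ζ w))
      (-(((m : ℂ) + k.val) * (offspringGF (fun j => laplace (μ j) (W j) (ζ z)) k
        - laplace (μ k) (W k) (ζ z))) / z) z := by
  have hm' : (starRingEnd ℂ) ((0 : ℂ), ζ z).1 + ((0 : ℂ), ζ z).2 ∈ laplaceDomain μ W := by
    simpa using hmem
  have hd := hasDerivAt_familyTransform hW (p := fun w => ((0 : ℂ), ζ w)) hm'
    ((hasDerivAt_const z (0 : ℂ)).prodMk hζ) k
  have he := heq _ hm' k
  simp only [branchingDefect] at he
  simp only [laplace_eq_familyTransform]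
  refine hd.congr_deriv ?_
  linear_combination (-1 / z) * he

/-- For a real parameter `r` the conjugate of `ζ (r z)` is differentiable too, with derivative `-l *
conj ζ` at `r = 1`. The pair `(conj ζ / 2, ζ / 2)` is thus tangent to the flow run backwards; for a
complex increment of `z` this would fail. -/
theorem hasDerivWithinAt_realLaplace_comp (hW : ∀ k, Measurable (W k)) {l : ℂ}
    (heq : ∀ p : ℂ × ℂ, (starRingEnd ℂ) p.1 + p.2 ∈ laplaceDomain μ W → ∀ k,
      branchingDefect μ W l k p = 0) {ζ : ℂ → ℂ} {z : ℂ} (hz : z ≠ 0)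
    (hζ : HasDerivAt ζ (-((starRingEnd ℂ) l * ζ z) / z) z)
    (hmem : ζ z ∈ laplaceDomain μ W) (k : Fin m) :
    HasDerivWithinAt (fun w => realLaplace (μ k) (W k) (ζ w))
      (-(((m : ℂ) + k.val) * (offspringGF (fun j => realLaplace (μ j) (W j) (ζ z)) k
        - realLaplace (μ k) (W k) (ζ z))) / z) (ray z) z := by
  refine hasDerivWithinAt_ray hz ?_
  let η : ℝ → ℂ := fun r => ζ (r * z)
  have hη1 : η 1 = ζ z := by simp [η]
  have hη : HasDerivAt η (-((starRingEnd ℂ) l * ζ z)) 1 := by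
    have h1 : HasDerivAt (fun r : ℝ => (r : ℂ) * z) z 1 := by
      simpa using ((hasDerivAt_id (1 : ℝ)).ofReal_comp).mul_const z
    have h2 : HasDerivAt ζ (-((starRingEnd ℂ) l * ζ z) / z) (((1 : ℝ) : ℂ) * z) := by
      simpa using hζ
    refine (h2.comp (1 : ℝ) h1).congr_deriv ?_
    field_simp
  have hηc : HasDerivAt (fun r => (starRingEnd ℂ) (η r)) (-(l * (starRingEnd ℂ) (ζ z))) 1 := by
    have h3 := Complex.conjCLE.toContinuousLinearMap.hasFDerivAt.comp_hasDerivAt (1 : ℝ) hη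
    refine h3.congr_deriv ?_
    simp
  have hm' : (starRingEnd ℂ) ((starRingEnd ℂ) (η 1) / 2, η 1 / 2).1
      + ((starRingEnd ℂ) (η 1) / 2, η 1 / 2).2 ∈ laplaceDomain μ W := by
    simp only [hη1, map_div₀, Complex.conj_conj, Complex.conj_ofNat, add_halves]
    exact hmem
  have hd := hasDerivAt_familyTransform hW
    (p := fun r : ℝ => ((starRingEnd ℂ) (η r) / 2, η r / 2)) hm'
    ((hηc.div_const 2).prodMk (hη.div_const 2)) k
  have he := heq _ hm' k
  simp only [branchingDefect, hη1] at he
  simp only [realLaplace_eq_familyTransform]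
  refine hd.congr_deriv ?_
  rw [mul_div_cancel₀ _ hz, hη1]
  linear_combination -he

end Laplace

end BTree

theorem mainTheorem8 (m : ℕ) (hm : 2 ≤ m) (l : ℂ) (hl : BTree.IsSecondEigenvalue m l)
    (hlarge : 1 / 2 < l.re)
    {Ω : Fin m → Type*} [∀ k, MeasurableSpace (Ω k)]
    (μ : ∀ k, Measure (Ω k)) [∀ k, IsProbabilityMeasure (μ k)]
    (L : ∀ k, ℝ≥0 → Ω k → BTree.State m)
    (hL : ∀ k, BTree.IsFringeProcess (μ k) (Pi.single k 1) (L k)) :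
    -- the limit variables `W_k` exist, and their Laplace transforms converge near `0`
    ∃ W : ∀ k, Ω k → ℂ, (∀ k, BTree.IsLimitVariable (μ k) l (L k) (W k)) ∧
      (0 : ℂ) ∈ BTree.laplaceDomain μ W ∧
      -- for every determination `ℓ` of the logarithm on an open set `U`
      ∀ (U : Set ℂ) (ℓ : ℂ → ℂ), IsOpen U → ContinuousOn ℓ U →
        (∀ z ∈ U, Complex.exp (ℓ z) = z) →
      ∀ z ∈ U, BTree.negConjPow l ℓ z ∈ BTree.laplaceDomain μ W →
        -- Hermitian product: holomorphic functions, complex derivatives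
        (let ψ := BTree.psi l ℓ (fun k => BTree.laplace (μ k) (W k));
          (∀ (k : ℕ) (hk : k + 1 < m),
            HasDerivAt (ψ ⟨k, by omega⟩) (ψ ⟨k + 1, hk⟩ z) z) ∧
          HasDerivAt (ψ ⟨m - 1, by omega⟩) (ψ ⟨0, by omega⟩ z ^ 2) z ∧
          iteratedDeriv m (ψ ⟨0, by omega⟩) z = ψ ⟨0, by omega⟩ z ^ 2) ∧
        -- real scalar product: derivatives along the half-line from the origin through `z`
        (let ψ := BTree.psi l ℓ (fun k => BTree.realLaplace (μ k) (W k));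
          (∀ (k : ℕ) (hk : k + 1 < m),
            HasDerivWithinAt (ψ ⟨k, by omega⟩) (ψ ⟨k + 1, hk⟩ z) (BTree.ray z) z) ∧
          HasDerivWithinAt (ψ ⟨m - 1, by omega⟩) (ψ ⟨0, by omega⟩ z ^ 2) (BTree.ray z) z ∧
          iteratedDerivWithin m (ψ ⟨0, by omega⟩) (BTree.ray z) z = ψ ⟨0, by omega⟩ z ^ 2) := by
  have hv := BTree.isEigenweight_eigenCoeff hm hl.hasEigenvalue
  choose W hWm hW using fun k => (hL k).ae_tendsto_scaledForm hv hlarge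
  have h0 : (0 : ℂ) ∈ BTree.laplaceDomain μ W := by
    choose ε hε hint using fun k =>
      (hL k).exists_integrable_exp_limit hv hlarge (hWm k) (hW k)
    obtain ⟨δ, hδ, hδε⟩ : ∃ δ > 0, ∀ k, δ ≤ ε k := by
      have : Nonempty (Fin m) := ⟨⟨0, by omega⟩⟩
      refine ⟨Finset.univ.inf' Finset.univ_nonempty ε, ?_, fun k =>
        Finset.inf'_le _ (Finset.mem_univ k)⟩
      exact (Finset.lt_inf'_iff _).2 fun k _ => hε k
    refine mem_interior.2 ⟨Metric.ball 0 δ, fun z hz => ?_, Metric.isOpen_ball,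
      Metric.mem_ball_self hδ⟩
    have h : ∀ k, Integrable (fun ω => Real.exp (inner ℝ z (W k ω))) (μ k) := fun k => by
      have hk := hint k z ((mem_ball_zero_iff.1 hz).le.trans (hδε k))
      have e : ∀ w : ℂ, inner ℝ z w = (z * (starRingEnd ℂ) w).re := fun w => by
        simp [Complex.inner]; ring
      simpa only [e] using hk
    exact h
  have heq : ∀ p : ℂ × ℂ, (starRingEnd ℂ) p.1 + p.2 ∈ BTree.laplaceDomain μ W → ∀ k,
      BTree.branchingDefect μ W l k p = 0 := fun p hp k =>
    BTree.branchingDefect_eq_zero_of_fringe hL hWm hW h0 hp k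
  refine ⟨W, fun k => ⟨hWm k, ?_⟩, h0, fun U ℓ hU hℓ hexp z hz hzD => ?_⟩
  · filter_upwards [hW k] with ω hω
    simpa only [BTree.eigenform_gaps, BTree.scaledForm] using hω
  have hζ := fun w hw => BTree.hasDerivAt_negConjPow hU hℓ hexp l (z := w) hw
  -- The points where the equations are claimed form an open set, since `negConjPow` is continuous
  -- on `U` and the domain is an interior.
  let O : Set ℂ := U ∩ BTree.negConjPow l ℓ ⁻¹' BTree.laplaceDomain μ W
  have hO : IsOpen O := ContinuousOn.isOpen_inter_preimage
    (fun w hw => (hζ w hw).continuousAt.continuousWithinAt) hU isOpen_interior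
  have hU0 : ∀ w ∈ U, w ≠ 0 := fun w hw h => Complex.exp_ne_zero (ℓ w) (by rw [hexp w hw, h])
  have hO0 : ∀ w ∈ O, w ≠ 0 := fun w hw => hU0 w hw.1
  have h0 : 0 < m := by omega
  have hlast : m - 1 < m := by omega
  constructor
  · have h := BTree.psi_system hm (l := l) (ℓ := ℓ) (s := Set.univ)
      (φ := fun k => BTree.laplace (μ k) (W k)) hO hO0 (fun w _ => uniqueDiffWithinAt_univ)
      (fun w hw k => (BTree.hasDerivAt_laplace_comp hWm heq (hζ w hw.1.1) hw.1.2
        k).hasDerivWithinAt) (z := z) ⟨⟨hz, hzD⟩, Set.mem_univ z⟩ h0 hlast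
    refine ⟨fun k hk => ?_, ?_⟩
    · simpa only [hasDerivWithinAt_univ] using h.1 k (k.lt_succ_self.trans hk) hk
    · simpa only [hasDerivWithinAt_univ, iteratedDerivWithin_univ] using h.2
  · have h := BTree.psi_system hm (l := l) (ℓ := ℓ) (s := BTree.ray z)
      (φ := fun k => BTree.realLaplace (μ k) (W k)) hO hO0 (fun w hw => ?_) (fun w hw k => ?_)
      ⟨⟨hz, hzD⟩, BTree.mem_ray_self z⟩ h0 hlast
    · exact ⟨fun k hk => h.1 k (k.lt_succ_self.trans hk) hk, h.2⟩
    · have hw0 : w ≠ 0 := by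
        obtain ⟨r, hr, rfl⟩ := hw
        exact mul_ne_zero (by exact_mod_cast hr.ne') (hU0 z hz)
      -- The half-line is the same seen from each of its points, so the statements at the base point
      -- of a ray apply at every `w` on it.
      rw [← BTree.ray_eq_of_mem hw]
      exact BTree.uniqueDiffWithinAt_ray hw0
    · rw [← BTree.ray_eq_of_mem hw.2]
      exact BTree.hasDerivWithinAt_realLaplace_comp hWm heq (hO0 w hw.1) (hζ w hw.1.1) hw.1.2 k
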